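/- **Setting.** A graph in the plane is a set of edges, an edge being an unordered pair of distinct complex numbers (drawn as a straight segment). A directed edge $\vec e=(z,w)$ has tail $t(\vec e)=z$, head $h(\vec e)=w$, reversal $-\vec e=(w,z)$ and underlying edge $e$; $\vec G$ is the set of directed edges of $G$. Let $\Gamma$ be an infinite isoradial graph in the plane with circumradius $\rho>0$: every edge $e$ of $\Gamma$ is a diagonal of a nondegenerate rhombus of side length $\rho$, whose other diagonal is the dual edge, and these rhombi form a locally finite edge-to-edge tiling of $\mathbb C$ in which the vertices of $\Gamma$ and the dual vertices are different corners. Let $\theta_e$ be the angle between $e$ and the sides of its rhombus, and assume that there are constants $k,K$ with $0<k\le\theta_e\le K<\pi$ for all edges $e$ of $\Gamma$. For $\beta\in(0,1]$ let $$x_e(\beta)=\tanh(\beta J_e),\qquad \tanh J_e=\tan(\theta_e/2);$$ these weights are critical for $\beta=1$ and supercritical for $0<\beta<1$. Put $\angle(\vec e,\vec g)=\operatorname{Arg}\frac{h(\vec g)-t(\vec g)}{h(\vec e)-t(\vec e)}\in(-\pi,\pi]$. For a subgraph $G$ of $\Gamma$ (a subset of its edges) let $T=\mathrm{Id}-\Lambda$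 be the Kac–Ward operator on $\ell^2(\vec G)$, where $\Lambda_{\vec e,\vec g}=x_e e^{\frac i2\angle(\vec e,\vec g)}$ if $h(\vec e)=t(\vec g)$ and $\vec g\ne-\vec e$, and $\Lambda_{\vec e,\vec g}=0$ otherwise. Let $\mathcal W_r(\vec e,\vec g)$ be the set of non-backtracking walks of length $r$ in $G$ from $\vec e$ to $\vec g$, i.e. of sequences $\omega=(\vec e_0,\dots,\vec e_r)$ in $\vec G$ with $\vec e_0=\vec e$, $\vec e_r=\vec g$, and $h(\vec e_i)=t(\vec e_{i+1})$, $\vec e_{i+1}\neq-\vec e_i$ for $0\le i<r$. Their weights are $$w(\omega)=\exp\Big(\tfrac i2\sum_{i=0}^{r-1}\angle(\vec e_i,\vec e_{i+1})\Big)\prod_{i=0}^{r-1}x_{e_i}.$$ Let $d(\vec e,\vec g)\in\{0,1,2,\dots,\infty\}$ be the length of a shortest such walk. **Theorem.** All sets $\mathcal W_r(\vec e,\vec g)$ are finite, and the following hold. 1. If the weights are supercritical and $G$ is any subgraph of $\Gamma$, or the weights are critical and $G$ is a finite subgraph of $\Gamma$, then $T$ is a bounded operator on $\ell^2(\vec G)$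 with a bounded two-sided inverse, which is given by the matrix $$T^{-1}_{\vec e,\vec g}=\sum_{r=d(\vec e,\vec g)}^{\infty}\ \sum_{\omega\in\mathcal W_r(\vec e,\vec g)}w(\omega),$$ where the series over $r$ converges absolutely (and is $0$ if there is no walk from $\vec e$ to $\vec g$). 2. For every $\beta\in(0,1)$ there are constants $C>0$ and $\varepsilon\in(0,1)$, depending only on $\beta$ and $\Gamma$, such that for every subgraph $G$ of $\Gamma$, for the weights $x(\beta)$, $$\Big|\sum_{\omega\in\mathcal W_r(\vec e,\vec g)}w(\omega)\Big|\le C\varepsilon^r\qquad\text{for all }\vec e,\vec g\in\vec G\text{ and all } r\ge 0.$$ 3. If $G=\Gamma$ and the weights are critical, then $T$ is a bounded operator on $\ell^2(\vec\Gamma)$ that has no bounded inverse, not even a bounded left inverse. -/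

import Mathlib

open scoped Real

noncomputable section

namespace KacWard

/-!
## Graphs in the plane

A graph whose edges are unordered pairs of distinct complex numbers, identified with its set of
edges, is a `SimpleGraph ℂ`; its vertices are the endpoints of its edges (a complex number without
neighbours is not a vertex and plays no role). Subgraphs are given by `≤`, that is, by inclusion of
edge sets. The directed edges are the darts `e : G.Dart`, with tail `e.fst`, head `e.snd`,
reversal `e.symm` and underlying undirected edge `e.edge`.
-/

/-! ### Isoradial graphs -/

/-- The two remaining corners of the rhombus of side length `ρ` that has the edge `e` as a
diagonal, that is, the points at distance `ρ` from both endpoints of `e`. In an isoradial graph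
these are the circumcenters of the two faces on the two sides of `e`, i.e. the endpoints of the dual
edge of `e`. -/
def dualCorners (ρ : ℝ) (e : Sym2 ℂ) : Set ℂ := {a | ∀ z ∈ e, dist a z = ρ}

/-- The corners of the rhombus of side length `ρ` associated with the edge `e`. -/
def corners (ρ : ℝ) (e : Sym2 ℂ) : Set ℂ := {z | z ∈ e} ∪ dualCorners ρ e

/-- The (closed, filled) rhombus of side length `ρ` associated with the edge `e`. -/
def rhombus (ρ : ℝ) (e : Sym2 ℂ) : Set ℂ := convexHull ℝ (corners ρ e)

/-- `Γ` is an infinite isoradial graph with common circumradius `ρ`: every edge is a diagonal of a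
nondegenerate rhombus of side length `ρ`, whose other diagonal is the dual edge, and these rhombi
form a locally finite edge-to-edge tiling of the plane. -/
structure IsIsoradial (Γ : SimpleGraph ℂ) (ρ : ℝ) : Prop where
  radius_pos : 0 < ρ
  /-- The rhombi are nondegenerate. -/
  dist_lt : ∀ z w, Γ.Adj z w → dist z w < 2 * ρ
  /-- Two different rhombi are disjoint or share exactly a corner or exactly a side. -/
  inter_eq : ∀ e ∈ Γ.edgeSet, ∀ f ∈ Γ.edgeSet, e ≠ f →
    rhombus ρ e ∩ rhombus ρ f = convexHull ℝ (corners ρ e ∩ corners ρ f)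
  /-- The vertices of the graph and of its dual are different corners of the tiling. -/
  vertex_notMem_dual : ∀ e ∈ Γ.edgeSet, ∀ f ∈ Γ.edgeSet, ∀ z ∈ e, z ∉ dualCorners ρ f
  /-- The rhombi cover the plane. -/
  cover : ∀ p : ℂ, ∃ e ∈ Γ.edgeSet, p ∈ rhombus ρ e
  /-- Only finitely many edges have an endpoint in a given bounded region. -/
  locallyFinite : ∀ R : ℝ, {e ∈ Γ.edgeSet | ∃ z ∈ e, ‖z‖ ≤ R}.Finite

/-- The angle `θ_e` between the edge `e` and the sides of its rhombus of side length `ρ`: half of the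
diagonal `e` is the leg adjacent to `θ_e` in a right triangle with hypotenuse `ρ`. -/
def edgeAngle (ρ : ℝ) : Sym2 ℂ → ℝ :=
  Sym2.lift ⟨fun z w => Real.arccos (dist z w / (2 * ρ)), fun z w => by simp only [dist_comm]⟩

/-- `edgeAngle` is the angle at an endpoint of the edge between the edge and a side of its
rhombus. -/
theorem edgeAngle_eq_angle {ρ : ℝ} (hρ : 0 < ρ) {z w a : ℂ} (hzw : z ≠ w)
    (ha : a ∈ dualCorners ρ s(z, w)) : edgeAngle ρ s(z, w) = EuclideanGeometry.angle w z a := by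
  have h1 : dist a z = ρ := ha z (Sym2.mem_mk_left z w)
  have h2 : dist a w = ρ := ha w (Sym2.mem_mk_right z w)
  have hd : 0 < dist z w := dist_pos.mpr hzw
  have h := EuclideanGeometry.law_cos w z a
  rw [dist_comm w a, h2, h1, dist_comm w z] at h
  have hc : dist z w / (2 * ρ) = Real.cos (EuclideanGeometry.angle w z a) := by
    rw [div_eq_iff (by positivity)]
    have : dist z w * (dist z w - Real.cos (EuclideanGeometry.angle w z a) * (2 * ρ)) = 0 := by
      linarith
    rcases mul_eq_zero.mp this with h | h <;> linarith
  change Real.arccos (dist z w / (2 * ρ)) = _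
  rw [hc, Real.arccos_cos (EuclideanGeometry.angle_nonneg _ _ _)
    (EuclideanGeometry.angle_le_pi _ _ _)]

/-- The coupling constant `J_e`, defined by `tanh J_e = tan (θ_e / 2)`. -/
def coupling (ρ : ℝ) (e : Sym2 ℂ) : ℝ := Real.artanh (Real.tan (edgeAngle ρ e / 2))

/-- The edge weights `x_e(β) = tanh (β J_e)` at inverse temperature `β`; they are critical for
`β = 1` and supercritical for `0 < β < 1`. -/
def weight (ρ β : ℝ) (e : Sym2 ℂ) : ℝ := Real.tanh (β * coupling ρ e)

/-! ### The Kac-Ward operator and non-backtracking walks -/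

variable {G : SimpleGraph ℂ}

/-- The turning angle from `e` to `g`, in `(-π, π]`. -/
def turningAngle (e g : G.Dart) : ℝ := Complex.arg ((g.snd - g.fst) / (e.snd - e.fst))

open Classical in
/-- The Kac-Ward transition matrix for the edge weights `x`. -/
def transition (x : Sym2 ℂ → ℝ) (e g : G.Dart) : ℂ :=
  if e.snd = g.fst ∧ g ≠ e.symm then
    (x e.edge : ℂ) * Complex.exp (Complex.I / 2 * (turningAngle e g : ℂ))
  else 0

open Classical in
/-- The Kac-Ward matrix: the identity matrix minus the transition matrix. -/
def kacWardMatrix (G : SimpleGraph ℂ) (x : Sym2 ℂ → ℝ) (e g : G.Dart) : ℂ :=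
  (if e = g then 1 else 0) - transition x e g

/-- The Hilbert space `ℓ²` over the directed edges of `G`. -/
abbrev EdgeSpace (G : SimpleGraph ℂ) : Type := lp (fun _ : G.Dart => ℂ) 2

/-- The bounded operator `A` on `ℓ²` acts as multiplication by the matrix `M`. This determines `A` as
well as `M`. -/
def HasMatrix (A : EdgeSpace G →L[ℂ] EdgeSpace G) (M : G.Dart → G.Dart → ℂ) : Prop :=
  ∀ (φ : EdgeSpace G) (e : G.Dart), HasSum (fun g => M e g * φ g) (A φ e)

/-- The non-backtracking walks of length `r` in `G` from `e` to `g`, as sequences of `r + 1` directed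
edges. -/
def walks (G : SimpleGraph ℂ) (r : ℕ) (e g : G.Dart) : Set (Fin (r + 1) → G.Dart) :=
  {ω | ω 0 = e ∧ ω (Fin.last r) = g ∧
    ∀ i : Fin r, (ω i.castSucc).snd = (ω i.succ).fst ∧ ω i.succ ≠ (ω i.castSucc).symm}

/-- The total turning angle of a walk. -/
def totalTurning {r : ℕ} (ω : Fin (r + 1) → G.Dart) : ℝ :=
  ∑ i : Fin r, turningAngle (ω i.castSucc) (ω i.succ)

/-- The signed weight of a walk; the last edge contributes no edge weight. -/
def walkWeight (x : Sym2 ℂ → ℝ) {r : ℕ} (ω : Fin (r + 1) → G.Dart) : ℂ :=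
  Complex.exp (Complex.I / 2 * (totalTurning ω : ℂ)) *
    ∏ i : Fin r, (x (ω i.castSucc).edge : ℂ)

/-- The sum of the signed weights of all walks of length `r` from `e` to `g` (a finite sum whenever
`walks G r e g` is finite). -/
def walkSum (G : SimpleGraph ℂ) (x : Sym2 ℂ → ℝ) (r : ℕ) (e g : G.Dart) : ℂ :=
  ∑ᶠ ω ∈ walks G r e g, walkWeight x ω

/-- The length of a shortest walk from `e` to `g`, and `⊤` if there is no walk. -/
def walkDist (G : SimpleGraph ℂ) (e g : G.Dart) : ℕ∞ :=
  ⨅ (r : ℕ) (_ : (walks G r e g).Nonempty), (r : ℕ∞)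

/-- The Kac-Ward matrix of `G` for the weights `x` defines a bounded operator on `ℓ²` which has a
bounded two-sided inverse, and the inverse is given by the matrix whose entries are the sums over the
non-backtracking walks, grouped by length. -/
def InverseIsWalkSeries (G : SimpleGraph ℂ) (x : Sym2 ℂ → ℝ) : Prop :=
  ∃ (T S : EdgeSpace G →L[ℂ] EdgeSpace G) (M : G.Dart → G.Dart → ℂ),
    HasMatrix T (kacWardMatrix G x) ∧ T * S = 1 ∧ S * T = 1 ∧ HasMatrix S M ∧
    ∀ e g : G.Dart,
      HasSum (fun r : {r : ℕ // walkDist G e g ≤ (r : ℕ∞)} => walkSum G x r e g) (M e g)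

end KacWard

end

noncomputable section

namespace KacWard

/-! ### Geometry of a single rhombus -/

/-! The value of Λφ at a directed edge e involves φ only on the edges leaving the head of e. Hence Λ
splits into one finite block per vertex z, from functions on the edges out of z to functions on the
edges into z, and norms can be estimated vertex by vertex. Conjugation by the diagonal operator √x
replaces the weight x_e by √x_e √x_g. Turning from wz to zw' differs from the difference of the
directions of zw' and zw by ±π, so halving the angle produces a factor ±i, and the conjugated block
is Hermitian (`exp_half_arg`).

The norm of a Hermitian block is read off its quadratic form, which here is four times the signed
area of a polygon. A discrete isoperimetric inequality (`area_form_le`) shows that the block has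
norm at most s as soon as ∑ arctan(x/s) ≤ π/2 (`sum_norm_block_le`). The critical weight is
tan(θ/2), with arctangent θ/2; the rhombi at a vertex fill the full angle, which gives ∑ θ = π
(`sum_edgeAngle`). So the critical blocks are contractions, exactly at the borderline.

For β < 1 every vertex has an edge with θ ≤ π/3, on which the arctangent drops by a fixed amount.
Since degrees are at most π/k, one s < 1 serves all vertices and all subgraphs
(`exists_uniform_contraction`). The Neumann series then converges geometrically, and the entries of
Λ^r are the walk sums (`pow_entry`).

On a finite graph at criticality, an eigenvector with eigenvalue of modulus at least 1 would make
every block isometric on it. At a rightmost vertex of its support an edge of Γ pointing to the right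
plays no role, and the block without that edge is a strict contraction (`no_eigenvector`). So the
spectral radius is below 1.

On all of Γ at criticality, sin(θ_e/2) is fixed by Λ, as one sees by integrating exp(it/2) over the
sectors at a vertex (`sum_exp_mul_sin`). Multiplied by a slowly varying cutoff it lies in ℓ² and is
an approximate null vector of T, so T is not bounded below (`critical_full`). -/

/-- The closed cone at the endpoint `0` of the rhombus of side length `ρ` with diagonal `d`. -/
def cone (ρ : ℝ) (d : ℂ) : Set ℂ := {u | ‖u‖ * ‖d‖ ^ 2 ≤ 2 * ρ * (u * (starRingEnd ℂ) d).re}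

/-- The tangent of the angle between the edge `zw` and the sides of its rhombus. -/
def slope (ρ : ℝ) (z w : ℂ) : ℝ := √(4 * ρ ^ 2 - ‖w - z‖ ^ 2) / ‖w - z‖

/-- A dual corner of the rhombus of the edge `zw`; the other one is obtained by negating `t`. -/
def sideCorner (z w : ℂ) (t : ℝ) : ℂ := (z + w) / 2 + (w - z) / 2 * (Complex.I * t)

section Rhombus

variable {ρ : ℝ} {z w : ℂ}

theorem slope_pos (hzw : z ≠ w) (hd : dist z w < 2 * ρ) : 0 < slope ρ z w := by
  have h1 : 0 < ‖w - z‖ := norm_pos_iff.2 (sub_ne_zero.2 hzw.symm)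
  rw [dist_comm, dist_eq_norm] at hd
  exact div_pos (Real.sqrt_pos.2 (by nlinarith)) h1

theorem slope_sq (hzw : z ≠ w) (hd : dist z w < 2 * ρ) :
    (slope ρ z w ^ 2 + 1) * ‖w - z‖ ^ 2 = 4 * ρ ^ 2 := by
  have h1 : 0 < ‖w - z‖ := norm_pos_iff.2 (sub_ne_zero.2 hzw.symm)
  rw [dist_comm, dist_eq_norm] at hd
  rw [slope, div_pow, Real.sq_sqrt (by nlinarith)]
  field_simp
  ring

theorem two_re_dualCorner {a : ℂ} (ha : a ∈ dualCorners ρ s(z, w)) :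
    2 * ((a - z) * (starRingEnd ℂ) (w - z)).re = ‖w - z‖ ^ 2 := by
  have h1 : dist a z = ρ := ha z (Sym2.mem_mk_left z w)
  have h2 : dist a w = ρ := ha w (Sym2.mem_mk_right z w)
  rw [dist_eq_norm] at h1 h2
  have h : ‖a - z‖ ^ 2 = ‖a - w‖ ^ 2 := by rw [h1, h2]
  simp only [← Complex.normSq_eq_norm_sq, Complex.normSq_apply, Complex.sub_re, Complex.sub_im,
    Complex.mul_re, Complex.conj_re, Complex.conj_im] at *
  linarith

theorem convex_sub_mem_cone (ρ : ℝ) (z d : ℂ) : Convex ℝ {p : ℂ | p - z ∈ cone ρ d} := by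
  intro p hp q hq a b ha hb hab
  simp only [cone, Set.mem_ofPred_eq] at *
  have e : a • p + b • q - z = a • (p - z) + b • (q - z) := by
    have : (a : ℂ) + b = 1 := by exact_mod_cast hab
    simp only [Complex.real_smul]
    linear_combination z * this
  have h1 : ‖a • (p - z) + b • (q - z)‖ ≤ a * ‖p - z‖ + b * ‖q - z‖ := by
    refine (norm_add_le _ _).trans ?_
    rw [norm_smul, norm_smul, Real.norm_of_nonneg ha, Real.norm_of_nonneg hb]
  have h2 : ((a • (p - z) + b • (q - z)) * (starRingEnd ℂ) d).re =
      a * ((p - z) * (starRingEnd ℂ) d).re + b * ((q - z) * (starRingEnd ℂ) d).re := by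
    rw [add_mul, smul_mul_assoc, smul_mul_assoc, Complex.add_re, Complex.smul_re, Complex.smul_re]
    rfl
  rw [e, h2]
  linarith [mul_le_mul_of_nonneg_right h1 (sq_nonneg ‖d‖), mul_le_mul_of_nonneg_left hp ha,
    mul_le_mul_of_nonneg_left hq hb]

theorem sub_mem_cone_of_mem_corners (hρ : 0 < ρ) (hd : dist z w < 2 * ρ) {p : ℂ}
    (hp : p ∈ corners ρ s(z, w)) : p - z ∈ cone ρ (w - z) := by
  rw [dist_comm, dist_eq_norm] at hd
  rcases hp with hp | hp
  · rcases Sym2.mem_iff.1 hp with rfl | rfl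
    · simp [cone]
    · simp only [cone, Set.mem_ofPred_eq, Complex.mul_conj, Complex.ofReal_re,
        Complex.normSq_eq_norm_sq]
      nlinarith [sq_nonneg ‖p - z‖]
  · have h1 : dist p z = ρ := hp z (Sym2.mem_mk_left z w)
    have h := two_re_dualCorner hp
    rw [dist_eq_norm] at h1
    simp only [cone, Set.mem_ofPred_eq, h1]
    nlinarith

theorem rhombus_subset_cone (hρ : 0 < ρ) (hd : dist z w < 2 * ρ) {p : ℂ}
    (hp : p ∈ rhombus ρ s(z, w)) : p - z ∈ cone ρ (w - z) :=
  convexHull_min (fun _ h => sub_mem_cone_of_mem_corners hρ hd h)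
    (convex_sub_mem_cone ρ z (w - z)) hp

theorem norm_sideCorner_sub (hzw : z ≠ w) (hd : dist z w < 2 * ρ) (hρ : 0 < ρ) {t : ℝ}
    (ht : t = slope ρ z w ∨ t = -slope ρ z w) :
    ‖sideCorner z w t - z‖ = ρ ∧ ‖sideCorner z w t - w‖ = ρ := by
  have ht2 : t ^ 2 = slope ρ z w ^ 2 := by rcases ht with rfl | rfl <;> ring
  have h := slope_sq hzw hd
  rw [← ht2] at h
  have e1 : sideCorner z w t - z = (w - z) / 2 * (1 + Complex.I * t) := by
    simp only [sideCorner]; ring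
  have e2 : sideCorner z w t - w = (w - z) / 2 * (-1 + Complex.I * t) := by
    simp only [sideCorner]; ring
  constructor
  · rw [e1, ← sq_eq_sq₀ (norm_nonneg _) hρ.le, norm_mul, mul_pow, norm_div, div_pow,
      ← Complex.normSq_eq_norm_sq (1 + _), Complex.normSq_apply]
    simp
    nlinarith
  · rw [e2, ← sq_eq_sq₀ (norm_nonneg _) hρ.le, norm_mul, mul_pow, norm_div, div_pow,
      ← Complex.normSq_eq_norm_sq (-1 + _), Complex.normSq_apply]
    simp
    nlinarith

theorem sideCorner_mem (hzw : z ≠ w) (hd : dist z w < 2 * ρ) (hρ : 0 < ρ) {t : ℝ}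
    (ht : t = slope ρ z w ∨ t = -slope ρ z w) : sideCorner z w t ∈ dualCorners ρ s(z, w) := by
  obtain ⟨h1, h2⟩ := norm_sideCorner_sub hzw hd hρ ht
  intro x hx
  rcases Sym2.mem_iff.1 hx with rfl | rfl
  · rwa [dist_eq_norm]
  · rwa [dist_eq_norm]

theorem sideCorner_ne (hzw : z ≠ w) {t : ℝ} (ht : t ≠ 0) :
    sideCorner z w t ≠ sideCorner z w (-t) := by
  intro h
  simp only [sideCorner, Complex.ofReal_neg] at h
  have h3 : (w - z) * (Complex.I * t) = 0 := by linear_combination h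
  simp [sub_eq_zero, hzw.symm, ht] at h3

theorem dualCorners_eq (hzw : z ≠ w) (hd : dist z w < 2 * ρ) (hρ : 0 < ρ) :
    dualCorners ρ s(z, w) = {sideCorner z w (slope ρ z w), sideCorner z w (-slope ρ z w)} := by
  have h1 := sideCorner_mem hzw hd hρ (Or.inl rfl)
  have h2 := sideCorner_mem hzw hd hρ (Or.inr rfl)
  refine Set.Subset.antisymm (fun a ha => ?_) ?_
  · exact EuclideanGeometry.eq_of_dist_eq_of_dist_eq_of_finrank_eq_two Complex.finrank_real_complex
      hzw (sideCorner_ne hzw (slope_pos hzw hd).ne')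
      (h1 z (Sym2.mem_mk_left z w)) (h2 z (Sym2.mem_mk_left z w)) (ha z (Sym2.mem_mk_left z w))
      (h1 w (Sym2.mem_mk_right z w)) (h2 w (Sym2.mem_mk_right z w)) (ha w (Sym2.mem_mk_right z w))
  · rintro a (rfl | rfl)
    exacts [h1, h2]

theorem corners_finite (hzw : z ≠ w) (hd : dist z w < 2 * ρ) (hρ : 0 < ρ) :
    (corners ρ s(z, w)).Finite := by
  rw [corners, dualCorners_eq hzw hd hρ]
  refine Set.Finite.union ?_ (Set.toFinite _)
  refine (Set.toFinite {z, w}).subset fun x hx => ?_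
  rcases Sym2.mem_iff.1 hx with rfl | rfl <;> simp

theorem isClosed_rhombus (hzw : z ≠ w) (hd : dist z w < 2 * ρ) (hρ : 0 < ρ) :
    IsClosed (rhombus ρ s(z, w)) :=
  (corners_finite hzw hd hρ).isClosed_convexHull ℝ

theorem rhombus_subset_closedBall (hd : dist z w < 2 * ρ) (hρ : 0 < ρ) :
    rhombus ρ s(z, w) ⊆ Metric.closedBall z (2 * ρ) := by
  refine convexHull_min (fun p hp => ?_) (convex_closedBall _ _)
  rw [Metric.mem_closedBall]
  rcases hp with hp | hp
  · rcases Sym2.mem_iff.1 hp with rfl | rfl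
    · simp [hρ.le]
    · rw [dist_comm]; exact hd.le
  · rw [hp z (Sym2.mem_mk_left z w)]; linarith

/-- In the coordinate q, with origin at the midpoint of zw and unit (w - z)/2, the corners are ±1
and ±iτ with τ the slope, so the rhombus is a weighted ℓ¹ ball. -/
theorem mem_rhombus (hzw : z ≠ w) (hd : dist z w < 2 * ρ) (hρ : 0 < ρ) {q : ℂ}
    (hq : |q.re| + |q.im| / slope ρ z w ≤ 1) :
    (z + w) / 2 + (w - z) / 2 * q ∈ rhombus ρ s(z, w) := by
  have hτ := slope_pos hzw hd
  set τ := slope ρ z w with hτdef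
  set t := q.im / τ with ht
  have hq' : |q.re| + |t| ≤ 1 := by rwa [ht, abs_div, abs_of_pos hτ]
  have hC := convex_convexHull ℝ (corners ρ s(z, w))
  have hsub := subset_convexHull ℝ (corners ρ s(z, w))
  have mz : z ∈ corners ρ s(z, w) := Or.inl (Sym2.mem_mk_left z w)
  have mw : w ∈ corners ρ s(z, w) := Or.inl (Sym2.mem_mk_right z w)
  have ma : sideCorner z w τ ∈ corners ρ s(z, w) := Or.inr (sideCorner_mem hzw hd hρ (Or.inl rfl))
  have mb : sideCorner z w (-τ) ∈ corners ρ s(z, w) :=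
    Or.inr (sideCorner_mem hzw hd hρ (Or.inr rfl))
  -- The slack r is spread evenly over the four corners, so that the coefficients add up to 1.
  set r := 1 - |q.re| - |t| with hr
  let c : Fin 4 → ℝ := ![(|q.re| - q.re) / 2 + r / 4, (|q.re| + q.re) / 2 + r / 4,
    (|t| + t) / 2 + r / 4, (|t| - t) / 2 + r / 4]
  let p : Fin 4 → ℂ := ![z, w, sideCorner z w τ, sideCorner z w (-τ)]
  have key := hC.sum_mem (t := Finset.univ) (w := c) (z := p) ?_ ?_ ?_
  · have e : (z + w) / 2 + (w - z) / 2 * q = ∑ i, c i • p i := ?_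
    · rw [e]; exact key
    have hqe : q = (q.re : ℂ) + (t : ℂ) * τ * Complex.I := by
      apply Complex.ext <;> simp [ht, div_mul_cancel₀ _ hτ.ne']
    simp only [Fin.sum_univ_four, c, p, sideCorner, Matrix.cons_val, Complex.real_smul]
    push_cast
    conv_lhs => rw [hqe]
    simp only [hr]
    push_cast
    ring
  · intro i _
    have := abs_le.1 (le_refl |q.re|)
    have := abs_le.1 (le_refl |t|)
    fin_cases i
    · change 0 ≤ (|q.re| - q.re) / 2 + r / 4; linarith
    · change 0 ≤ (|q.re| + q.re) / 2 + r / 4; linarith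
    · change 0 ≤ (|t| + t) / 2 + r / 4; linarith
    · change 0 ≤ (|t| - t) / 2 + r / 4; linarith
  · simp only [Fin.sum_univ_four, c, Matrix.cons_val]
    linarith
  · intro i _
    fin_cases i
    exacts [hsub mz, hsub mw, hsub ma, hsub mb]

/-- Directions in the cone at `z` enter the rhombus. -/
theorem mem_rhombus_of_mem_cone (hzw : z ≠ w) (hd : dist z w < 2 * ρ) (hρ : 0 < ρ) {u : ℂ}
    (hu : u ∈ cone ρ (w - z)) {t : ℝ} (ht : 0 ≤ t) (htu : 2 * t * ‖u‖ ≤ ‖w - z‖) :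
    z + t * u ∈ rhombus ρ s(z, w) := by
  have hτ := slope_pos hzw hd
  have hsq := slope_sq hzw hd
  set τ := slope ρ z w with hτdef
  have hD : 0 < ‖w - z‖ := norm_pos_iff.2 (sub_ne_zero.2 hzw.symm)
  have hne : w - z ≠ 0 := sub_ne_zero.2 hzw.symm
  set v := 2 * u / (w - z) with hv
  have huv : u = v * (w - z) / 2 := by rw [hv]; field_simp
  have hnu : ‖u‖ = ‖v‖ * ‖w - z‖ / 2 := by rw [huv]; simp
  have hre : (u * (starRingEnd ℂ) (w - z)).re = v.re * ‖w - z‖ ^ 2 / 2 := by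
    rw [huv, div_mul_eq_mul_div, mul_assoc, Complex.mul_conj, Complex.normSq_eq_norm_sq]
    have : v * ((‖w - z‖ ^ 2 : ℝ) : ℂ) / 2 = ((‖w - z‖ ^ 2 / 2 : ℝ) : ℂ) * v := by push_cast; ring
    rw [this, Complex.re_ofReal_mul]; ring
  simp only [cone, Set.mem_ofPred_eq] at hu
  rw [hre, hnu] at hu
  have hu1 : ‖v‖ * ‖w - z‖ ≤ 2 * ρ * v.re := by
    have : 0 < ‖w - z‖ ^ 2 := by positivity
    nlinarith
  have hvre : 0 ≤ v.re := by
    have : 0 ≤ ‖v‖ * ‖w - z‖ := by positivity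
    by_contra! h
    nlinarith
  have hvre1 : t * v.re ≤ 1 := by
    have h1 : v.re ≤ ‖v‖ := Complex.re_le_norm v
    rw [hnu] at htu
    have : t * ‖v‖ ≤ 1 := by
      have : t * ‖v‖ * ‖w - z‖ ≤ 1 * ‖w - z‖ := by linarith
      exact le_of_mul_le_mul_right this hD
    nlinarith
  have him : |v.im| ≤ τ * v.re := by
    apply abs_le_of_sq_le_sq _ (by positivity)
    have h2 : ‖v‖ ^ 2 = v.re ^ 2 + v.im ^ 2 := by
      rw [← Complex.normSq_eq_norm_sq, Complex.normSq_apply]; ring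
    have h3 : (‖v‖ * ‖w - z‖) ^ 2 ≤ (2 * ρ * v.re) ^ 2 := by
      apply pow_le_pow_left₀ (by positivity) hu1
    have h4 : (v.re ^ 2 + v.im ^ 2) * ‖w - z‖ ^ 2 ≤ ((τ ^ 2 + 1) * v.re ^ 2) * ‖w - z‖ ^ 2 := by
      rw [← h2]; nlinarith
    have := le_of_mul_le_mul_right h4 (by positivity)
    nlinarith
  -- The vertex z is q = -1. The cone condition has become |Im v| ≤ τ Re v, and t Re v ≤ 1 keeps the
  -- point in the half of the rhombus next to z.
  have key := mem_rhombus hzw hd hρ (q := -1 + t * v) ?_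
  · have e : z + t * u = (z + w) / 2 + (w - z) / 2 * (-1 + t * v) := by rw [huv]; ring
    rw [e]; exact key
  · simp only [Complex.add_re, Complex.neg_re, Complex.one_re, Complex.re_ofReal_mul,
      Complex.add_im, Complex.neg_im, Complex.one_im, Complex.im_ofReal_mul, neg_zero, zero_add]
    rw [abs_of_nonpos (by linarith), abs_mul, abs_of_nonneg ht]
    have : t * |v.im| / τ ≤ t * v.re := by
      rw [div_le_iff₀ hτ]; nlinarith
    linarith

theorem smul_mem_cone {d u : ℂ} {t : ℝ} (ht : 0 < t) (h : (t : ℂ) * u ∈ cone ρ d) :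
    u ∈ cone ρ d := by
  simp only [cone, Set.mem_ofPred_eq] at *
  rw [norm_mul, Complex.norm_real, Real.norm_of_nonneg ht.le, mul_assoc (t : ℂ),
    Complex.re_ofReal_mul] at h
  have : t * (‖u‖ * ‖d‖ ^ 2) ≤ t * (2 * ρ * (u * (starRingEnd ℂ) d).re) := by linarith
  exact le_of_mul_le_mul_left this ht

end Rhombus

/-! ### Local structure of an isoradial graph -/

namespace IsIsoradial

variable {Γ : SimpleGraph ℂ} {ρ : ℝ}

theorem finite_neighborSet (hΓ : IsIsoradial Γ ρ) (z : ℂ) : (Γ.neighborSet z).Finite := by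
  refine Set.Finite.of_injOn (f := fun w => s(z, w)) (t := _) ?_ ?_ (hΓ.locallyFinite ‖z‖)
  · intro w hw
    exact ⟨hw, z, Sym2.mem_mk_left z w, le_rfl⟩
  · intro w _ w' _ h
    exact Sym2.congr_right.1 h

theorem mem_or_mem_dual (hΓ : IsIsoradial Γ ρ) {e f : Sym2 ℂ} (he : e ∈ Γ.edgeSet)
    (hf : f ∈ Γ.edgeSet) {p : ℂ} (hp : p ∈ corners ρ e ∩ corners ρ f) :
    (p ∈ e ∧ p ∈ f) ∨ (p ∈ dualCorners ρ e ∧ p ∈ dualCorners ρ f) := by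
  obtain ⟨h1 | h1, h2 | h2⟩ := hp
  · exact Or.inl ⟨h1, h2⟩
  · exact absurd h2 (hΓ.vertex_notMem_dual e he f hf p h1)
  · exact absurd h1 (hΓ.vertex_notMem_dual f hf e he p h2)
  · exact Or.inr ⟨h1, h2⟩

/-- With two distinct common dual corners a and b, the endpoints of both edges would all be
intersection points of the circles of radius ρ about a and b; there are only two such points. -/
theorem common_dualCorner_unique {e f : Sym2 ℂ} (he : e ∈ Γ.edgeSet)
    (hf : f ∈ Γ.edgeSet) (hef : e ≠ f) {a b : ℂ} (hae : a ∈ dualCorners ρ e)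
    (haf : a ∈ dualCorners ρ f) (hbe : b ∈ dualCorners ρ e) (hbf : b ∈ dualCorners ρ f) :
    a = b := by
  induction e using Sym2.ind with | _ z w
  induction f using Sym2.ind with | _ z' w'
  by_contra hab
  have hz := Sym2.mem_mk_left z w
  have hw := Sym2.mem_mk_right z w
  have key : ∀ x ∈ s(z', w'), x = z ∨ x = w := by
    intro x hx
    refine EuclideanGeometry.eq_of_dist_eq_of_dist_eq_of_finrank_eq_two
      Complex.finrank_real_complex hab (r₁ := ρ) (r₂ := ρ) (SimpleGraph.Adj.ne he) ?_ ?_ ?_ ?_ ?_ ?_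
    all_goals rw [dist_comm]
    exacts [hae z hz, hae w hw, haf x hx, hbe z hz, hbe w hw, hbf x hx]
  have hne : z' ≠ w' := SimpleGraph.Adj.ne hf
  apply hef
  rcases key z' (Sym2.mem_mk_left _ _) with h1 | h1 <;>
    rcases key w' (Sym2.mem_mk_right _ _) with h2 | h2
  · exact absurd (h1.trans h2.symm) hne
  · rw [h1, h2]
  · rw [h1, h2]; exact Sym2.eq_swap
  · exact absurd (h1.trans h2.symm) hne

theorem common_vertex_unique {e f : Sym2 ℂ} (hef : e ≠ f) {a b : ℂ} (hae : a ∈ e)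
    (haf : a ∈ f) (hbe : b ∈ e) (hbf : b ∈ f) : a = b := by
  by_contra hab
  exact hef (((Sym2.mem_and_mem_iff hab).1 ⟨hae, hbe⟩).trans
    ((Sym2.mem_and_mem_iff hab).1 ⟨haf, hbf⟩).symm)

/-- A vertex that lies in the rhombus of an edge is an endpoint of that edge. -/
theorem mem_edge_of_mem_rhombus (hΓ : IsIsoradial Γ ρ) {z w : ℂ} (hzw : Γ.Adj z w)
    {f : Sym2 ℂ} (hf : f ∈ Γ.edgeSet) (hz : z ∈ rhombus ρ f) : z ∈ f := by
  by_cases hef : s(z, w) = f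
  · rw [← hef]; exact Sym2.mem_mk_left z w
  have hzc : z ∈ corners ρ s(z, w) := Or.inl (Sym2.mem_mk_left z w)
  have h := hΓ.inter_eq s(z, w) hzw f hf hef
  have hmem : z ∈ convexHull ℝ (corners ρ s(z, w) ∩ corners ρ f) :=
    h ▸ ⟨subset_convexHull ℝ _ hzc, hz⟩
  have hD : 0 < ‖w - z‖ := norm_pos_iff.2 (sub_ne_zero.2 hzw.ne.symm)
  have hin : z ∈ corners ρ f := by
    by_contra hzf
    -- The open half-plane H contains every corner of the rhombus of zw except z. If z were not a
    -- corner of f, the convex hull of the common corners would lie in H and miss z.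
    let H : Set ℂ := {p | 0 < ((p - z) * (starRingEnd ℂ) (w - z)).re}
    have hH : Convex ℝ H := by
      intro p hp q hq a b ha hb hab
      simp only [H, Set.mem_ofPred_eq] at *
      have e : a • p + b • q - z = a • (p - z) + b • (q - z) := by
        have : (a : ℂ) + b = 1 := by exact_mod_cast hab
        simp only [Complex.real_smul]
        linear_combination z * this
      rw [e, add_mul, smul_mul_assoc, smul_mul_assoc, Complex.add_re, Complex.smul_re,
        Complex.smul_re, smul_eq_mul, smul_eq_mul]
      rcases ha.eq_or_lt with rfl | ha
      · rw [zero_add] at hab; rw [hab]; linarith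
      · have := mul_pos ha hp
        have := mul_nonneg hb hq.le
        linarith
    have hsub : corners ρ s(z, w) ∩ corners ρ f ⊆ H := by
      rintro p ⟨hp | hp, hpf⟩
      · rcases Sym2.mem_iff.1 hp with rfl | rfl
        · exact absurd hpf hzf
        · simp only [H, Set.mem_ofPred_eq, Complex.mul_conj, Complex.ofReal_re,
            Complex.normSq_eq_norm_sq]
          positivity
      · have := two_re_dualCorner hp
        simp only [H, Set.mem_ofPred_eq]
        have : 0 < ‖w - z‖ ^ 2 := by positivity
        linarith
    have := convexHull_min hsub hH hmem
    simp [H] at this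
  rcases hΓ.mem_or_mem_dual hzw hf ⟨hzc, hin⟩ with h | h
  · exact h.2
  · exact absurd h.1 (hΓ.vertex_notMem_dual _ hzw _ hzw z (Sym2.mem_mk_left z w))

/-- The interiors of the cones at a vertex are disjoint from the other cones. -/
theorem notMem_cone (hΓ : IsIsoradial Γ ρ) {z w w' : ℂ} (hw : Γ.Adj z w) (hw' : Γ.Adj z w')
    (hne : w ≠ w') {u : ℂ} (hu : ‖u‖ * ‖w - z‖ ^ 2 < 2 * ρ * (u * (starRingEnd ℂ) (w - z)).re) :
    u ∉ cone ρ (w' - z) := by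
  intro hu'
  have hρ := hΓ.radius_pos
  have hD : 0 < ‖w - z‖ := norm_pos_iff.2 (sub_ne_zero.2 hw.ne.symm)
  have hD' : 0 < ‖w' - z‖ := norm_pos_iff.2 (sub_ne_zero.2 hw'.ne.symm)
  have hu0 : u ≠ 0 := by rintro rfl; simp at hu
  have hun : 0 < ‖u‖ := norm_pos_iff.2 hu0
  -- Scaled down far enough, a common direction of both cones gives a point of both rhombi.
  obtain ⟨t, ht, ht1, ht2⟩ : ∃ t : ℝ, 0 < t ∧ 2 * t * ‖u‖ ≤ ‖w - z‖ ∧ 2 * t * ‖u‖ ≤ ‖w' - z‖ := by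
    refine ⟨min ‖w - z‖ ‖w' - z‖ / (2 * ‖u‖), by positivity, ?_, ?_⟩
    · have e : 2 * (min ‖w - z‖ ‖w' - z‖ / (2 * ‖u‖)) * ‖u‖ = min ‖w - z‖ ‖w' - z‖ := by field_simp
      rw [e]; exact min_le_left _ _
    · have e : 2 * (min ‖w - z‖ ‖w' - z‖ / (2 * ‖u‖)) * ‖u‖ = min ‖w - z‖ ‖w' - z‖ := by field_simp
      rw [e]; exact min_le_right _ _
  have m1 := mem_rhombus_of_mem_cone hw.ne (hΓ.dist_lt _ _ hw) hρ (u := u) hu.le ht.le ht1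
  have m2 := mem_rhombus_of_mem_cone hw'.ne (hΓ.dist_lt _ _ hw') hρ hu' ht.le ht2
  have hef : s(z, w) ≠ s(z, w') := fun h => hne (Sym2.congr_right.1 h)
  have hmem : z + t * u ∈ convexHull ℝ (corners ρ s(z, w) ∩ corners ρ s(z, w')) :=
    hΓ.inter_eq _ hw _ hw' hef ▸ ⟨m1, m2⟩
  have hzc : ∀ x, x ∈ s(z, w) ∧ x ∈ s(z, w') → x = z := fun x hx =>
    common_vertex_unique hef hx.1 hx.2 (Sym2.mem_mk_left z w) (Sym2.mem_mk_left z w')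
  -- The two rhombi share z and at most one dual corner a, so they meet in the side za or only in z.
  -- The side lies on the boundary of the cone, against the strict inequality for u.
  by_cases hA : ∃ a, a ∈ dualCorners ρ s(z, w) ∧ a ∈ dualCorners ρ s(z, w')
  · obtain ⟨a, ha, ha'⟩ := hA
    have hsub : corners ρ s(z, w) ∩ corners ρ s(z, w') ⊆ {z, a} := by
      intro p hp
      rcases hΓ.mem_or_mem_dual hw hw' hp with h | h
      · exact Or.inl (hzc p h)
      · exact Or.inr (common_dualCorner_unique hw hw' hef h.1 h.2 ha ha')
    have := convexHull_mono hsub hmem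
    rw [convexHull_pair, segment_eq_image'] at this
    obtain ⟨c, ⟨hc0, _⟩, hc⟩ := this
    have hc : (t : ℂ) * u = c * (a - z) := by
      simpa using hc.symm
    have h1 : t * ‖u‖ = c * ρ := by
      have h2 := congrArg norm hc
      rw [norm_mul, norm_mul, Complex.norm_real, Complex.norm_real, Real.norm_of_nonneg ht.le,
        Real.norm_of_nonneg hc0, ← dist_eq_norm, ha z (Sym2.mem_mk_left z w)] at h2
      exact h2
    have h3 : 2 * (t * (u * (starRingEnd ℂ) (w - z)).re) = c * ‖w - z‖ ^ 2 := by
      rw [← Complex.re_ofReal_mul, ← mul_assoc, hc, mul_assoc, Complex.re_ofReal_mul,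
        ← two_re_dualCorner ha]
      ring
    have h4 := mul_lt_mul_of_pos_left hu ht
    have h5 : t * (‖u‖ * ‖w - z‖ ^ 2) = c * ρ * ‖w - z‖ ^ 2 := by rw [← h1]; ring
    have h6 : t * (2 * ρ * (u * (starRingEnd ℂ) (w - z)).re) = ρ * (c * ‖w - z‖ ^ 2) := by
      rw [← h3]; ring
    linarith
  · have hsub : corners ρ s(z, w) ∩ corners ρ s(z, w') ⊆ {z} := by
      intro p hp
      rcases hΓ.mem_or_mem_dual hw hw' hp with h | h
      · exact hzc p h
      · exact absurd ⟨p, h⟩ hA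
    have := convexHull_mono hsub hmem
    simp [hu0, ht.ne'] at this

/-- The cones at a vertex cover the plane. -/
theorem exists_mem_cone (hΓ : IsIsoradial Γ ρ) {z w : ℂ} (hw : Γ.Adj z w) (u : ℂ) :
    ∃ w', Γ.Adj z w' ∧ u ∈ cone ρ (w' - z) := by
  have hρ := hΓ.radius_pos
  -- Follow the points z + u/(n+1) towards z. By local finiteness one rhombus contains infinitely
  -- many of them; it is closed, so it also contains z and belongs to an edge at z.
  choose F hF hFm using fun n : ℕ => hΓ.cover (z + (1 / ((n : ℝ) + 1) : ℝ) * u)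
  have hlim : Filter.Tendsto (fun n : ℕ => z + (1 / ((n : ℝ) + 1) : ℝ) * u) Filter.atTop
      (nhds z) := by
    have h1 := (Complex.continuous_ofReal.tendsto 0).comp tendsto_one_div_add_atTop_nhds_zero_nat
    have h2 := (h1.mul_const u).const_add z
    simpa using h2
  have hfin : (Set.range F).Finite := by
    refine (hΓ.locallyFinite (‖z‖ + ‖u‖ + 2 * ρ)).subset ?_
    rintro _ ⟨n, rfl⟩
    refine ⟨hF n, ?_⟩
    have h1 := hF n
    have h2 := hFm n
    generalize F n = f at h1 h2
    induction f using Sym2.ind with | _ a b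
    refine ⟨a, Sym2.mem_mk_left a b, ?_⟩
    have h3 := rhombus_subset_closedBall (hΓ.dist_lt a b h1) hρ h2
    rw [Metric.mem_closedBall, dist_eq_norm] at h3
    have h4 : ‖((1 / ((n : ℝ) + 1) : ℝ) : ℂ) * u‖ ≤ ‖u‖ := by
      rw [norm_mul, Complex.norm_real, Real.norm_of_nonneg (by positivity)]
      refine mul_le_of_le_one_left (norm_nonneg _) ?_
      rw [div_le_one (by positivity)]
      have : (0 : ℝ) ≤ n := Nat.cast_nonneg n
      linarith
    set y := ((1 / ((n : ℝ) + 1) : ℝ) : ℂ) * u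
    calc ‖a‖ = ‖z + y - (z + y - a)‖ := by congr 1; ring
      _ ≤ ‖z + y‖ + ‖z + y - a‖ := norm_sub_le _ _
      _ ≤ ‖z‖ + ‖u‖ + 2 * ρ := by linarith [norm_add_le z y]
  obtain ⟨f, hf⟩ : ∃ f, ∃ᶠ n in Filter.atTop, F n = f := by
    by_contra! h
    have h1 := (Filter.eventually_all_finite hfin).2 fun f _ => h f
    obtain ⟨n, hn⟩ := h1.exists
    exact hn (F n) ⟨n, rfl⟩ rfl
  obtain ⟨n, hn⟩ := hf.exists
  have hfe : f ∈ Γ.edgeSet := hn ▸ hF n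
  have hzf : z ∈ rhombus ρ f := by
    have hcl : IsClosed (rhombus ρ f) := by
      clear hf hn
      induction f using Sym2.ind with | _ a b
      exact isClosed_rhombus (SimpleGraph.Adj.ne hfe) (hΓ.dist_lt _ _ hfe) hρ
    exact hcl.mem_of_frequently_of_tendsto (hf.mono fun n hn => hn ▸ hFm n) hlim
  obtain ⟨w', rfl⟩ := hΓ.mem_edge_of_mem_rhombus hw hfe hzf
  refine ⟨w', hfe, ?_⟩
  have h1 := rhombus_subset_cone hρ (hΓ.dist_lt _ _ hfe) (hn ▸ hFm n)
  rw [add_sub_cancel_left] at h1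
  exact smul_mem_cone (by positivity) h1

/-- The midpoint of an edge lies in no other rhombus. -/
theorem midpoint_notMem_rhombus (hΓ : IsIsoradial Γ ρ) {z w : ℂ} (hw : Γ.Adj z w)
    {f : Sym2 ℂ} (hf : f ∈ Γ.edgeSet) (hef : s(z, w) ≠ f) : (z + w) / 2 ∉ rhombus ρ f := by
  intro hmf
  have hρ := hΓ.radius_pos
  have hlt := hΓ.dist_lt _ _ hw
  have hme : (z + w) / 2 ∈ rhombus ρ s(z, w) := by
    have := mem_rhombus hw.ne hlt hρ (q := 0) (by simp)
    simpa using this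
  have hmem : (z + w) / 2 ∈ convexHull ℝ (corners ρ s(z, w) ∩ corners ρ f) :=
    hΓ.inter_eq _ hw _ hf hef ▸ ⟨hme, hmf⟩
  have hD : 0 < ‖w - z‖ := norm_pos_iff.2 (sub_ne_zero.2 hw.ne.symm)
  have hτ := slope_pos hw.ne hlt
  -- At most one endpoint and at most one dual corner are shared. Suitable signs s and t thus give a
  -- linear functional on the two diagonals that is positive at all shared corners but zero at the
  -- midpoint.
  have key : ∃ s t : ℝ, ∀ p ∈ corners ρ s(z, w) ∩ corners ρ f,
      0 < s * ((p - (z + w) / 2) / (w - z)).re + t * ((p - (z + w) / 2) / (w - z)).im := by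
    have hne : w - z ≠ 0 := sub_ne_zero.2 hw.ne.symm
    have hs : ∃ s : ℝ, ∀ p, p ∈ s(z, w) ∧ p ∈ f → 0 < s * ((p - (z + w) / 2) / (w - z)).re := by
      by_cases h : z ∈ f
      · refine ⟨-1, fun p hp => ?_⟩
        rw [common_vertex_unique hef hp.1 hp.2 (Sym2.mem_mk_left z w) h]
        have : (z - (z + w) / 2) / (w - z) = ((-1 / 2 : ℝ) : ℂ) := by
          push_cast; field_simp; ring
        rw [this, Complex.ofReal_re]; norm_num
      · refine ⟨1, fun p hp => ?_⟩
        rcases Sym2.mem_iff.1 hp.1 with rfl | rfl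
        · exact absurd hp.2 h
        have : (p - (z + p) / 2) / (p - z) = ((1 / 2 : ℝ) : ℂ) := by
          push_cast; field_simp; ring
        rw [this, Complex.ofReal_re]; norm_num
    have hc : ∀ t : ℝ, (sideCorner z w t - (z + w) / 2) / (w - z) = ((t / 2 : ℝ) : ℂ) * Complex.I := by
      intro t; simp only [sideCorner]; push_cast; field_simp; ring
    have ht : ∃ t : ℝ, ∀ p, p ∈ dualCorners ρ s(z, w) ∧ p ∈ dualCorners ρ f →
        0 < t * ((p - (z + w) / 2) / (w - z)).im := by
      have hdu := dualCorners_eq hw.ne hlt hρ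
      by_cases h : sideCorner z w (slope ρ z w) ∈ dualCorners ρ f
      · refine ⟨1, fun p hp => ?_⟩
        rw [common_dualCorner_unique hw hf hef hp.1 hp.2 (by rw [hdu]; exact Or.inl rfl) h, hc]
        simp [hτ]
      · refine ⟨-1, fun p hp => ?_⟩
        obtain ⟨hp1, hp2⟩ := hp
        rw [hdu] at hp1
        rcases hp1 with rfl | rfl
        · exact absurd hp2 h
        · rw [hc]; simp; linarith
    obtain ⟨s, hs⟩ := hs
    obtain ⟨t, ht⟩ := ht
    refine ⟨s, t, fun p hp => ?_⟩
    rcases hΓ.mem_or_mem_dual hw hf hp with h | h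
    · have h0 : ((p - (z + w) / 2) / (w - z)).im = 0 := by
        rcases Sym2.mem_iff.1 h.1 with rfl | rfl
        · have : (p - (p + w) / 2) / (w - p) = ((-1 / 2 : ℝ) : ℂ) := by
            push_cast; field_simp; ring
          rw [this, Complex.ofReal_im]
        · have : (p - (z + p) / 2) / (p - z) = ((1 / 2 : ℝ) : ℂ) := by
            push_cast; field_simp; ring
          rw [this, Complex.ofReal_im]
      rw [h0]; linarith [hs p h]
    · have h0 : ((p - (z + w) / 2) / (w - z)).re = 0 := by
        have h1 := h.1
        rw [dualCorners_eq hw.ne hlt hρ] at h1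
        rcases h1 with rfl | rfl <;> rw [hc] <;> simp
      rw [h0]; linarith [ht p h]
  obtain ⟨s, t, hst⟩ := key
  let ℓ : ℂ → ℝ := fun p => s * ((p - (z + w) / 2) / (w - z)).re +
    t * ((p - (z + w) / 2) / (w - z)).im
  have hH : Convex ℝ {p | 0 < ℓ p} := by
    intro p hp q hq a b ha hb hab
    simp only [Set.mem_ofPred_eq] at *
    have e : (a • p + b • q - (z + w) / 2) / (w - z) =
        a • ((p - (z + w) / 2) / (w - z)) + b • ((q - (z + w) / 2) / (w - z)) := by
      have : (a : ℂ) + b = 1 := by exact_mod_cast hab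
      have hne : w - z ≠ 0 := sub_ne_zero.2 hw.ne.symm
      simp only [Complex.real_smul]
      field_simp
      linear_combination (z + w) * this
    have e2 : ℓ (a • p + b • q) = a * ℓ p + b * ℓ q := by
      simp only [ℓ, e, Complex.add_re, Complex.add_im, Complex.smul_re, Complex.smul_im,
        smul_eq_mul]
      ring
    rw [e2]
    rcases ha.eq_or_lt with rfl | ha
    · rw [zero_add] at hab; rw [hab]; linarith
    · have := mul_pos ha hp
      have := mul_nonneg hb hq.le
      linarith
  have h0 : 0 < ℓ ((z + w) / 2) := convexHull_min (fun p hp => hst p hp) hH hmem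
  simp [ℓ] at h0

end IsIsoradial

/-! ### Angle sums at a vertex -/

theorem cos_edgeAngle {ρ : ℝ} {z w : ℂ} (hρ : 0 < ρ) (hd : dist z w < 2 * ρ) :
    Real.cos (edgeAngle ρ s(z, w)) = ‖w - z‖ / (2 * ρ) := by
  change Real.cos (Real.arccos (dist z w / (2 * ρ))) = _
  have h0 : 0 ≤ dist z w / (2 * ρ) := by positivity
  rw [Real.cos_arccos (by linarith) ((div_le_one (by positivity)).2 hd.le), dist_comm,
    dist_eq_norm]

theorem edgeAngle_pos {ρ : ℝ} {z w : ℂ} (hρ : 0 < ρ) (hd : dist z w < 2 * ρ) :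
    0 < edgeAngle ρ s(z, w) :=
  Real.arccos_pos.2 ((div_lt_one (by positivity)).2 hd)

theorem edgeAngle_lt {ρ : ℝ} {z w : ℂ} (hρ : 0 < ρ) (hzw : z ≠ w) :
    edgeAngle ρ s(z, w) < π / 2 :=
  Real.arccos_lt_pi_div_two.2 (div_pos (dist_pos.2 hzw) (by positivity))

theorem sub_eq_exp_arg {c d : ℂ} (hc : c ≠ 0) :
    d = c * ((‖d‖ / ‖c‖ : ℝ) * Complex.exp ((Complex.arg (d / c) : ℝ) * Complex.I)) := by
  have h := Complex.norm_mul_exp_arg_mul_I (d / c)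
  rw [norm_div] at h
  rw [h]
  field_simp

theorem re_mul_conj_eq {c d : ℂ} (hc : c ≠ 0) (t : ℝ) :
    (c * Complex.exp (t * Complex.I) * (starRingEnd ℂ) d).re =
      ‖c‖ * ‖d‖ * Real.cos (t - Complex.arg (d / c)) := by
  have hn : ‖c‖ ≠ 0 := norm_ne_zero_iff.2 hc
  set a := Complex.arg (d / c) with ha
  have e : c * Complex.exp (t * Complex.I) * (starRingEnd ℂ) d =
      ((‖c‖ * ‖d‖ : ℝ) : ℂ) * Complex.exp (((t - a : ℝ) : ℂ) * Complex.I) := by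
    rw [sub_eq_exp_arg (d := d) hc, ← ha, map_mul, map_mul, Complex.conj_ofReal, ← Complex.exp_conj,
      map_mul, Complex.conj_ofReal, Complex.conj_I]
    have h1 : ((t - a : ℝ) : ℂ) * Complex.I = t * Complex.I + a * -Complex.I := by push_cast; ring
    have h2 : c * (starRingEnd ℂ) c = (‖c‖ : ℂ) ^ 2 := by
      rw [Complex.mul_conj, Complex.normSq_eq_norm_sq]; norm_cast
    have h3 : (‖c‖ : ℂ) ≠ 0 := by exact_mod_cast hn
    rw [h1, Complex.exp_add, norm_mul, norm_mul, Complex.norm_real, Complex.norm_exp_ofReal_mul_I]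
    simp only [Real.norm_of_nonneg (show 0 ≤ ‖d‖ / ‖c‖ by positivity)]
    push_cast
    field_simp
    linear_combination (‖d‖ : ℂ) * h2
  rw [e, Complex.re_ofReal_mul, Complex.exp_ofReal_mul_I_re]

theorem norm_mul_exp (c : ℂ) (t : ℝ) : ‖c * Complex.exp (t * Complex.I)‖ = ‖c‖ := by
  rw [norm_mul, Complex.norm_exp_ofReal_mul_I, mul_one]

section Cone

variable {ρ : ℝ} {z w c : ℂ}

theorem mem_cone_iff (hρ : 0 < ρ) (hzw : z ≠ w) (hd : dist z w < 2 * ρ) (hc : c ≠ 0) (t : ℝ) :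
    c * Complex.exp (t * Complex.I) ∈ cone ρ (w - z) ↔
      Real.cos (edgeAngle ρ s(z, w)) ≤ Real.cos (t - Complex.arg ((w - z) / c)) := by
  have hn : 0 < ‖c‖ := norm_pos_iff.2 hc
  have hD : 0 < ‖w - z‖ := norm_pos_iff.2 (sub_ne_zero.2 hzw.symm)
  rw [cone, Set.mem_ofPred_eq, re_mul_conj_eq hc, norm_mul_exp, cos_edgeAngle hρ hd,
    div_le_iff₀ (by positivity)]
  set C := Real.cos _
  have e1 : ‖c‖ * ‖w - z‖ ^ 2 = (‖c‖ * ‖w - z‖) * ‖w - z‖ := by ring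
  have e2 : 2 * ρ * (‖c‖ * ‖w - z‖ * C) = (‖c‖ * ‖w - z‖) * (C * (2 * ρ)) := by ring
  rw [e1, e2, mul_le_mul_iff_right₀ (by positivity)]

theorem interior_cone_iff (hρ : 0 < ρ) (hzw : z ≠ w) (hd : dist z w < 2 * ρ) (hc : c ≠ 0) (t : ℝ) :
    ‖c * Complex.exp (t * Complex.I)‖ * ‖w - z‖ ^ 2 <
      2 * ρ * (c * Complex.exp (t * Complex.I) * (starRingEnd ℂ) (w - z)).re ↔
      Real.cos (edgeAngle ρ s(z, w)) < Real.cos (t - Complex.arg ((w - z) / c)) := by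
  have hn : 0 < ‖c‖ := norm_pos_iff.2 hc
  have hD : 0 < ‖w - z‖ := norm_pos_iff.2 (sub_ne_zero.2 hzw.symm)
  rw [re_mul_conj_eq hc, norm_mul_exp, cos_edgeAngle hρ hd, div_lt_iff₀ (by positivity)]
  set C := Real.cos _
  have e1 : ‖c‖ * ‖w - z‖ ^ 2 = (‖c‖ * ‖w - z‖) * ‖w - z‖ := by ring
  have e2 : 2 * ρ * (‖c‖ * ‖w - z‖ * C) = (‖c‖ * ‖w - z‖) * (C * (2 * ρ)) := by ring
  rw [e1, e2, mul_lt_mul_iff_right₀ (by positivity)]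

end Cone

/-- For `|s| < 2π - θ`, the cosine comparison is a comparison of absolute values. -/
theorem cos_le_cos_iff_abs_le {θ s : ℝ} (h0 : 0 ≤ θ) (hθ : θ ≤ π) (hs : |s| < 2 * π - θ) :
    Real.cos θ ≤ Real.cos s ↔ |s| ≤ θ := by
  rw [← Real.cos_abs s]
  constructor
  · intro h
    by_contra! hlt
    rcases le_or_gt |s| π with h1 | h1
    · exact absurd (Real.cos_lt_cos_of_nonneg_of_le_pi h0 h1 hlt) (not_lt.2 h)
    · have := Real.cos_lt_cos_of_nonneg_of_le_pi h0 (y := 2 * π - |s|) (by linarith) (by linarith)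
      rw [Real.cos_two_pi_sub] at this
      linarith
  · exact fun h => Real.cos_le_cos_of_nonneg_of_le_pi (abs_nonneg s) hθ h

theorem cos_lt_cos_of_abs_lt {θ s : ℝ} (hθ : θ ≤ π) (hs : |s| < θ) :
    Real.cos θ < Real.cos s := by
  rw [← Real.cos_abs s]
  exact Real.cos_lt_cos_of_nonneg_of_le_pi (abs_nonneg s) hθ hs

namespace IsIsoradial

variable {Γ : SimpleGraph ℂ} {ρ : ℝ}

theorem edgeAngle_mem (hΓ : IsIsoradial Γ ρ) {z w : ℂ} (h : Γ.Adj z w) :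
    edgeAngle ρ s(z, w) ∈ Set.Ioo 0 (π / 2) :=
  ⟨edgeAngle_pos hΓ.radius_pos (hΓ.dist_lt _ _ h), edgeAngle_lt hΓ.radius_pos h.ne⟩

/-- Seen from the end of the edge `z₀z`, the rhombi of the other edges at `z` tile the sector that
is left free by the rhombus of `z₀z`. -/
theorem sum_integral_sectors (hΓ : IsIsoradial Γ ρ) {z z₀ : ℂ} (h₀ : Γ.Adj z z₀) {N : Finset ℂ}
    (hN : ∀ w, w ∈ N ↔ Γ.Adj z w) {f : ℝ → ℂ} (hf : Continuous f) :
    ∑ w ∈ N.erase z₀, ∫ t in (Complex.arg ((w - z) / (z - z₀)) - edgeAngle ρ s(z, w))..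
        (Complex.arg ((w - z) / (z - z₀)) + edgeAngle ρ s(z, w)), f t =
      ∫ t in (-π + edgeAngle ρ s(z, z₀))..(π - edgeAngle ρ s(z, z₀)), f t := by
  have hρ := hΓ.radius_pos
  have hc : z - z₀ ≠ 0 := sub_ne_zero.2 h₀.ne
  set α : ℂ → ℝ := fun w => Complex.arg ((w - z) / (z - z₀)) with hα
  set θ : ℂ → ℝ := fun w => edgeAngle ρ s(z, w) with hθ
  have hθm : ∀ w, Γ.Adj z w → 0 < θ w ∧ θ w < π / 2 := fun w hw => hΓ.edgeAngle_mem hw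
  have hπ := Real.pi_pos
  -- Angles are measured from the direction of z - z₀. The edge back to z₀ then sits on the branch
  -- cut, and the sectors of the other edges do not wrap around.
  have hα0 : α z₀ = π := by
    simp only [hα]
    rw [← neg_sub, neg_div, div_self hc, Complex.arg_neg_one]
  have hadj : ∀ w ∈ N.erase z₀, Γ.Adj z w ∧ w ≠ z₀ := fun w hw =>
    ⟨(hN w).1 (Finset.mem_of_mem_erase hw), Finset.ne_of_mem_erase hw⟩
  have hdisj : ∀ w w', Γ.Adj z w → Γ.Adj z w' → w ≠ w' → ∀ t : ℝ,
      Real.cos (θ w) < Real.cos (t - α w) → Real.cos (t - α w') < Real.cos (θ w') := by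
    intro w w' hw hw' hne t h
    have h1 := hΓ.notMem_cone hw hw' hne
      ((interior_cone_iff hρ hw.ne (hΓ.dist_lt _ _ hw) hc t).2 h)
    rw [mem_cone_iff hρ hw'.ne (hΓ.dist_lt _ _ hw') hc, not_le] at h1
    exact h1
  have hcover : ∀ t : ℝ, ∃ w, Γ.Adj z w ∧ Real.cos (θ w) ≤ Real.cos (t - α w) := by
    intro t
    obtain ⟨w, hw, h⟩ := hΓ.exists_mem_cone h₀ ((z - z₀) * Complex.exp (t * Complex.I))
    exact ⟨w, hw, (mem_cone_iff hρ hw.ne (hΓ.dist_lt _ _ hw) hc t).1 h⟩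
  obtain ⟨hθ1, hθ2⟩ := hθm z₀ h₀
  -- the directions `α w` stay away from `±π`
  have hαθ : ∀ w ∈ N.erase z₀, -π + θ w < α w ∧ α w < π - θ w := by
    intro w hw
    obtain ⟨hw, hne⟩ := hadj w hw
    obtain ⟨h1, h2⟩ := hθm w hw
    have h3 := hdisj z₀ w h₀ hw hne.symm π (by
      rw [hα0]; exact cos_lt_cos_of_abs_lt (by linarith) (by simpa using hθ1))
    have h4 : -π < α w := Complex.neg_pi_lt_arg _
    have h5 : α w ≤ π := Complex.arg_le_pi _
    constructor
    · by_contra! h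
      have h6 : Real.cos (π - α w) = Real.cos (π + α w) := by
        rw [Real.cos_pi_sub, Real.cos_add, Real.cos_pi, Real.sin_pi]; ring
      rw [h6] at h3
      exact absurd (Real.cos_le_cos_of_nonneg_of_le_pi (x := π + α w) (y := θ w)
        (by linarith) (by linarith) (by linarith)) (not_le.2 h3)
    · by_contra! h
      exact absurd (Real.cos_le_cos_of_nonneg_of_le_pi (x := π - α w) (y := θ w)
        (by linarith) (by linarith) (by linarith)) (not_le.2 h3)
  have hiff : ∀ w ∈ N.erase z₀, ∀ t ∈ Set.Ioo (-π) π,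
      (Real.cos (θ w) ≤ Real.cos (t - α w) ↔ |t - α w| ≤ θ w) := by
    intro w hw t ht
    obtain ⟨h3, h4⟩ := hαθ w hw
    obtain ⟨h1, h2⟩ := hθm w (hadj w hw).1
    refine cos_le_cos_iff_abs_le h1.le (by linarith) ?_
    rw [abs_lt]; constructor <;> linarith [ht.1, ht.2]
  have hlt : ∀ w ∈ N.erase z₀, ∀ t ∈ Set.Ioo (α w - θ w) (α w + θ w),
      Real.cos (θ w) < Real.cos (t - α w) := by
    intro w hw t ht
    obtain ⟨h1, h2⟩ := hθm w (hadj w hw).1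
    exact cos_lt_cos_of_abs_lt (by linarith) (by rw [abs_lt]; constructor <;> linarith [ht.1, ht.2])
  have hsub : ∀ w ∈ N.erase z₀, ∀ t ∈ Set.Ioo (α w - θ w) (α w + θ w),
      t ∈ Set.Ioo (-π + θ z₀) (π - θ z₀) := by
    intro w hw t ht
    have h1 := hdisj w z₀ (hadj w hw).1 h₀ (hadj w hw).2 t (hlt w hw t ht)
    rw [hα0, Real.cos_sub_pi] at h1
    have h2 : |t| < π := by
      obtain ⟨h3, h4⟩ := hαθ w hw
      rw [abs_lt]; constructor <;> linarith [ht.1, ht.2]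
    have h3 : |t| < π - θ z₀ := by
      by_contra! h
      have := Real.cos_le_cos_of_nonneg_of_le_pi (x := π - θ z₀) (y := |t|)
        (by linarith) h2.le h
      rw [Real.cos_abs, Real.cos_pi_sub] at this
      linarith
    rw [abs_lt] at h3
    exact ⟨by linarith [h3.1], h3.2⟩
  have hcov : ∀ t ∈ Set.Ioo (-π + θ z₀) (π - θ z₀), ∃ w ∈ N.erase z₀, |t - α w| ≤ θ w := by
    intro t ht
    obtain ⟨w, hw, h⟩ := hcover t
    have hne : w ≠ z₀ := by
      rintro rfl
      rw [hα0, Real.cos_sub_pi] at h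
      have := Real.cos_lt_cos_of_nonneg_of_le_pi (x := |t|) (y := π - θ w)
        (abs_nonneg t) (by linarith) (by rw [abs_lt]; constructor <;> linarith [ht.1, ht.2])
      rw [Real.cos_abs, Real.cos_pi_sub] at this
      linarith
    have hwN : w ∈ N.erase z₀ := Finset.mem_erase.2 ⟨hne, (hN w).2 hw⟩
    exact ⟨w, hwN, (hiff w hwN t ⟨by linarith [ht.1], by linarith [ht.2]⟩).1 h⟩
  rw [intervalIntegral.integral_of_le (by linarith), MeasureTheory.integral_Ioc_eq_integral_Ioo]
  have hint : ∀ a b : ℝ, MeasureTheory.IntegrableOn f (Set.Ioo a b) := fun a b =>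
    (hf.integrableOn_Icc (a := a) (b := b)).mono_set Set.Ioo_subset_Icc_self
  have hsum : ∀ w ∈ N.erase z₀, ∫ t in (α w - θ w)..(α w + θ w), f t =
      ∫ t in Set.Ioo (α w - θ w) (α w + θ w), f t := by
    intro w hw
    obtain ⟨h1, h2⟩ := hθm w (hadj w hw).1
    rw [intervalIntegral.integral_of_le (by linarith), MeasureTheory.integral_Ioc_eq_integral_Ioo]
  rw [Finset.sum_congr rfl hsum, ← MeasureTheory.integral_biUnion_finset _
    (fun _ _ => measurableSet_Ioo) ?_ (fun _ _ => hint _ _)]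
  · refine MeasureTheory.setIntegral_congr_set ?_
    -- The open sectors cover the free sector only up to their finitely many end directions, a null
    -- set.
    have hE : (⋃ w ∈ N.erase z₀, ({α w - θ w, α w + θ w} : Set ℝ)).Countable :=
      Set.Countable.biUnion (Finset.countable_toSet _) fun _ _ => (Set.toFinite _).countable
    filter_upwards [hE.ae_notMem MeasureTheory.volume] with t ht
    apply propext
    change t ∈ (⋃ w ∈ N.erase z₀, Set.Ioo (α w - θ w) (α w + θ w)) ↔ t ∈ Set.Ioo _ _
    simp only [Set.mem_iUnion, exists_prop] at ht ⊢
    push Not at ht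
    constructor
    · rintro ⟨w, hw, h⟩
      exact hsub w hw t h
    · intro h
      obtain ⟨w, hw, h⟩ := hcov t h
      have hn := ht w hw
      simp only [Set.mem_insert_iff, Set.mem_singleton_iff, not_or] at hn
      rw [abs_le] at h
      exact ⟨w, hw, lt_of_le_of_ne (by linarith [h.1]) (Ne.symm hn.1),
        lt_of_le_of_ne (by linarith [h.2]) hn.2⟩
  · intro w hw w' hw' hne
    refine Set.disjoint_left.2 fun t ht ht' => ?_
    exact lt_asymm (hdisj w w' (hadj w hw).1 (hadj w' hw').1 hne t (hlt w hw t ht))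
      (hlt w' hw' t ht')

/-- Integrating the constant 1: the rhombus of zw occupies an angle 2θ at z, and the sector left
free by z₀ has opening 2π - 2θ₀. -/
theorem sum_edgeAngle (hΓ : IsIsoradial Γ ρ) {z z₀ : ℂ} (h₀ : Γ.Adj z z₀) {N : Finset ℂ}
    (hN : ∀ w, w ∈ N ↔ Γ.Adj z w) : ∑ w ∈ N, edgeAngle ρ s(z, w) = π := by
  have h := hΓ.sum_integral_sectors h₀ hN (f := fun _ => 1) continuous_const
  simp only [intervalIntegral.integral_const, Complex.real_smul, mul_one] at h
  rw [← Complex.ofReal_sum, Complex.ofReal_inj] at h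
  have e : ∀ w ∈ N.erase z₀, Complex.arg ((w - z) / (z - z₀)) + edgeAngle ρ s(z, w) -
      (Complex.arg ((w - z) / (z - z₀)) - edgeAngle ρ s(z, w)) = 2 * edgeAngle ρ s(z, w) :=
    fun w _ => by ring
  rw [Finset.sum_congr rfl e, ← Finset.mul_sum] at h
  rw [← Finset.add_sum_erase N _ ((hN z₀).2 h₀)]
  linarith

/-- The function `sin (θ_e / 2)` is an eigenfunction of the critical transition matrix. -/
theorem sum_exp_mul_sin (hΓ : IsIsoradial Γ ρ) {z z₀ : ℂ} (h₀ : Γ.Adj z z₀) {N : Finset ℂ}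
    (hN : ∀ w, w ∈ N ↔ Γ.Adj z w) :
    ∑ w ∈ N.erase z₀, Complex.exp (Complex.I / 2 * (Complex.arg ((w - z) / (z - z₀)) : ℝ)) *
      (Real.sin (edgeAngle ρ s(z, w) / 2) : ℝ) = (Real.cos (edgeAngle ρ s(z, z₀) / 2) : ℝ) := by
  -- The same formula serves both sides: the free sector has centre 0 and half-width π - θ₀, and
  -- sin((π - θ₀)/2) = cos(θ₀/2).
  have key : ∀ a θ : ℝ, ∫ t in (a - θ)..(a + θ), Complex.exp (Complex.I / 2 * (t : ℂ)) =
      4 * (Complex.exp (Complex.I / 2 * (a : ℝ)) * (Real.sin (θ / 2) : ℝ)) := by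
    intro a θ
    rw [integral_exp_mul_complex (by simp)]
    have e1 : Complex.I / 2 * ((a + θ : ℝ) : ℂ) =
      Complex.I / 2 * (a : ℝ) + ((θ / 2 : ℝ) : ℂ) * Complex.I := by push_cast; ring
    have e2 : Complex.I / 2 * ((a - θ : ℝ) : ℂ) =
      Complex.I / 2 * (a : ℝ) + ((-(θ / 2) : ℝ) : ℂ) * Complex.I := by push_cast; ring
    rw [e1, e2, Complex.exp_add, Complex.exp_add, Complex.exp_mul_I (((θ / 2 : ℝ)) : ℂ),
      Complex.exp_mul_I ((-(θ / 2) : ℝ) : ℂ)]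
    push_cast
    rw [Complex.cos_neg, Complex.sin_neg]
    field_simp
    ring
  have h := hΓ.sum_integral_sectors h₀ hN
    (f := fun t => Complex.exp (Complex.I / 2 * (t : ℂ))) (by fun_prop)
  have e : -π + edgeAngle ρ s(z, z₀) = 0 - (π - edgeAngle ρ s(z, z₀)) ∧
    π - edgeAngle ρ s(z, z₀) = 0 + (π - edgeAngle ρ s(z, z₀)) := ⟨by ring, by ring⟩
  rw [e.1] at h
  nth_rewrite 2 [e.2] at h
  simp only [key] at h
  rw [← Finset.mul_sum] at h
  have h2 := mul_left_cancel₀ (by norm_num) h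
  rw [h2]
  have : (π - edgeAngle ρ s(z, z₀)) / 2 = π / 2 - edgeAngle ρ s(z, z₀) / 2 := by ring
  rw [this, Real.sin_pi_div_two_sub]
  simp

/-- Different edges at a vertex have different directions. -/
theorem arg_sub_injOn (hΓ : IsIsoradial Γ ρ) {z : ℂ} :
    Set.InjOn (fun w => Complex.arg (w - z)) {w | Γ.Adj z w} := by
  intro w hw w' hw' h
  by_contra hne
  have hρ := hΓ.radius_pos
  have hw : Γ.Adj z w := hw
  have hw' : Γ.Adj z w' := hw'
  have h1 := (interior_cone_iff hρ hw.ne (hΓ.dist_lt _ _ hw) one_ne_zero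
    (Complex.arg (w - z))).2 (by
      rw [div_one, sub_self]
      exact cos_lt_cos_of_abs_lt (by linarith [(hΓ.edgeAngle_mem hw).2, Real.pi_pos])
        (by simpa using (hΓ.edgeAngle_mem hw).1))
  refine hΓ.notMem_cone hw hw' hne h1 ((mem_cone_iff hρ hw'.ne (hΓ.dist_lt _ _ hw') one_ne_zero
    (Complex.arg (w - z))).2 ?_)
  have h : Complex.arg (w - z) = Complex.arg (w' - z) := h
  rw [h, div_one, sub_self, Real.cos_zero]
  exact Real.cos_le_one _

/-- Every vertex has an edge that points to the right. -/
theorem exists_adj_re_lt (hΓ : IsIsoradial Γ ρ) {z z₀ : ℂ} (h₀ : Γ.Adj z z₀) :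
    ∃ w, Γ.Adj z w ∧ z.re < w.re := by
  obtain ⟨w, hw, h⟩ := hΓ.exists_mem_cone h₀ 1
  refine ⟨w, hw, ?_⟩
  have hρ := hΓ.radius_pos
  have hD : 0 < ‖w - z‖ := norm_pos_iff.2 (sub_ne_zero.2 hw.ne.symm)
  simp only [cone, Set.mem_ofPred_eq, norm_one, one_mul, Complex.conj_re, Complex.sub_re] at h
  have : 0 < ‖w - z‖ ^ 2 := by positivity
  by_contra! h1
  nlinarith

end IsIsoradial

/-! ### The norm of the block of the transition matrix at a vertex -/

/-- Polarization: for a Hermitian form the diagonal bound controls F(u, v), hence the operator norm.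
-/
theorem re_form_le_of_hermitian {ι : Type*} (N : Finset ι) (A : ι → ι → ℂ)
    (hA : ∀ i j, A j i = (starRingEnd ℂ) (A i j)) {s : ℝ} (hs : 0 < s)
    (hq : ∀ v : ι → ℂ, |(∑ i ∈ N, ∑ j ∈ N, (starRingEnd ℂ) (v i) * (A i j * v j)).re| ≤
      s * ∑ i ∈ N, ‖v i‖ ^ 2) (v : ι → ℂ) :
    ∑ i ∈ N, ‖∑ j ∈ N, A i j * v j‖ ^ 2 ≤ s ^ 2 * ∑ i ∈ N, ‖v i‖ ^ 2 := by
  let F : (ι → ℂ) → (ι → ℂ) → ℂ := fun u v => ∑ i ∈ N, ∑ j ∈ N, (starRingEnd ℂ) (u i) * (A i j * v j)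
  have hherm : ∀ u v, (F u v).re = (F v u).re := by
    intro u v
    have : F v u = (starRingEnd ℂ) (F u v) := by
      simp only [F, map_sum, map_mul, Complex.conj_conj]
      rw [Finset.sum_comm]
      refine Finset.sum_congr rfl fun i _ => Finset.sum_congr rfl fun j _ => ?_
      rw [← hA]; ring
    rw [this, Complex.conj_re]
  have hpol : ∀ u v, F (u + v) (u + v) - F (u - v) (u - v) = 2 * F u v + 2 * F v u := by
    intro u v
    simp only [F, ← Finset.sum_sub_distrib, Finset.mul_sum, ← Finset.sum_add_distrib]
    refine Finset.sum_congr rfl fun i _ => Finset.sum_congr rfl fun j _ => ?_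
    simp only [Pi.add_apply, Pi.sub_apply, map_add, map_sub]
    ring
  have hpar : ∀ u v : ι → ℂ, ∑ i ∈ N, ‖(u + v) i‖ ^ 2 + ∑ i ∈ N, ‖(u - v) i‖ ^ 2 =
      2 * ∑ i ∈ N, ‖u i‖ ^ 2 + 2 * ∑ i ∈ N, ‖v i‖ ^ 2 := by
    intro u v
    simp only [Finset.mul_sum, ← Finset.sum_add_distrib]
    refine Finset.sum_congr rfl fun i _ => ?_
    have := parallelogram_law_with_norm ℝ (u i) (v i)
    simp only [Pi.add_apply, Pi.sub_apply]
    nlinarith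
  have hmain : ∀ u v : ι → ℂ, 4 * (F u v).re ≤
      s * (2 * ∑ i ∈ N, ‖u i‖ ^ 2 + 2 * ∑ i ∈ N, ‖v i‖ ^ 2) := by
    intro u v
    have h1 := (abs_le.1 (hq (u + v))).2
    have h2 := (abs_le.1 (hq (u - v))).1
    have h3 := congrArg Complex.re (hpol u v)
    simp only [Complex.sub_re, Complex.add_re, Complex.mul_re, Complex.re_ofNat, Complex.im_ofNat,
      zero_mul, sub_zero] at h3
    rw [hherm v u] at h3
    rw [← hpar]
    have h4 : (F (u + v) (u + v)).re ≤ s * ∑ i ∈ N, ‖(u + v) i‖ ^ 2 := h1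
    have h5 : -(s * ∑ i ∈ N, ‖(u - v) i‖ ^ 2) ≤ (F (u - v) (u - v)).re := h2
    linarith
  set B : ι → ℂ := fun i => ∑ j ∈ N, A i j * v j with hB
  -- The test vector u = Av/s balances the two terms on the right of `hmain`.
  have h := hmain (fun i => (s⁻¹ : ℝ) * B i) v
  have e1 : F (fun i => (s⁻¹ : ℝ) * B i) v = ((s⁻¹ * ∑ i ∈ N, ‖B i‖ ^ 2 : ℝ) : ℂ) := by
    simp only [F, ← Finset.mul_sum]
    push_cast
    rw [Finset.mul_sum]
    refine Finset.sum_congr rfl fun i _ => ?_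
    change (starRingEnd ℂ) (_ * B i) * B i = _
    rw [map_mul, mul_assoc, ← Complex.conj_mul', ← Complex.ofReal_inv, Complex.conj_ofReal]
  have e2 : ∑ i ∈ N, ‖((s⁻¹ : ℝ) : ℂ) * B i‖ ^ 2 = s⁻¹ ^ 2 * ∑ i ∈ N, ‖B i‖ ^ 2 := by
    rw [Finset.mul_sum]
    refine Finset.sum_congr rfl fun i _ => ?_
    rw [norm_mul, mul_pow, Complex.norm_real, Real.norm_of_nonneg (by positivity)]
  rw [e1, Complex.ofReal_re, e2] at h
  set X := ∑ i ∈ N, ‖B i‖ ^ 2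
  set Y := ∑ i ∈ N, ‖v i‖ ^ 2
  have e3 : s * (2 * (s⁻¹ ^ 2 * X) + 2 * Y) = 2 * s⁻¹ * X + 2 * s * Y := by field_simp
  rw [e3] at h
  have h6 : s⁻¹ * X ≤ s * Y := by linarith
  calc X = s * (s⁻¹ * X) := by field_simp
    _ ≤ s * (s * Y) := by gcongr
    _ = s ^ 2 * Y := by ring

/-- The right side minus the left, times a + b, is exactly the square ‖S(a + i) - u(b - i)‖². The
relation between a, b and c is the addition formula for the cotangent. -/
theorem area_step {a b c : ℝ} (hab : 0 < a + b) (hc : c * (a + b) = a * b - 1) (S u : ℂ) :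
    c * ‖S + u‖ ^ 2 ≤ a * ‖S‖ ^ 2 + b * ‖u‖ ^ 2 - 2 * ((starRingEnd ℂ) S * u).im := by
  have hpos : 0 ≤ ‖S * (a + Complex.I) - u * (b - Complex.I)‖ ^ 2 := by positivity
  simp only [← Complex.normSq_eq_norm_sq, Complex.normSq_apply, Complex.add_re, Complex.add_im,
    Complex.mul_re, Complex.mul_im, Complex.sub_re, Complex.sub_im, Complex.conj_re,
    Complex.conj_im, Complex.ofReal_re, Complex.ofReal_im, Complex.I_re, Complex.I_im] at *
  refine le_of_mul_le_mul_right ?_ hab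
  have e : c * ((S.re + u.re) * (S.re + u.re) + (S.im + u.im) * (S.im + u.im)) * (a + b) =
      (a * b - 1) * ((S.re + u.re) * (S.re + u.re) + (S.im + u.im) * (S.im + u.im)) := by
    rw [← hc]; ring
  rw [e]
  nlinarith

/-- A discrete isoperimetric inequality. -/
theorem area_form_le {ι : Type*} (ψ : ι → ℝ) (y : ι → ℝ) (u : ι → ℂ)
    (N : Finset ι) (hy : ∀ i ∈ N, 0 < y i) (hψ : Set.InjOn ψ N)
    (hsum : ∑ i ∈ N, Real.arctan (y i) ≤ π / 2) :
    Real.cot (∑ i ∈ N, Real.arctan (y i)) * ‖∑ i ∈ N, u i‖ ^ 2 ≤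
      ∑ i ∈ N, ‖u i‖ ^ 2 / y i -
        2 * ∑ i ∈ N, ∑ j ∈ N, if ψ i < ψ j then ((starRingEnd ℂ) (u i) * u j).im else 0 := by
  classical
  -- Adding the vectors in increasing order of ψ builds a polygonal path, and the double sum is
  -- twice the signed area of its closure. The extremal case is a polygon inscribed in a circle
  -- whose edges subtend the central angles 2 arctan(y i). The new last vector is appended to the
  -- chord S of the path so far.
  induction N using Finset.induction_on_max_value ψ with
  | empty => simp
  | insert a s ha hmax ih =>
    have hlt : ∀ x ∈ s, ψ x < ψ a := fun x hx => lt_of_le_of_ne (hmax x hx) fun h =>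
      ha (hψ (Finset.mem_insert_of_mem hx) (Finset.mem_insert_self a s) h ▸ hx)
    have hya := hy a (Finset.mem_insert_self a s)
    have hβ : 0 < Real.arctan (y a) := Real.arctan_pos.2 hya
    have hβ2 := Real.arctan_lt_pi_div_two (y a)
    rw [Finset.sum_insert ha] at hsum
    have ih := ih (fun i hi => hy i (Finset.mem_insert_of_mem hi))
      (hψ.mono (by simp)) (by linarith)
    have e1 : ∑ i ∈ insert a s, ∑ j ∈ insert a s,
        (if ψ i < ψ j then ((starRingEnd ℂ) (u i) * u j).im else 0) =
        ((starRingEnd ℂ) (∑ i ∈ s, u i) * u a).im +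
        ∑ i ∈ s, ∑ j ∈ s, (if ψ i < ψ j then ((starRingEnd ℂ) (u i) * u j).im else 0) := by
      rw [Finset.sum_insert ha, Finset.sum_eq_zero (s := insert a s), zero_add]
      · rw [map_sum, Finset.sum_mul, Complex.im_sum, ← Finset.sum_add_distrib]
        refine Finset.sum_congr rfl fun i hi => ?_
        rw [Finset.sum_insert ha, if_pos (hlt i hi)]
      · intro j hj
        rcases Finset.mem_insert.1 hj with rfl | hj
        · simp
        · rw [if_neg (not_lt.2 (hmax j hj))]
    rw [e1, Finset.sum_insert ha, Finset.sum_insert ha, Finset.sum_insert ha]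
    have hcot : Real.cot (Real.arctan (y a)) = (y a)⁻¹ := by
      rw [← Real.tan_inv_eq_cot, Real.tan_arctan]
    -- For an empty path the convention cot 0 = 0 breaks the addition formula, so the first vector
    -- is treated directly.
    rcases s.eq_empty_or_nonempty with rfl | hne
    · simp [hcot, div_eq_inv_mul]
    have hA : 0 < ∑ i ∈ s, Real.arctan (y i) :=
      Finset.sum_pos (fun i hi => Real.arctan_pos.2 (hy i (Finset.mem_insert_of_mem hi))) hne
    set A := ∑ i ∈ s, Real.arctan (y i)
    set β := Real.arctan (y a)
    have hsA : 0 < Real.sin A := Real.sin_pos_of_pos_of_lt_pi hA (by linarith)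
    have hsβ : 0 < Real.sin β := Real.sin_pos_of_pos_of_lt_pi hβ (by linarith)
    have hsAβ : 0 < Real.sin (A + β) := Real.sin_pos_of_pos_of_lt_pi (by linarith)
      (by linarith [Real.pi_pos])
    have hsum_cot : Real.cot A + Real.cot β = Real.sin (A + β) / (Real.sin A * Real.sin β) := by
      rw [Real.cot_eq_cos_div_sin, Real.cot_eq_cos_div_sin, Real.sin_add]
      field_simp
      ring
    have hpos : 0 < Real.cot A + Real.cot β := by rw [hsum_cot]; positivity
    have hc : Real.cot (A + β) * (Real.cot A + Real.cot β) = Real.cot A * Real.cot β - 1 := by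
      rw [hsum_cot, Real.cot_eq_cos_div_sin, Real.cot_eq_cos_div_sin, Real.cot_eq_cos_div_sin,
        Real.cos_add]
      field_simp
    have step := area_step hpos hc (∑ i ∈ s, u i) (u a)
    rw [add_comm β A, add_comm (u a)]
    rw [hcot] at step
    rw [div_eq_inv_mul]
    linarith

/-- An angle sum of at most π/2 makes the cotangent nonnegative, so that term can be dropped.
Complex conjugation of all vectors reverses the sign of the area and gives the other bound. -/
theorem abs_area_form_le {ι : Type*} (ψ : ι → ℝ) (y : ι → ℝ) (u : ι → ℂ)
    (N : Finset ι) (hy : ∀ i ∈ N, 0 < y i) (hψ : Set.InjOn ψ N)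
    (hsum : ∑ i ∈ N, Real.arctan (y i) ≤ π / 2) :
    |2 * ∑ i ∈ N, ∑ j ∈ N, if ψ i < ψ j then ((starRingEnd ℂ) (u i) * u j).im else 0| ≤
      ∑ i ∈ N, ‖u i‖ ^ 2 / y i := by
  have h0 : 0 ≤ Real.cot (∑ i ∈ N, Real.arctan (y i)) := by
    rw [Real.cot_eq_cos_div_sin]
    have : 0 ≤ ∑ i ∈ N, Real.arctan (y i) :=
      Finset.sum_nonneg fun i hi => (Real.arctan_pos.2 (hy i hi)).le
    exact div_nonneg (Real.cos_nonneg_of_mem_Icc ⟨by linarith [Real.pi_pos], hsum⟩)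
      (Real.sin_nonneg_of_nonneg_of_le_pi this (by linarith [Real.pi_pos]))
  have h1 := area_form_le ψ y u N hy hψ hsum
  have h2 := area_form_le ψ y (fun i => (starRingEnd ℂ) (u i)) N hy hψ hsum
  have e : ∑ i ∈ N, ∑ j ∈ N, (if ψ i < ψ j then ((starRingEnd ℂ) ((starRingEnd ℂ) (u i)) *
      (starRingEnd ℂ) (u j)).im else 0) =
      -∑ i ∈ N, ∑ j ∈ N, (if ψ i < ψ j then ((starRingEnd ℂ) (u i) * u j).im else 0) := by
    simp only [← Finset.sum_neg_distrib]
    refine Finset.sum_congr rfl fun i _ => Finset.sum_congr rfl fun j _ => ?_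
    rw [← map_mul, Complex.conj_im]
    split_ifs <;> simp
  rw [e] at h2
  simp only [RCLike.norm_conj] at h2
  have h3 := mul_nonneg h0 (sq_nonneg ‖∑ i ∈ N, u i‖)
  have h4 := mul_nonneg h0 (sq_nonneg ‖∑ i ∈ N, (starRingEnd ℂ) (u i)‖)
  rw [abs_le]
  constructor <;> linarith

/-- An edge entering z from w has direction -d with d = w - z. Adding ∓π to the difference of
arguments lands in (-π, π], the sign depending on their order. -/
theorem arg_div_neg {d d' : ℂ} (hd : d ≠ 0) (hd' : d' ≠ 0) :
    (Complex.arg d < Complex.arg d' →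
      Complex.arg (d' / -d) = Complex.arg d' - Complex.arg d - π) ∧
    (Complex.arg d' < Complex.arg d →
      Complex.arg (d' / -d) = Complex.arg d' - Complex.arg d + π) := by
  have hn : 0 < ‖d'‖ / ‖d‖ := div_pos (norm_pos_iff.2 hd') (norm_pos_iff.2 hd)
  have h1 := Complex.norm_mul_exp_arg_mul_I d
  have h2 := Complex.norm_mul_exp_arg_mul_I d'
  have b1 := Complex.neg_pi_lt_arg d
  have b2 := Complex.arg_le_pi d
  have b3 := Complex.neg_pi_lt_arg d'
  have b4 := Complex.arg_le_pi d'
  have key : ∀ t : ℝ, Complex.exp (t * Complex.I) = -1 →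
      Complex.arg d' - Complex.arg d + t ∈ Set.Ioc (-π) π →
      Complex.arg (d' / -d) = Complex.arg d' - Complex.arg d + t := by
    intro t ht hmem
    rw [← Complex.arg_mul_cos_add_sin_mul_I hn hmem]
    congr 1
    rw [← Complex.exp_mul_I]
    have e : ((Complex.arg d' - Complex.arg d + t : ℝ) : ℂ) * Complex.I =
        Complex.arg d' * Complex.I - Complex.arg d * Complex.I + t * Complex.I := by
      push_cast; ring
    rw [e, Complex.exp_add, Complex.exp_sub, ht]
    nth_rewrite 1 [← h1, ← h2]
    have : (‖d‖ : ℂ) ≠ 0 := by exact_mod_cast norm_ne_zero_iff.2 hd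
    push_cast
    field_simp
  constructor
  · intro h
    have := key (-π) (by
      rw [Complex.ofReal_neg, neg_mul, Complex.exp_neg, Complex.exp_pi_mul_I]; norm_num)
      ⟨by linarith, by linarith⟩
    linarith
  · intro h
    exact key π (Complex.exp_pi_mul_I) ⟨by linarith, by linarith⟩

/-- The block at a vertex of the symmetrized transition matrix; the row of `w` belongs to the edge
from `w` to `z` and the column of `w'` to the edge from `z` to `w'`. -/
def block (x : ℂ → ℝ) (z w w' : ℂ) : ℂ :=
  open Classical in
  if w = w' then 0 else
    (√(x w) * √(x w') : ℝ) * Complex.exp (Complex.I / 2 * (Complex.arg ((w' - z) / (z - w)) : ℝ))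

/-- Halving turns ∓π into ∓i. Exchanging d and d' then conjugates the entry, which is what makes the
block Hermitian. -/
theorem exp_half_arg {d d' : ℂ} (hd : d ≠ 0) (hd' : d' ≠ 0) :
    (Complex.arg d < Complex.arg d' → Complex.exp (Complex.I / 2 * (Complex.arg (d' / -d) : ℝ)) =
      -Complex.I * ((starRingEnd ℂ) (Complex.exp (Complex.I / 2 * (Complex.arg d : ℝ))) *
        Complex.exp (Complex.I / 2 * (Complex.arg d' : ℝ)))) ∧
    (Complex.arg d' < Complex.arg d → Complex.exp (Complex.I / 2 * (Complex.arg (d' / -d) : ℝ)) =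
      Complex.I * ((starRingEnd ℂ) (Complex.exp (Complex.I / 2 * (Complex.arg d : ℝ))) *
        Complex.exp (Complex.I / 2 * (Complex.arg d' : ℝ)))) := by
  have hI : Complex.exp (π / 2 * Complex.I) = Complex.I := Complex.exp_pi_div_two_mul_I
  constructor
  · intro h
    rw [(arg_div_neg hd hd').1 h, ← Complex.exp_conj, ← Complex.exp_add]
    have hI' : -Complex.I = Complex.exp (-(π / 2 * Complex.I)) := by
      rw [Complex.exp_neg, hI, Complex.inv_I]
    rw [hI', ← Complex.exp_add]
    congr 1
    simp only [map_mul, map_div₀, Complex.conj_I, Complex.conj_ofReal, map_ofNat]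
    push_cast; ring
  · intro h
    rw [(arg_div_neg hd hd').2 h, ← Complex.exp_conj, ← Complex.exp_add]
    nth_rewrite 2 [← hI]
    rw [← Complex.exp_add]
    congr 1
    simp only [map_mul, map_div₀, Complex.conj_I, Complex.conj_ofReal, map_ofNat]
    push_cast; ring

/-- The block at a vertex has norm at most `s` if `∑ arctan (x / s) ≤ π / 2`. -/
theorem sum_norm_block_le {z : ℂ} {N : Finset ℂ} {x : ℂ → ℝ} {s : ℝ} (hs : 0 < s)
    (hz : ∀ w ∈ N, w ≠ z) (hinj : Set.InjOn (fun w => Complex.arg (w - z)) N)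
    (hx : ∀ w ∈ N, 0 < x w) (hsum : ∑ w ∈ N, Real.arctan (x w / s) ≤ π / 2) (v : ℂ → ℂ) :
    ∑ w ∈ N, ‖∑ w' ∈ N, block x z w w' * v w'‖ ^ 2 ≤ s ^ 2 * ∑ w ∈ N, ‖v w‖ ^ 2 := by
  classical
  let ψ : ℂ → ℝ := fun w => Complex.arg (w - z)
  let E : ℂ → ℂ := fun w => √(x w) * Complex.exp (Complex.I / 2 * (ψ w : ℝ))
  -- `A` agrees with the block on N but is Hermitian for all pairs of indices, including pairs with
  -- equal directions.
  let A : ℂ → ℂ → ℂ := fun w w' =>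
    if ψ w < ψ w' then -Complex.I * ((starRingEnd ℂ) (E w) * E w')
    else if ψ w' < ψ w then Complex.I * ((starRingEnd ℂ) (E w) * E w') else 0
  have hAB : ∀ w ∈ N, ∀ w' ∈ N, block x z w w' = A w w' := by
    intro w hw w' hw'
    have hd := sub_ne_zero.2 (hz w hw)
    have hd' := sub_ne_zero.2 (hz w' hw')
    simp only [block, A]
    rcases eq_or_ne w w' with rfl | hne
    · simp
    have hne' : ψ w ≠ ψ w' := fun h => hne (hinj hw hw' h)
    rw [if_neg hne, ← neg_sub w z]
    rcases lt_or_gt_of_ne hne' with h | h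
    · rw [if_pos h, (exp_half_arg hd hd').1 h]
      simp only [E, map_mul, Complex.conj_ofReal, ψ]
      push_cast; ring
    · rw [if_neg (not_lt.2 h.le), if_pos h, (exp_half_arg hd hd').2 h]
      simp only [E, map_mul, Complex.conj_ofReal, ψ]
      push_cast; ring
  have hA : ∀ i j, A j i = (starRingEnd ℂ) (A i j) := by
    intro i j
    simp only [A]
    rcases lt_trichotomy (ψ i) (ψ j) with h | h | h
    · rw [if_neg (not_lt.2 h.le), if_pos h, if_pos h]
      simp only [map_mul, map_neg, Complex.conj_I, Complex.conj_conj]; ring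
    · simp [h]
    · rw [if_pos h, if_neg (not_lt.2 h.le), if_pos h]
      simp only [map_mul, Complex.conj_I, Complex.conj_conj]; ring
  have hnE : ∀ w ∈ N, ‖E w‖ ^ 2 = x w := by
    intro w hw
    have e : Complex.I / 2 * (ψ w : ℝ) = ((ψ w / 2 : ℝ) : ℂ) * Complex.I := by push_cast; ring
    simp only [E]
    rw [norm_mul, e, Complex.norm_exp_ofReal_mul_I, mul_one, Complex.norm_real,
      Real.norm_of_nonneg (Real.sqrt_nonneg _), Real.sq_sqrt (hx w hw).le]
  have key := re_form_le_of_hermitian N A hA hs ?_ v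
  · refine le_trans (le_of_eq (Finset.sum_congr rfl fun w hw => ?_)) key
    rw [Finset.sum_congr rfl fun w' hw' => by rw [hAB w hw w' hw']]
  intro v
  -- The quadratic form of `A` at v is the area form of the vectors u = Ev. Since ‖E w‖² = x w, the
  -- choice y = x/s turns its bound into s∑‖v‖².
  have h := abs_area_form_le ψ (fun w => x w / s) (fun w => E w * v w) N
    (fun w hw => div_pos (hx w hw) hs) hinj hsum
  have e1 : ∑ i ∈ N, ‖E i * v i‖ ^ 2 / (x i / s) = s * ∑ i ∈ N, ‖v i‖ ^ 2 := by
    rw [Finset.mul_sum]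
    refine Finset.sum_congr rfl fun i hi => ?_
    rw [norm_mul, mul_pow, hnE i hi]
    have := (hx i hi).ne'
    field_simp
  rw [e1] at h
  refine le_trans (le_of_eq ?_) h
  congr 1
  rw [Complex.re_sum]
  simp only [Complex.re_sum]
  have e2 : ∀ i j, ((starRingEnd ℂ) (v i) * (A i j * v j)).re =
      (if ψ i < ψ j then ((starRingEnd ℂ) (E i * v i) * (E j * v j)).im else 0) +
      (if ψ j < ψ i then ((starRingEnd ℂ) (E j * v j) * (E i * v i)).im else 0) := by
    intro i j
    simp only [A]
    have hc : ((starRingEnd ℂ) (E j * v j) * (E i * v i)).im =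
        -((starRingEnd ℂ) (E i * v i) * (E j * v j)).im := by
      rw [← Complex.conj_im]
      congr 1
      simp only [map_mul, Complex.conj_conj]; ring
    have hI : ∀ c : ℂ, (-Complex.I * c).re = c.im ∧ (Complex.I * c).re = -c.im := by
      intro c; simp
    rcases lt_trichotomy (ψ i) (ψ j) with h | h | h
    · rw [if_pos h, if_pos h, if_neg (not_lt.2 h.le), add_zero, ← (hI _).1]
      congr 1; simp only [map_mul]; ring
    · simp [h]
    · rw [if_neg (not_lt.2 h.le), if_pos h, if_neg (not_lt.2 h.le), if_pos h, zero_add, hc,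
        ← (hI _).2]
      congr 1; simp only [map_mul]; ring
  simp only [e2, Finset.sum_add_distrib]
  rw [two_mul]
  congr 1
  rw [Finset.sum_comm]

/-! ### Bounded operators with finite rows on `ℓ²` -/

section Operators

variable {ι : Type*}

/-- A matrix with finite rows acts on functions. -/
def rowSum (M : ι → ι → ℂ) (φ : ι → ℂ) (i : ι) : ℂ := ∑ᶠ j, M i j * φ j

theorem rowSum_eq_sum {M : ι → ι → ℂ} {i : ι} {F : Finset ι} (hF : ∀ j, M i j ≠ 0 → j ∈ F)
    (φ : ι → ℂ) : rowSum M φ i = ∑ j ∈ F, M i j * φ j :=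
  finsum_eq_sum_of_support_subset _ fun j hj => hF j (left_ne_zero_of_mul hj)

theorem hasSum_rowSum {M : ι → ι → ℂ} {i : ι} (hM : {j | M i j ≠ 0}.Finite) (φ : ι → ℂ) :
    HasSum (fun j => M i j * φ j) (rowSum M φ i) := by
  rw [rowSum_eq_sum (F := hM.toFinset) (fun j hj => by simpa using hj)]
  refine hasSum_sum_of_ne_finset_zero fun j hj => ?_
  have : M i j = 0 := by simpa using hj
  simp [this]

theorem sum_norm_sq_le (φ : lp (fun _ : ι => ℂ) 2) (F : Finset ι) :
    ∑ i ∈ F, ‖φ i‖ ^ 2 ≤ ‖φ‖ ^ 2 := by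
  have := lp.sum_rpow_le_norm_rpow (p := 2) (by simp) φ F
  simpa using this

theorem norm_le_of_forall_sum_sq_le {φ : lp (fun _ : ι => ℂ) 2} {C : ℝ} (hC : 0 ≤ C)
    (h : ∀ F : Finset ι, ∑ i ∈ F, ‖φ i‖ ^ 2 ≤ C ^ 2) : ‖φ‖ ≤ C :=
  lp.norm_le_of_forall_sum_le (by simp) hC fun F => by simpa using h F

/-- Only finite sets of rows have to be tested. Finite rows keep `rowSum` away from the default
value of `finsum` and make it linear for all φ. -/
theorem exists_operator {M : ι → ι → ℂ} (hfin : ∀ i, {j | M i j ≠ 0}.Finite) {s : ℝ} (hs : 0 ≤ s)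
    (hM : ∀ (φ : ι → ℂ) (E : Finset ι), ∃ F : Finset ι,
      ∑ i ∈ E, ‖rowSum M φ i‖ ^ 2 ≤ s ^ 2 * ∑ j ∈ F, ‖φ j‖ ^ 2) :
    ∃ A : lp (fun _ : ι => ℂ) 2 →L[ℂ] lp (fun _ : ι => ℂ) 2, ‖A‖ ≤ s ∧
      ∀ φ i, A φ i = rowSum M φ i := by
  have hbound : ∀ (φ : lp (fun _ : ι => ℂ) 2) (E : Finset ι),
      ∑ i ∈ E, ‖rowSum M φ i‖ ^ 2 ≤ (s * ‖φ‖) ^ 2 := by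
    intro φ E
    obtain ⟨F, hF⟩ := hM φ E
    rw [mul_pow]
    exact hF.trans (mul_le_mul_of_nonneg_left (sum_norm_sq_le φ F) (sq_nonneg s))
  have hmem : ∀ φ : lp (fun _ : ι => ℂ) 2, Memℓp (rowSum M φ) 2 := fun φ =>
    memℓp_gen' (C := (s * ‖φ‖) ^ 2) fun E => by simpa using hbound φ E
  let L : lp (fun _ : ι => ℂ) 2 →ₗ[ℂ] lp (fun _ : ι => ℂ) 2 :=
    { toFun := fun φ => ⟨rowSum M φ, hmem φ⟩
      map_add' := fun φ χ => by
        ext i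
        change rowSum M ⇑(φ + χ) i = rowSum M φ i + rowSum M χ i
        have hF : ∀ j, M i j ≠ 0 → j ∈ (hfin i).toFinset := fun j hj => by simpa using hj
        rw [rowSum_eq_sum hF, rowSum_eq_sum hF, rowSum_eq_sum hF, ← Finset.sum_add_distrib]
        exact Finset.sum_congr rfl fun j _ => by rw [lp.coeFn_add, Pi.add_apply]; ring
      map_smul' := fun c φ => by
        ext i
        change rowSum M ⇑(c • φ) i = c * rowSum M φ i
        have hF : ∀ j, M i j ≠ 0 → j ∈ (hfin i).toFinset := fun j hj => by simpa using hj
        rw [rowSum_eq_sum hF, rowSum_eq_sum hF, Finset.mul_sum]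
        exact Finset.sum_congr rfl fun j _ => by
          rw [lp.coeFn_smul, Pi.smul_apply, smul_eq_mul]; ring }
  refine ⟨L.mkContinuous s fun φ => norm_le_of_forall_sum_sq_le (by positivity) (hbound φ),
    LinearMap.mkContinuous_norm_le _ hs _, fun φ i => rfl⟩

/-- Multiplication by a function with values in `[a, b]`, where `0 < a`. -/
theorem exists_diagonal {d : ι → ℝ} {a b : ℝ} (ha : 0 < a) (hd : ∀ i, a ≤ d i ∧ d i ≤ b) :
    ∃ D : (lp (fun _ : ι => ℂ) 2 →L[ℂ] lp (fun _ : ι => ℂ) 2)ˣ,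
      (∀ φ i, D.val φ i = d i * φ i) ∧ (∀ φ i, D.inv φ i = ((d i)⁻¹ : ℝ) * φ i) ∧
      ‖D.val‖ ≤ max b 0 ∧ ‖D.inv‖ ≤ a⁻¹ := by
  classical
  have key : ∀ (f : ι → ℝ) (s : ℝ), 0 ≤ s → (∀ i, |f i| ≤ s) →
      ∃ A : lp (fun _ : ι => ℂ) 2 →L[ℂ] lp (fun _ : ι => ℂ) 2, ‖A‖ ≤ s ∧
        ∀ φ i, A φ i = f i * φ i := by
    intro f s hs hf
    have hrow : ∀ φ i, rowSum (fun i j => if j = i then (f i : ℂ) else 0) φ i = f i * φ i := by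
      intro φ i
      rw [rowSum_eq_sum (F := {i}) (fun j hj => by by_contra h; simp_all)]
      simp
    obtain ⟨A, hA, h⟩ := exists_operator (M := fun i j => if j = i then (f i : ℂ) else 0)
      (fun i => (Set.finite_singleton i).subset fun j hj => by by_contra h; simp_all) hs
      (fun φ E => ⟨E, by
        rw [Finset.mul_sum]
        refine Finset.sum_le_sum fun i _ => ?_
        rw [hrow, norm_mul, mul_pow, Complex.norm_real, Real.norm_eq_abs]
        exact mul_le_mul_of_nonneg_right (pow_le_pow_left₀ (abs_nonneg _) (hf i) 2)
          (sq_nonneg _)⟩)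
    exact ⟨A, hA, fun φ i => by rw [h, hrow]⟩
  -- Over an empty index set b may be negative, hence the maximum with 0.
  obtain ⟨A, hA, hAf⟩ := key d (max b 0) (le_max_right _ _) fun i => by
    rw [abs_of_pos (ha.trans_le (hd i).1)]; exact (hd i).2.trans (le_max_left _ _)
  obtain ⟨B, hB, hBf⟩ := key (fun i => (d i)⁻¹) a⁻¹ (by positivity) fun i => by
    rw [abs_of_pos (inv_pos.2 (ha.trans_le (hd i).1))]
    exact inv_anti₀ ha (hd i).1
  have hne : ∀ i, (d i : ℂ) ≠ 0 := fun i => by exact_mod_cast (ha.trans_le (hd i).1).ne'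
  refine ⟨⟨A, B, ?_, ?_⟩, hAf, hBf, hA, hB⟩
  · ext φ i
    change A (B φ) i = φ i
    rw [hAf, hBf, Complex.ofReal_inv, mul_inv_cancel_left₀ (hne i)]
  · ext φ i
    change B (A φ) i = φ i
    rw [hBf, hAf, Complex.ofReal_inv, inv_mul_cancel_left₀ (hne i)]

/-- The standard basis vectors of `ℓ²`. -/
def basisVec (i : ι) : lp (fun _ : ι => ℂ) 2 :=
  open Classical in lp.single 2 i (1 : ℂ)

theorem basisVec_self (i : ι) : basisVec i i = 1 := by
  classical
  exact lp.single_apply_self 2 i _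

theorem basisVec_ne {i j : ι} (h : j ≠ i) : basisVec i j = 0 := by
  classical
  exact lp.single_apply_ne 2 i _ h

theorem norm_basisVec (i : ι) : ‖basisVec i‖ = 1 := by
  classical
  exact (lp.norm_single (by simp) i _).trans (by simp)

/-- Every bounded operator on `ℓ²` acts as multiplication by its matrix. -/
theorem hasSum_entries (A : lp (fun _ : ι => ℂ) 2 →L[ℂ] lp (fun _ : ι => ℂ) 2)
    (φ : lp (fun _ : ι => ℂ) 2) (i : ι) :
    HasSum (fun j => A (basisVec j) i * φ j) (A φ i) := by
  classical
  have h1 := lp.hasSum_single (p := 2) (by simp) φ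
  have h2 : HasSum (fun j => A (lp.single 2 j (φ j)) i) (A φ i) :=
    ((lp.evalCLM ℂ (fun _ : ι => ℂ) 2 i).comp A).hasSum h1
  have e : ∀ j, A (lp.single 2 j (φ j)) i = A (basisVec j) i * φ j := by
    intro j
    have : lp.single 2 j (φ j) = φ j • (basisVec j : lp (fun _ : ι => ℂ) 2) := by
      refine Eq.trans ?_ (lp.single_smul (E := fun _ : ι => ℂ) (p := 2) j (φ j) (1 : ℂ))
      rw [smul_eq_mul, mul_one]
    rw [this, map_smul]
    exact mul_comm _ _
  simpa only [e] using h2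

theorem norm_entry_le (A : lp (fun _ : ι => ℂ) 2 →L[ℂ] lp (fun _ : ι => ℂ) 2) (i j : ι) :
    ‖A (basisVec j) i‖ ≤ ‖A‖ :=
  (lp.norm_apply_le_norm (by simp) _ i).trans
    ((A.le_opNorm _).trans (by rw [norm_basisVec, mul_one]))

end Operators

/-! ### Sums over walks as entries of powers of the transition matrix -/

section Walks

variable {G : SimpleGraph ℂ}

theorem walks_succ (r : ℕ) (e g : G.Dart) :
    walks G (r + 1) e g = ⋃ f ∈ {f : G.Dart | e.snd = f.fst ∧ f ≠ e.symm},
      (Fin.cons (α := fun _ => G.Dart) e) '' walks G r f g := by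
  ext ω
  simp only [walks, Set.mem_ofPred_eq, Set.mem_iUnion, Set.mem_image, exists_prop]
  constructor
  · rintro ⟨h0, h1, h2⟩
    rw [Fin.forall_fin_succ] at h2
    refine ⟨ω 1, ?_, Fin.tail ω, ⟨rfl, h1, fun i => ?_⟩, ?_⟩
    · have := h2.1
      rw [Fin.castSucc_zero, h0] at this
      exact this
    · exact h2.2 i
    · rw [← h0, Fin.cons_self_tail]
  · rintro ⟨f, hf, ω', ⟨h0, h1, h2⟩, rfl⟩
    refine ⟨rfl, h1, ?_⟩
    rw [Fin.forall_fin_succ]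
    refine ⟨?_, fun i => h2 i⟩
    change e.snd = (ω' 0).fst ∧ ω' 0 ≠ e.symm
    rw [h0]
    exact hf

theorem finite_out (hG : ∀ z, (G.neighborSet z).Finite) (z : ℂ) :
    {g : G.Dart | g.fst = z}.Finite := by
  refine Set.Finite.of_injOn (f := fun g => g.snd) (t := G.neighborSet z) ?_ ?_ (hG z)
  · rintro g rfl
    exact g.adj
  · rintro g (rfl : g.fst = _) g' (h : g'.fst = _) h'
    exact SimpleGraph.Dart.ext _ _ (Prod.ext h.symm h')

theorem finite_transition (hG : ∀ z, (G.neighborSet z).Finite) (x : Sym2 ℂ → ℝ) (e : G.Dart) :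
    {g | transition x e g ≠ 0}.Finite := by
  refine (finite_out hG e.snd).subset fun g hg => ?_
  by_contra h
  exact hg (if_neg fun h' => h h'.1.symm)

theorem finite_walks (hG : ∀ z, (G.neighborSet z).Finite) (r : ℕ) (e g : G.Dart) :
    (walks G r e g).Finite := by
  induction r generalizing e with
  | zero =>
    refine (Set.finite_singleton fun _ => e).subset fun ω hω => ?_
    funext i
    rw [Fin.eq_zero i]
    exact hω.1
  | succ r ih =>
    rw [walks_succ]
    exact ((finite_out hG e.snd).subset fun f hf => hf.1.symm).biUnion fun f _ => (ih f).image _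

theorem walkWeight_cons (x : Sym2 ℂ → ℝ) {r : ℕ} (e : G.Dart) (ω : Fin (r + 1) → G.Dart)
    (h : e.snd = (ω 0).fst ∧ ω 0 ≠ e.symm) :
    walkWeight x (Fin.cons (α := fun _ => G.Dart) e ω) =
      transition x e (ω 0) * walkWeight x ω := by
  rw [transition, if_pos h, walkWeight, walkWeight, totalTurning, totalTurning,
    Fin.sum_univ_succ, Fin.prod_univ_succ]
  simp only [Fin.castSucc_zero, Fin.cons_zero, Fin.cons_succ, ← Fin.succ_castSucc]
  rw [Complex.ofReal_add, mul_add, Complex.exp_add]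
  ring

theorem walkSum_succ (hG : ∀ z, (G.neighborSet z).Finite) (x : Sym2 ℂ → ℝ) (r : ℕ)
    (e g : G.Dart) :
    walkSum G x (r + 1) e g = rowSum (transition x) (fun f => walkSum G x r f g) e := by
  have hinj : Function.Injective
      (Fin.cons (n := r + 1) (α := fun _ => G.Dart) e) := Fin.cons_right_injective _
  have hI : {f : G.Dart | e.snd = f.fst ∧ f ≠ e.symm}.Finite :=
    (finite_out hG e.snd).subset fun f hf => hf.1.symm
  rw [walkSum, walks_succ, finsum_mem_biUnion ?_ hI fun f _ => (finite_walks hG r f g).image _]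
  · rw [rowSum, finsum_mem_def]
    refine finsum_congr fun f => ?_
    by_cases hf : f ∈ {f : G.Dart | e.snd = f.fst ∧ f ≠ e.symm}
    · rw [Set.indicator_of_mem hf, finsum_mem_image hinj.injOn, walkSum, mul_finsum_mem]
      refine finsum_mem_congr rfl fun ω hω => ?_
      have h0 : ω 0 = f := hω.1
      rw [walkWeight_cons x e ω (by rw [h0]; exact hf), h0]
    · have hf' : ¬(e.snd = f.fst ∧ f ≠ e.symm) := hf
      rw [Set.indicator_of_notMem hf, transition, if_neg hf', zero_mul]
  · intro f _ f' _ hne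
    refine Set.disjoint_left.2 ?_
    rintro _ ⟨ω, hω, rfl⟩ ⟨ω', hω', h⟩
    have := hinj h
    exact hne (by rw [← hω.1, ← this, hω'.1])

theorem walkSum_zero (x : Sym2 ℂ → ℝ) (e g : G.Dart) :
    walkSum G x 0 e g = basisVec g e := by
  rw [walkSum]
  by_cases h : e = g
  · subst h
    have : walks G 0 e e = {fun _ => e} := by
      ext ω
      constructor
      · intro hω
        funext i
        rw [Fin.eq_zero i]
        exact hω.1
      · rintro rfl
        exact ⟨rfl, rfl, fun i => i.elim0⟩
    rw [this, finsum_mem_singleton, basisVec_self]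
    simp [walkWeight, totalTurning]
  · have : walks G 0 e g = ∅ := by
      ext ω
      simp only [Set.mem_empty_iff_false, iff_false]
      rintro ⟨h0, h1, _⟩
      exact h (h0.symm.trans h1)
    rw [this, finsum_mem_empty, basisVec_ne h]

/-- The weight of a walk is the product of the transition entries along it, because turning angles
add and the last edge has no weight factor. Peeling off the first edge of a walk is therefore
multiplication by Λ on the left. -/
theorem pow_entry (hG : ∀ z, (G.neighborSet z).Finite) (x : Sym2 ℂ → ℝ)
    {Λ : EdgeSpace G →L[ℂ] EdgeSpace G} (hΛ : ∀ φ e, Λ φ e = rowSum (transition x) φ e)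
    (r : ℕ) (e g : G.Dart) : (Λ ^ r) (basisVec g) e = walkSum G x r e g := by
  induction r generalizing e with
  | zero => rw [walkSum_zero, pow_zero]; rfl
  | succ r ih =>
    rw [pow_succ', walkSum_succ hG]
    change Λ ((Λ ^ r) (basisVec g)) e = _
    rw [hΛ]
    congr 1
    funext f
    exact ih f

theorem hasMatrix_one_sub (hG : ∀ z, (G.neighborSet z).Finite) (x : Sym2 ℂ → ℝ)
    {Λ : EdgeSpace G →L[ℂ] EdgeSpace G} (hΛ : ∀ φ e, Λ φ e = rowSum (transition x) φ e) :
    HasMatrix (1 - Λ) (kacWardMatrix G x) := by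
  classical
  intro φ e
  have h1 := hasSum_rowSum (finite_transition hG x e) φ
  have h2 : HasSum (fun g => (if e = g then 1 else 0) * φ g) (φ e) := by
    have := hasSum_ite_eq e (φ e)
    convert this using 2 with g
    split_ifs with h1 h2 h2
    · rw [h1, one_mul]
    · exact absurd h1.symm h2
    · exact absurd h2.symm h1
    · rw [zero_mul]
  have h3 := h2.sub h1
  have e1 : (1 - Λ) φ e = φ e - rowSum (transition x) φ e := by
    rw [← hΛ]; rfl
  rw [e1]
  refine h3.congr_fun fun g => ?_
  rw [kacWardMatrix, sub_mul]

/-- If the powers of the transition operator are summable, the Neumann series inverts the Kac-Ward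
operator. -/
theorem inverseIsWalkSeries_of_summable (hG : ∀ z, (G.neighborSet z).Finite) (x : Sym2 ℂ → ℝ)
    {Λ : EdgeSpace G →L[ℂ] EdgeSpace G} (hΛ : ∀ φ e, Λ φ e = rowSum (transition x) φ e)
    (hs : Summable fun r : ℕ => Λ ^ r) : InverseIsWalkSeries G x := by
  refine ⟨1 - Λ, ∑' r : ℕ, Λ ^ r, fun e g => (∑' r : ℕ, Λ ^ r) (basisVec g) e,
    hasMatrix_one_sub hG x hΛ, hs.one_sub_mul_tsum_pow, hs.tsum_pow_mul_one_sub,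
    fun φ e => hasSum_entries _ φ e, fun e g => ?_⟩
  have h1 := hs.hasSum
  have h2 := ((lp.evalCLM ℂ (fun _ : G.Dart => ℂ) 2 e).comp
    (ContinuousLinearMap.apply ℂ (EdgeSpace G) (basisVec g))).hasSum h1
  have h3 : HasSum (fun r : ℕ => walkSum G x r e g) ((∑' r : ℕ, Λ ^ r) (basisVec g) e) := by
    refine h2.congr_fun fun r => ?_
    exact (pow_entry hG x hΛ r e g).symm
  -- Below the distance there are no walks, so the omitted terms vanish; at infinite distance the
  -- index set is empty.
  rw [← hasSum_subtype_iff_of_support_subset (s := {r : ℕ | walkDist G e g ≤ (r : ℕ∞)})] at h3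
  · exact h3
  · intro r hr
    change walkDist G e g ≤ _
    by_contra hlt
    refine hr ?_
    have : walks G r e g = ∅ := by
      by_contra hne
      exact hlt (iInf₂_le r (Set.nonempty_iff_ne_empty.2 hne))
    simp [walkSum, this]

end Walks

/-! ### The transition operator on `ℓ²` -/

section TransitionOperator

variable {G : SimpleGraph ℂ}

/-- The neighbours of `z` in a locally finite graph. -/
def nbrs (hG : ∀ z, (G.neighborSet z).Finite) (z : ℂ) : Finset ℂ := (hG z).toFinset

theorem mem_nbrs (hG : ∀ z, (G.neighborSet z).Finite) {z w : ℂ} : w ∈ nbrs hG z ↔ G.Adj z w := by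
  simp [nbrs]

/-- The directed edges with tail `z`. -/
def outDarts (hG : ∀ z, (G.neighborSet z).Finite) (z : ℂ) : Finset G.Dart :=
  (finite_out hG z).toFinset

theorem mem_outDarts (hG : ∀ z, (G.neighborSet z).Finite) {z : ℂ} {g : G.Dart} :
    g ∈ outDarts hG z ↔ g.fst = z := by
  simp [outDarts]

/-- The directed edges with head `z`. -/
def inDarts (hG : ∀ z, (G.neighborSet z).Finite) (z : ℂ) : Finset G.Dart :=
  (outDarts hG z).map ⟨SimpleGraph.Dart.symm, SimpleGraph.Dart.symm_involutive.injective⟩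

theorem mem_inDarts (hG : ∀ z, (G.neighborSet z).Finite) {z : ℂ} {g : G.Dart} :
    g ∈ inDarts hG z ↔ g.snd = z := by
  simp only [inDarts, Finset.mem_map, mem_outDarts, Function.Embedding.coeFn_mk]
  constructor
  · rintro ⟨f, rfl, rfl⟩
    rfl
  · rintro rfl
    exact ⟨g.symm, rfl, SimpleGraph.Dart.symm_symm g⟩

/-- A function of the directed edges with tail `z` as a function of the neighbours of `z`. -/
def atVertex {M : Type*} [Zero M] (φ : G.Dart → M) (z w : ℂ) : M :=
  open Classical in if h : G.Adj z w then φ ⟨(z, w), h⟩ else 0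

theorem atVertex_of_adj {M : Type*} [Zero M] (φ : G.Dart → M) {z w : ℂ} (h : G.Adj z w) :
    atVertex φ z w = φ ⟨(z, w), h⟩ := dif_pos h

theorem sum_outDarts {M : Type*} [AddCommMonoid M] (hG : ∀ z, (G.neighborSet z).Finite) (z : ℂ)
    (φ : G.Dart → M) : ∑ g ∈ outDarts hG z, φ g = ∑ w ∈ nbrs hG z, atVertex φ z w := by
  refine Finset.sum_nbij (fun g => g.snd) ?_ ?_ ?_ ?_
  · intro g hg
    have hg := (mem_outDarts hG).1 hg
    subst hg
    exact (mem_nbrs hG).2 g.adj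
  · intro g hg g' hg' h
    have hg := (mem_outDarts hG).1 hg
    have hg' := (mem_outDarts hG).1 hg'
    exact SimpleGraph.Dart.ext _ _ (Prod.ext (hg.trans hg'.symm) h)
  · intro w hw
    exact ⟨⟨(z, w), (mem_nbrs hG).1 hw⟩, (mem_outDarts hG).2 rfl, rfl⟩
  · intro g hg
    have hg := (mem_outDarts hG).1 hg
    subst hg
    rw [atVertex_of_adj φ g.adj]

theorem sum_inDarts {M : Type*} [AddCommMonoid M] (hG : ∀ z, (G.neighborSet z).Finite) (z : ℂ)
    (φ : G.Dart → M) :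
    ∑ g ∈ inDarts hG z, φ g = ∑ w ∈ nbrs hG z, atVertex (fun g => φ g.symm) z w := by
  rw [inDarts, Finset.sum_map, ← sum_outDarts]
  rfl

/-- The symmetrized transition matrix. -/
def symTransition (x : Sym2 ℂ → ℝ) (e g : G.Dart) : ℂ :=
  transition x e g * (√(x g.edge) / √(x e.edge) : ℝ)

theorem finite_symTransition (hG : ∀ z, (G.neighborSet z).Finite) (x : Sym2 ℂ → ℝ) (e : G.Dart) :
    {g | symTransition x e g ≠ 0}.Finite :=
  (finite_transition hG x e).subset fun _ hg => left_ne_zero_of_mul hg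

/-- The factor √x_g/√x_e changes the weight x_e into the symmetric √x_e √x_g; the backtracking entry
is the zero on the diagonal of the block. -/
theorem symTransition_eq_block {x : Sym2 ℂ → ℝ} (hx : ∀ e ∈ G.edgeSet, 0 < x e) {z w w' : ℂ}
    (h : G.Adj z w) (h' : G.Adj z w') :
    symTransition x (⟨(w, z), h.symm⟩ : G.Dart) ⟨(z, w'), h'⟩ =
      block (fun w => x s(z, w)) z w w' := by
  rw [symTransition, transition, block]
  by_cases hww : w = w'
  · subst hww
    rw [if_pos rfl, if_neg, zero_mul]
    rintro ⟨-, h2⟩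
    exact h2 rfl
  · rw [if_neg hww, if_pos]
    · have e1 : (⟨(w, z), h.symm⟩ : G.Dart).edge = s(z, w) := Sym2.eq_swap
      have e2 : (⟨(z, w'), h'⟩ : G.Dart).edge = s(z, w') := rfl
      rw [e1, e2]
      have hp : 0 < x s(z, w) := hx _ h
      have hs : (√(x s(z, w)) : ℂ) ≠ 0 := by exact_mod_cast (Real.sqrt_pos.2 hp).ne'
      have hsq : (x s(z, w) : ℂ) = √(x s(z, w)) * √(x s(z, w)) := by
        exact_mod_cast (Real.mul_self_sqrt hp.le).symm
      rw [hsq]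
      simp only [turningAngle]
      push_cast
      field_simp
    · refine ⟨rfl, fun h2 => hww ?_⟩
      exact (congrArg (fun g : G.Dart => g.snd) h2).symm

theorem rowSum_symTransition (hG : ∀ z, (G.neighborSet z).Finite) {x : Sym2 ℂ → ℝ}
    (hx : ∀ e ∈ G.edgeSet, 0 < x e) (φ : G.Dart → ℂ) {z w : ℂ} (h : G.Adj z w) :
    rowSum (symTransition x) φ ⟨(w, z), h.symm⟩ =
      ∑ w' ∈ nbrs hG z, block (fun w => x s(z, w)) z w w' * atVertex φ z w' := by
  rw [rowSum_eq_sum (F := outDarts hG z), sum_outDarts]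
  · refine Finset.sum_congr rfl fun w' hw' => ?_
    have h' := (mem_nbrs hG).1 hw'
    rw [atVertex_of_adj _ h', atVertex_of_adj _ h', symTransition_eq_block hx h h']
  · intro g hg
    rw [mem_outDarts]
    by_contra hne
    exact hg (by rw [symTransition, transition, if_neg fun h' => hne h'.1.symm, zero_mul])

theorem sum_norm_symTransition_le (hG : ∀ z, (G.neighborSet z).Finite) {x : Sym2 ℂ → ℝ}
    (hx : ∀ e ∈ G.edgeSet, 0 < x e) {s : ℝ} (hs : 0 < s) {z : ℂ}
    (hinj : Set.InjOn (fun w => Complex.arg (w - z)) {w | G.Adj z w})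
    (hsum : ∑ w ∈ nbrs hG z, Real.arctan (x s(z, w) / s) ≤ π / 2) (φ : G.Dart → ℂ) :
    ∑ e ∈ inDarts hG z, ‖rowSum (symTransition x) φ e‖ ^ 2 ≤
      s ^ 2 * ∑ g ∈ outDarts hG z, ‖φ g‖ ^ 2 := by
  rw [sum_inDarts, sum_outDarts]
  have key := sum_norm_block_le hs (N := nbrs hG z) (fun w hw => ((mem_nbrs hG).1 hw).ne.symm)
    (hinj.mono fun w hw => (mem_nbrs hG).1 hw) (x := fun w => x s(z, w))
    (fun w hw => hx _ ((mem_nbrs hG).1 hw)) hsum (atVertex φ z)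
  refine le_trans (le_of_eq ?_) (key.trans (le_of_eq ?_))
  · refine Finset.sum_congr rfl fun w hw => ?_
    have h := (mem_nbrs hG).1 hw
    rw [atVertex_of_adj _ h, ← rowSum_symTransition hG hx φ h]
    rfl
  · congr 1
    refine Finset.sum_congr rfl fun w hw => ?_
    have h := (mem_nbrs hG).1 hw
    rw [atVertex_of_adj _ h, atVertex_of_adj _ h]

/-- Each directed edge has one head and one tail, so the edges into and out of the various vertices
partition the rows and columns. Summing the block bounds gives the operator bound. The lower bound a
on the weights makes the conjugating diagonal invertible. -/
theorem exists_transition_operator (hG : ∀ z, (G.neighborSet z).Finite) {x : Sym2 ℂ → ℝ} {a : ℝ}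
    (ha : 0 < a) (hx : ∀ e ∈ G.edgeSet, a ≤ x e ∧ x e ≤ 1) {s : ℝ} (hs : 0 < s)
    (hinj : ∀ z, Set.InjOn (fun w => Complex.arg (w - z)) {w | G.Adj z w})
    (hsum : ∀ z, ∑ w ∈ nbrs hG z, Real.arctan (x s(z, w) / s) ≤ π / 2) :
    ∃ (Λ A : EdgeSpace G →L[ℂ] EdgeSpace G) (D : (EdgeSpace G →L[ℂ] EdgeSpace G)ˣ),
      (∀ φ e, Λ φ e = rowSum (transition x) φ e) ∧
      (∀ φ e, A φ e = rowSum (symTransition x) φ e) ∧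
      Λ = D.val * A * D.inv ∧ ‖A‖ ≤ s ∧ ‖D.val‖ ≤ 1 ∧ ‖D.inv‖ ≤ (√a)⁻¹ := by
  classical
  have hx0 : ∀ e ∈ G.edgeSet, 0 < x e := fun e he => ha.trans_le (hx e he).1
  obtain ⟨A, hA, hAf⟩ := exists_operator (finite_symTransition hG x) hs.le (fun φ E => by
    refine ⟨(E.image fun e => e.snd).biUnion (outDarts hG), ?_⟩
    have hsub : E ⊆ (E.image fun e => e.snd).biUnion (inDarts hG) := by
      intro e he
      rw [Finset.mem_biUnion]
      exact ⟨e.snd, Finset.mem_image_of_mem _ he, (mem_inDarts hG).2 rfl⟩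
    refine (Finset.sum_le_sum_of_subset_of_nonneg hsub fun _ _ _ => by positivity).trans ?_
    rw [Finset.sum_biUnion, Finset.sum_biUnion, Finset.mul_sum]
    · exact Finset.sum_le_sum fun z _ => sum_norm_symTransition_le hG hx0 hs (hinj z) (hsum z) φ
    · intro z _ z' _ hne
      refine Finset.disjoint_left.2 fun g hg hg' => hne ?_
      rw [← (mem_outDarts hG).1 hg, ← (mem_outDarts hG).1 hg']
    · intro z _ z' _ hne
      refine Finset.disjoint_left.2 fun g hg hg' => hne ?_
      rw [← (mem_inDarts hG).1 hg, ← (mem_inDarts hG).1 hg'])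
  obtain ⟨D, hD, hDi, hDn, hDin⟩ := exists_diagonal (ι := G.Dart) (d := fun e => √(x e.edge))
    (a := √a) (b := 1) (Real.sqrt_pos.2 ha) (fun e => ⟨Real.sqrt_le_sqrt (hx _ e.edge_mem).1,
      Real.sqrt_le_one.2 (hx _ e.edge_mem).2⟩)
  refine ⟨D.val * A * D.inv, A, D, fun φ e => ?_, hAf, rfl, hA, by simpa using hDn, hDin⟩
  change D.val (A (D.inv φ)) e = _
  rw [hD, hAf, rowSum_eq_sum (F := (finite_transition hG x e).toFinset),
    rowSum_eq_sum (F := (finite_transition hG x e).toFinset), Finset.mul_sum]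
  · refine Finset.sum_congr rfl fun g _ => ?_
    rw [hDi, symTransition]
    have h1 : (√(x e.edge) : ℂ) ≠ 0 := by
      exact_mod_cast (Real.sqrt_pos.2 (hx0 _ e.edge_mem)).ne'
    have h2 : (√(x g.edge) : ℂ) ≠ 0 := by
      exact_mod_cast (Real.sqrt_pos.2 (hx0 _ g.edge_mem)).ne'
    push_cast
    field_simp
  · intro g hg
    simpa using hg
  · intro g hg
    have := left_ne_zero_of_mul hg
    simpa using this

/-- If the blocks at all vertices are uniformly strict contractions, the walk series converges
exponentially fast. -/
theorem walkSeries_of_contraction (hG : ∀ z, (G.neighborSet z).Finite) {x : Sym2 ℂ → ℝ} {a : ℝ}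
    (ha : 0 < a) (hx : ∀ e ∈ G.edgeSet, a ≤ x e ∧ x e ≤ 1) {s : ℝ} (hs : 0 < s) (hs1 : s < 1)
    (hinj : ∀ z, Set.InjOn (fun w => Complex.arg (w - z)) {w | G.Adj z w})
    (hsum : ∀ z, ∑ w ∈ nbrs hG z, Real.arctan (x s(z, w) / s) ≤ π / 2) :
    InverseIsWalkSeries G x ∧
      ∀ (e g : G.Dart) (r : ℕ), ‖walkSum G x r e g‖ ≤ (√a)⁻¹ * s ^ r := by
  obtain ⟨Λ, A, D, hΛ, -, rfl, hA, hD, hDi⟩ := exists_transition_operator hG ha hx hs hinj hsum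
  -- The conjugation telescopes, so its cost (√a)⁻¹ does not depend on the power.
  have hpow : ∀ r : ℕ, ‖(D.val * A * D.inv) ^ r‖ ≤ (√a)⁻¹ * s ^ r := by
    intro r
    have e : (D.val * A * D.inv) ^ r = D.val * A ^ r * D.inv := Units.conj_pow D A r
    have hAr : ‖A ^ r‖ ≤ s ^ r := by
      induction r with
      | zero =>
        rw [pow_zero, pow_zero]
        exact ContinuousLinearMap.norm_id_le
      | succ r ih =>
        rw [pow_succ, pow_succ]
        exact (norm_mul_le _ _).trans
          (mul_le_mul (ih (Units.conj_pow D A r)) hA (norm_nonneg _) (by positivity))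
    rw [e]
    calc ‖D.val * A ^ r * D.inv‖ ≤ ‖D.val‖ * ‖A ^ r‖ * ‖D.inv‖ :=
          (norm_mul_le _ _).trans (mul_le_mul_of_nonneg_right (norm_mul_le _ _) (norm_nonneg _))
      _ ≤ 1 * s ^ r * (√a)⁻¹ := by gcongr
      _ = (√a)⁻¹ * s ^ r := by ring
  constructor
  · refine inverseIsWalkSeries_of_summable hG x hΛ ?_
    exact Summable.of_norm_bounded ((summable_geometric_of_lt_one hs.le hs1).mul_left _) hpow
  · intro e g r
    rw [← pow_entry hG x hΛ]
    exact (norm_entry_le _ e g).trans (hpow r)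

end TransitionOperator

/-! ### Estimates for the edge weights -/

theorem tanh_strictMono : StrictMono Real.tanh := by
  intro a b hab
  by_contra! h
  have := Real.artanh_le_artanh (Real.neg_one_lt_tanh b) (Real.tanh_lt_one a) h
  rw [Real.artanh_tanh, Real.artanh_tanh] at this
  linarith

theorem tanh_continuous : Continuous Real.tanh := by
  have : Real.tanh = fun x => Real.sinh x / Real.cosh x := funext Real.tanh_eq_sinh_div_cosh
  rw [this]
  exact Real.continuous_sinh.div Real.continuous_cosh fun x => (Real.cosh_pos x).ne'

theorem tanh_pos {x : ℝ} (hx : 0 < x) : 0 < Real.tanh x := by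
  simpa using tanh_strictMono hx

theorem tan_half_mem {θ : ℝ} (hθ : θ ∈ Set.Ioo 0 (π / 2)) : Real.tan (θ / 2) ∈ Set.Ioo 0 1 := by
  obtain ⟨h0, h1⟩ := hθ
  refine ⟨Real.tan_pos_of_pos_of_lt_pi_div_two (by linarith) (by linarith), ?_⟩
  rw [← Real.tan_pi_div_four]
  exact Real.tan_lt_tan_of_nonneg_of_lt_pi_div_two (by linarith) (by linarith) (by linarith)

theorem arctan_tanh_artanh_tan {θ : ℝ} (hθ : θ ∈ Set.Ioo 0 (π / 2)) :
    Real.arctan (Real.tanh (Real.artanh (Real.tan (θ / 2)))) = θ / 2 := by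
  have h := tan_half_mem hθ
  rw [Real.tanh_artanh ⟨by linarith [h.1], h.2⟩,
    Real.arctan_tan (by linarith [hθ.1, Real.pi_pos]) (by linarith [hθ.1, hθ.2])]

/-- For J > 0 the difference is continuous and positive, so it has a positive minimum on a compact
interval. An upper end b is needed: for β > 0 the gap closes as J → ∞, that is, as θ → π/2. -/
theorem exists_gap {β : ℝ} (hβ1 : β < 1) {a b : ℝ} (ha : 0 < a) :
    ∃ δ : ℝ, 0 < δ ∧ ∀ J ∈ Set.Icc a b,
      Real.arctan (Real.tanh (β * J)) + δ ≤ Real.arctan (Real.tanh J) := by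
  rcases lt_or_ge b a with hab | hab
  · exact ⟨1, one_pos, fun J hJ => absurd (hJ.1.trans hJ.2) (not_le.2 hab)⟩
  have hcont : Continuous fun J => Real.arctan (Real.tanh J) - Real.arctan (Real.tanh (β * J)) :=
    (Real.continuous_arctan.comp tanh_continuous).sub
      (Real.continuous_arctan.comp (tanh_continuous.comp (continuous_const.mul continuous_id)))
  obtain ⟨J₀, hJ₀, hmin⟩ := isCompact_Icc.exists_isMinOn (Set.nonempty_Icc.2 hab) hcont.continuousOn
  refine ⟨_, sub_pos.2 (Real.arctan_strictMono (tanh_strictMono (show β * J₀ < J₀ from ?_))),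
    fun J hJ => ?_⟩
  · nlinarith [hJ₀.1]
  · have h : Real.arctan (Real.tanh J₀) - Real.arctan (Real.tanh (β * J₀)) ≤
        Real.arctan (Real.tanh J) - Real.arctan (Real.tanh (β * J)) := hmin hJ
    linarith

/-- The arctangent is 1-Lipschitz, and x/s - x = x(s⁻¹ - 1) ≤ s⁻¹ - 1. -/
theorem arctan_div_le {x s : ℝ} (hx0 : 0 ≤ x) (hx : x ≤ 1) (hs : 0 < s) (hs1 : s ≤ 1) :
    Real.arctan (x / s) ≤ Real.arctan x + (s⁻¹ - 1) := by
  have hs2 : 1 ≤ s⁻¹ := (one_le_inv₀ hs).2 hs1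
  have h := image_sub_le_mul_sub_of_deriv_le Real.differentiable_arctan (C := 1) (fun y => by
    rw [Real.deriv_arctan, div_le_one (by positivity)]
    nlinarith [sq_nonneg y]) (x := x) (y := x / s) (by rw [div_eq_mul_inv]; nlinarith)
  rw [div_eq_mul_inv] at *
  nlinarith

section Weights

variable {ρ β k : ℝ} {e : Sym2 ℂ}

theorem weight_one (he : edgeAngle ρ e ∈ Set.Ioo 0 (π / 2)) :
    weight ρ 1 e = Real.tan (edgeAngle ρ e / 2) := by
  have h := tan_half_mem he
  rw [weight, one_mul, coupling, Real.tanh_artanh ⟨by linarith [h.1], h.2⟩]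

theorem coupling_pos (he : edgeAngle ρ e ∈ Set.Ioo 0 (π / 2)) : 0 < coupling ρ e :=
  Real.artanh_pos (tan_half_mem he)

theorem arctan_weight_le (hβ1 : β ≤ 1) (he : edgeAngle ρ e ∈ Set.Ioo 0 (π / 2)) :
    Real.arctan (weight ρ β e) ≤ edgeAngle ρ e / 2 := by
  rw [← arctan_tanh_artanh_tan he]
  refine Real.arctan_strictMono.monotone (tanh_strictMono.monotone ?_)
  have := coupling_pos he
  rw [coupling] at this
  rw [coupling]
  nlinarith

theorem coupling_mono {e f : ℝ} (he : e ∈ Set.Ioo 0 (π / 2)) (hf : f ∈ Set.Ioo 0 (π / 2))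
    (hef : e ≤ f) : Real.artanh (Real.tan (e / 2)) ≤ Real.artanh (Real.tan (f / 2)) := by
  refine Real.artanh_le_artanh (by linarith [(tan_half_mem he).1]) (tan_half_mem hf).2 ?_
  refine Real.strictMonoOn_tan.monotoneOn ⟨?_, ?_⟩ ⟨?_, ?_⟩ (by linarith) <;>
    linarith [he.1, hf.1, he.2, hf.2, Real.pi_pos]

theorem weight_lower (hβ : 0 < β) (hk : 0 < k) (he : edgeAngle ρ e ∈ Set.Ioo 0 (π / 2))
    (hke : k ≤ edgeAngle ρ e) :
    Real.tanh (β * Real.artanh (Real.tan (k / 2))) ≤ weight ρ β e :=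
  tanh_strictMono.monotone (mul_le_mul_of_nonneg_left
    (coupling_mono ⟨hk, hke.trans_lt he.2⟩ he hke) hβ.le)

end Weights

/-! ### Uniform contraction for supercritical weights -/

namespace IsIsoradial

variable {Γ G : SimpleGraph ℂ} {ρ k : ℝ}

theorem edgeAngle_mem_edge (hΓ : IsIsoradial Γ ρ) {e : Sym2 ℂ} (he : e ∈ Γ.edgeSet) :
    edgeAngle ρ e ∈ Set.Ioo 0 (π / 2) := by
  induction e using Sym2.ind with | _ z w
  exact hΓ.edgeAngle_mem he

theorem weight_bounds (hΓ : IsIsoradial Γ ρ) (hk : 0 < k)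
    (hθ : ∀ e ∈ Γ.edgeSet, k ≤ edgeAngle ρ e) {β : ℝ} (hβ : 0 < β) :
    ∃ a : ℝ, 0 < a ∧ ∀ e ∈ Γ.edgeSet, a ≤ weight ρ β e ∧ weight ρ β e ≤ 1 := by
  -- Any edge at all shows k < π/2, which keeps tan(k/2) in the domain of `artanh`.
  obtain ⟨e₀, he₀, -⟩ := hΓ.cover 0
  have hk2 : k ∈ Set.Ioo 0 (π / 2) := ⟨hk, (hθ e₀ he₀).trans_lt (hΓ.edgeAngle_mem_edge he₀).2⟩
  exact ⟨_, tanh_pos (mul_pos hβ (Real.artanh_pos (tan_half_mem hk2))), fun e he =>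
    ⟨weight_lower hβ hk (hΓ.edgeAngle_mem_edge he) (hθ e he), (Real.tanh_lt_one _).le⟩⟩

theorem finite_neighborSet_of_le (hΓ : IsIsoradial Γ ρ) (hG : G ≤ Γ) (z : ℂ) :
    (G.neighborSet z).Finite :=
  (hΓ.finite_neighborSet z).subset fun _ h => hG h

theorem nbrs_subset (hΓ : IsIsoradial Γ ρ) (hG : G ≤ Γ) (z : ℂ) :
    nbrs (hΓ.finite_neighborSet_of_le hG) z ⊆ nbrs hΓ.finite_neighborSet z := fun _ hw =>
  (mem_nbrs hΓ.finite_neighborSet).2 (hG ((mem_nbrs _).1 hw))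

theorem arg_sub_injOn_of_le (hΓ : IsIsoradial Γ ρ) (hG : G ≤ Γ) (z : ℂ) :
    Set.InjOn (fun w => Complex.arg (w - z)) {w | G.Adj z w} :=
  hΓ.arg_sub_injOn.mono fun _ h => hG h

theorem sum_edgeAngle_nbrs (hΓ : IsIsoradial Γ ρ) {z z₀ : ℂ} (h₀ : Γ.Adj z z₀) :
    ∑ w ∈ nbrs hΓ.finite_neighborSet z, edgeAngle ρ s(z, w) = π :=
  hΓ.sum_edgeAngle h₀ fun _ => mem_nbrs hΓ.finite_neighborSet

/-- The angles at a vertex add up to π and each is at least k: a uniform degree bound π/k. -/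
theorem card_nbrs_mul_le (hΓ : IsIsoradial Γ ρ) (hθ : ∀ e ∈ Γ.edgeSet, k ≤ edgeAngle ρ e) (z : ℂ) :
    (nbrs hΓ.finite_neighborSet z).card * k ≤ π := by
  rcases (nbrs hΓ.finite_neighborSet z).eq_empty_or_nonempty with h | ⟨z₀, h₀⟩
  · rw [h]; simpa using Real.pi_pos.le
  · rw [← hΓ.sum_edgeAngle_nbrs ((mem_nbrs _).1 h₀), ← nsmul_eq_mul]
    exact Finset.card_nsmul_le_sum _ _ _ fun w hw => hθ _ ((mem_nbrs _).1 hw)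

/-- Every vertex has an edge whose angle is at most `π / 3`, since its degree is at least three. -/
theorem exists_edgeAngle_le (hΓ : IsIsoradial Γ ρ) {z z₀ : ℂ} (h₀ : Γ.Adj z z₀) :
    ∃ w, Γ.Adj z w ∧ edgeAngle ρ s(z, w) ≤ π / 3 := by
  by_contra! h
  have hsum := hΓ.sum_edgeAngle_nbrs h₀
  set N := nbrs hΓ.finite_neighborSet z
  have hne : N.Nonempty := ⟨z₀, (mem_nbrs _).2 h₀⟩
  -- If all angles were strictly between π/3 and π/2, the sum π would force a degree strictly
  -- between 2 and 3.
  have h1 : N.card • (π / 3) < ∑ w ∈ N, edgeAngle ρ s(z, w) := by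
    rw [← Finset.sum_const]
    exact Finset.sum_lt_sum_of_nonempty hne fun w hw => h w ((mem_nbrs _).1 hw)
  have h2 : ∑ w ∈ N, edgeAngle ρ s(z, w) < N.card • (π / 2) := by
    rw [← Finset.sum_const]
    exact Finset.sum_lt_sum_of_nonempty hne fun w hw => (hΓ.edgeAngle_mem ((mem_nbrs _).1 hw)).2
  rw [hsum, nsmul_eq_mul] at h1 h2
  have hπ := Real.pi_pos
  have h3 : (N.card : ℝ) < 3 := by nlinarith
  have h4 : (2 : ℝ) < N.card := by nlinarith
  have h5 : N.card < 3 := by exact_mod_cast h3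
  have h6 : 2 < N.card := by exact_mod_cast h4
  omega

/-- For supercritical weights, the blocks at all vertices are uniformly strict contractions. -/
theorem exists_uniform_contraction (hΓ : IsIsoradial Γ ρ) (hk : 0 < k)
    (hθ : ∀ e ∈ Γ.edgeSet, k ≤ edgeAngle ρ e) {β : ℝ} (hβ : 0 < β) (hβ1 : β < 1) :
    ∃ s : ℝ, 0 < s ∧ s < 1 ∧ ∀ (G : SimpleGraph ℂ) (hG : G ≤ Γ) (z : ℂ),
      ∑ w ∈ nbrs (hΓ.finite_neighborSet_of_le hG) z, Real.arctan (weight ρ β s(z, w) / s) ≤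
        π / 2 := by
  classical
  have hπ := Real.pi_pos
  obtain ⟨e₀, he₀, -⟩ := hΓ.cover 0
  have hk2 : k ∈ Set.Ioo 0 (π / 2) := ⟨hk, (hθ e₀ he₀).trans_lt (hΓ.edgeAngle_mem_edge he₀).2⟩
  have h3 : π / 3 ∈ Set.Ioo 0 (π / 2) := ⟨by linarith, by linarith⟩
  -- The gap δ is gained at a single edge with k ≤ θ ≤ π/3; at the other edges arctan x ≤ θ/2 is
  -- enough.
  obtain ⟨δ, hδ, hgap⟩ := exists_gap hβ1 (a := Real.artanh (Real.tan (k / 2)))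
    (b := Real.artanh (Real.tan (π / 3 / 2))) (Real.artanh_pos (tan_half_mem hk2))
  have hw0 : ∀ z w, Γ.Adj z w → 0 < weight ρ β s(z, w) := fun z w h =>
    tanh_pos (mul_pos hβ (coupling_pos (hΓ.edgeAngle_mem h)))
  -- Dividing by s costs at most s⁻¹ - 1 = δk/π per edge, and at most δ in total over π/k edges.
  refine ⟨(1 + δ * k / π)⁻¹, by positivity, inv_lt_one_of_one_lt₀ (by
    have : 0 < δ * k / π := by positivity
    linarith), fun G hG z => ?_⟩
  set s := (1 + δ * k / π)⁻¹ with hs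
  have hs0 : 0 < s := by positivity
  have hs1 : s ≤ 1 := inv_le_one_of_one_le₀ (by
    have : 0 < δ * k / π := by positivity
    linarith)
  refine (Finset.sum_le_sum_of_subset_of_nonneg (hΓ.nbrs_subset hG z) fun w hw _ =>
    (Real.arctan_pos.2 (div_pos (hw0 z w ((mem_nbrs _).1 hw)) hs0)).le).trans ?_
  set N := nbrs hΓ.finite_neighborSet z with hN
  rcases N.eq_empty_or_nonempty with hemp | ⟨z₀, h₀⟩
  · rw [hemp, Finset.sum_empty]; positivity
  have h₀ : Γ.Adj z z₀ := (mem_nbrs _).1 h₀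
  obtain ⟨w₀, hw₀, hle⟩ := hΓ.exists_edgeAngle_le h₀
  have hw₀N : w₀ ∈ N := (mem_nbrs _).2 hw₀
  have hsum := hΓ.sum_edgeAngle_nbrs h₀
  have hcard := hΓ.card_nbrs_mul_le hθ z
  rw [← hN] at hsum hcard
  have hm₀ := hΓ.edgeAngle_mem hw₀
  have hgap₀ : Real.arctan (weight ρ β s(z, w₀)) + δ ≤ edgeAngle ρ s(z, w₀) / 2 := by
    rw [← arctan_tanh_artanh_tan hm₀]
    exact hgap _ ⟨coupling_mono hk2 hm₀ (hθ _ hw₀), coupling_mono hm₀ h3 hle⟩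
  have hsum1 : ∑ w ∈ N, Real.arctan (weight ρ β s(z, w)) + δ ≤ π / 2 := by
    rw [← hsum, Finset.sum_div, ← Finset.add_sum_erase _ _ hw₀N, ← Finset.add_sum_erase _ _ hw₀N]
    have : ∑ w ∈ N.erase w₀, Real.arctan (weight ρ β s(z, w)) ≤
        ∑ w ∈ N.erase w₀, edgeAngle ρ s(z, w) / 2 := Finset.sum_le_sum fun w hw =>
      arctan_weight_le hβ1.le (hΓ.edgeAngle_mem ((mem_nbrs _).1 (Finset.mem_of_mem_erase hw)))
    linarith
  calc ∑ w ∈ N, Real.arctan (weight ρ β s(z, w) / s)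
      ≤ ∑ w ∈ N, (Real.arctan (weight ρ β s(z, w)) + (s⁻¹ - 1)) :=
        Finset.sum_le_sum fun w hw => arctan_div_le (hw0 z w ((mem_nbrs _).1 hw)).le
          (Real.tanh_lt_one _).le hs0 hs1
    _ = ∑ w ∈ N, Real.arctan (weight ρ β s(z, w)) + N.card * k * (δ / π) := by
        rw [Finset.sum_add_distrib, Finset.sum_const, nsmul_eq_mul, hs, inv_inv]
        ring
    _ ≤ ∑ w ∈ N, Real.arctan (weight ρ β s(z, w)) + π * (δ / π) := by gcongr
    _ ≤ π / 2 := by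
        rw [mul_div_cancel₀ _ hπ.ne']
        exact hsum1

theorem sum_arctan_critical (hΓ : IsIsoradial Γ ρ) {z z₀ : ℂ} (h₀ : Γ.Adj z z₀) :
    ∑ w ∈ nbrs hΓ.finite_neighborSet z, Real.arctan (weight ρ 1 s(z, w)) = π / 2 := by
  rw [← hΓ.sum_edgeAngle_nbrs h₀, Finset.sum_div]
  refine Finset.sum_congr rfl fun w hw => ?_
  have hm := hΓ.edgeAngle_mem ((mem_nbrs _).1 hw)
  rw [← arctan_tanh_artanh_tan hm, weight, one_mul, coupling]

theorem sum_arctan_critical_le (hΓ : IsIsoradial Γ ρ) (hG : G ≤ Γ) (z : ℂ) :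
    ∑ w ∈ nbrs (hΓ.finite_neighborSet_of_le hG) z, Real.arctan (weight ρ 1 s(z, w) / 1) ≤
      π / 2 := by
  simp only [div_one]
  refine (Finset.sum_le_sum_of_subset_of_nonneg (hΓ.nbrs_subset hG z) fun w hw _ =>
    (Real.arctan_pos.2 (tanh_pos (mul_pos one_pos
      (coupling_pos (hΓ.edgeAngle_mem ((mem_nbrs _).1 hw)))))).le).trans ?_
  rcases (nbrs hΓ.finite_neighborSet z).eq_empty_or_nonempty with hemp | ⟨z₀, h₀⟩
  · rw [hemp, Finset.sum_empty]; positivity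
  · exact (hΓ.sum_arctan_critical ((mem_nbrs _).1 h₀)).le

/-- The supercritical parts of the theorem. -/
theorem supercritical (hΓ : IsIsoradial Γ ρ) (hk : 0 < k)
    (hθ : ∀ e ∈ Γ.edgeSet, k ≤ edgeAngle ρ e) {β : ℝ} (hβ : 0 < β) (hβ1 : β < 1) :
    ∃ C ε : ℝ, 0 < C ∧ 0 < ε ∧ ε < 1 ∧ ∀ G : SimpleGraph ℂ, G ≤ Γ →
      InverseIsWalkSeries G (weight ρ β) ∧ ∀ (e g : G.Dart) (r : ℕ),
        ‖walkSum G (weight ρ β) r e g‖ ≤ C * ε ^ r := by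
  obtain ⟨a, ha, hx⟩ := hΓ.weight_bounds hk hθ hβ
  obtain ⟨s, hs, hs1, hsum⟩ := hΓ.exists_uniform_contraction hk hθ hβ hβ1
  refine ⟨(√a)⁻¹, s, inv_pos.2 (Real.sqrt_pos.2 ha), hs, hs1, fun G hG => ?_⟩
  exact walkSeries_of_contraction (hΓ.finite_neighborSet_of_le hG) ha
    (fun e he => hx e (SimpleGraph.edgeSet_mono hG he)) hs hs1 (hΓ.arg_sub_injOn_of_le hG)
    (hsum G hG)

end IsIsoradial

/-! ### Critical weights on finite graphs -/

/-- Gelfand's formula and comparison with a geometric series of ratio q between the spectral radius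
and 1. -/
theorem summable_pow_of_spectralRadius_lt_one {A : Type*} [NormedRing A] [NormedAlgebra ℂ A]
    [CompleteSpace A] {a : A} (ha : spectralRadius ℂ a < 1) : Summable fun n : ℕ => a ^ n := by
  obtain ⟨q, hq1, hq2⟩ := ENNReal.lt_iff_exists_nnreal_btwn.1 ha
  have hq2 : (q : ℝ) < 1 := by exact_mod_cast hq2
  have h := (spectrum.pow_nnnorm_pow_one_div_tendsto_nhds_spectralRadius a).eventually_lt_const hq1
  refine Summable.of_norm_bounded_eventually_nat (g := fun n => (q : ℝ) ^ n)
    (summable_geometric_of_lt_one q.2 hq2) ?_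
  filter_upwards [h, Filter.eventually_gt_atTop 0] with n hn hn0
  have hn' : (n : ℝ) ≠ 0 := by positivity
  have h1 : ((‖a ^ n‖₊ : ENNReal) ^ (1 / n : ℝ)) ^ (n : ℝ) ≤ (q : ENNReal) ^ (n : ℝ) :=
    ENNReal.rpow_le_rpow hn.le (by positivity)
  rw [← ENNReal.rpow_mul, one_div_mul_cancel hn', ENNReal.rpow_one, ENNReal.rpow_natCast] at h1
  exact_mod_cast h1

theorem exists_eigenvector {E : Type*} [NormedAddCommGroup E] [NormedSpace ℂ E] [CompleteSpace E]
    [FiniteDimensional ℂ E] {A : E →L[ℂ] E} {c : ℂ} (hc : c ∈ spectrum ℂ A) :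
    ∃ φ : E, φ ≠ 0 ∧ A φ = c • φ := by
  by_contra! h
  refine hc ?_
  set B := algebraMap ℂ (E →L[ℂ] E) c - A with hB
  have hBf : ∀ φ, B φ = c • φ - A φ := fun φ => by
    rw [hB, _root_.sub_apply, Algebra.algebraMap_eq_smul_one]; rfl
  have hinj : Function.Injective B := by
    rw [injective_iff_map_eq_zero]
    intro φ hφ
    by_contra hne
    rw [hBf, sub_eq_zero] at hφ
    exact h φ hne hφ.symm
  have hsurj : Function.Surjective B :=
    (LinearMap.injective_iff_surjective (f := (B : E →ₗ[ℂ] E))).1 hinj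
  exact ContinuousLinearMap.isUnit_iff_bijective.2 ⟨hinj, hsurj⟩

theorem finite_dart {G : SimpleGraph ℂ} (hfin : G.edgeSet.Finite) : Finite G.Dart := by
  have h : ((fun g : G.Dart => g.edge) ⁻¹' G.edgeSet).Finite := by
    refine hfin.preimage' fun e _ => ?_
    by_cases hne : ∃ d : G.Dart, d.edge = e
    · obtain ⟨d, rfl⟩ := hne
      refine (Set.toFinite {d, d.symm}).subset fun d' hd' => ?_
      exact (SimpleGraph.dart_edge_eq_iff d' d).1 hd'
    · convert Set.finite_empty
      ext d
      simp only [Set.mem_preimage, Set.mem_singleton_iff, Set.mem_empty_iff_false, iff_false]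
      exact fun hd => hne ⟨d, hd⟩
  have e : ((fun g : G.Dart => g.edge) ⁻¹' G.edgeSet) = Set.univ :=
    Set.eq_univ_of_forall fun g => g.edge_mem
  rw [e] at h
  exact Set.finite_univ_iff.1 h

theorem exists_contraction_factor {ι : Type*} (N : Finset ι) {x : ι → ℝ}
    (hx : ∀ i ∈ N, 0 ≤ x i ∧ x i ≤ 1) (hsum : ∑ i ∈ N, Real.arctan (x i) < π / 2) :
    ∃ s : ℝ, 0 < s ∧ s < 1 ∧ ∑ i ∈ N, Real.arctan (x i / s) ≤ π / 2 := by
  -- The slack is divided among the terms; the +1 avoids division by zero when N is empty.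
  set δ := (π / 2 - ∑ i ∈ N, Real.arctan (x i)) / (N.card + 1) with hδ
  have hδ0 : 0 < δ := div_pos (by linarith) (by positivity)
  refine ⟨(1 + δ)⁻¹, by positivity, inv_lt_one_of_one_lt₀ (by linarith), ?_⟩
  calc ∑ i ∈ N, Real.arctan (x i / (1 + δ)⁻¹)
      ≤ ∑ i ∈ N, (Real.arctan (x i) + ((1 + δ)⁻¹⁻¹ - 1)) :=
        Finset.sum_le_sum fun i hi => arctan_div_le (hx i hi).1 (hx i hi).2 (by positivity)
          (inv_le_one_of_one_le₀ (by linarith))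
    _ = ∑ i ∈ N, Real.arctan (x i) + N.card * δ := by
        rw [Finset.sum_add_distrib, Finset.sum_const, nsmul_eq_mul, inv_inv]; ring
    _ ≤ ∑ i ∈ N, Real.arctan (x i) + (N.card + 1) * δ := by linarith
    _ = π / 2 := by rw [hδ, mul_div_cancel₀ _ (by positivity)]; ring

namespace IsIsoradial

variable {Γ G : SimpleGraph ℂ} {ρ k : ℝ}

/-- The block at `z` without a neighbour `w` in `Γ` is a strict contraction. -/
theorem eq_zero_of_block_isometry (hΓ : IsIsoradial Γ ρ) (hG : G ≤ Γ) {z w : ℂ} (hw : Γ.Adj z w)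
    {v : ℂ → ℂ} (hvw : w ∈ nbrs (hΓ.finite_neighborSet_of_le hG) z → v w = 0 ∧
      ∑ w' ∈ nbrs (hΓ.finite_neighborSet_of_le hG) z,
        block (fun w => weight ρ 1 s(z, w)) z w w' * v w' = 0)
    (hv : ∑ u ∈ nbrs (hΓ.finite_neighborSet_of_le hG) z, ‖v u‖ ^ 2 ≤
      ∑ u ∈ nbrs (hΓ.finite_neighborSet_of_le hG) z,
        ‖∑ w' ∈ nbrs (hΓ.finite_neighborSet_of_le hG) z,
          block (fun w => weight ρ 1 s(z, w)) z u w' * v w'‖ ^ 2) :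
    ∀ u ∈ nbrs (hΓ.finite_neighborSet_of_le hG) z, v u = 0 := by
  classical
  set N := nbrs (hΓ.finite_neighborSet_of_le hG) z with hN
  set B := block (fun w => weight ρ 1 s(z, w)) z with hB
  have hpos : ∀ u, Γ.Adj z u → 0 < weight ρ 1 s(z, u) := fun u hu =>
    tanh_pos (mul_pos one_pos (coupling_pos (hΓ.edgeAngle_mem hu)))
  have hadj : ∀ u ∈ N.erase w, G.Adj z u := fun u hu => (mem_nbrs _).1 (Finset.mem_of_mem_erase hu)
  -- The sum over all neighbours in Γ is exactly π/2, so leaving out the positive term of w makes it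
  -- strictly smaller, whether or not zw is an edge of G.
  have hlt : ∑ u ∈ N.erase w, Real.arctan (weight ρ 1 s(z, u)) < π / 2 := by
    rw [← hΓ.sum_arctan_critical hw]
    refine Finset.sum_lt_sum_of_subset
      ((Finset.erase_subset _ _).trans (hΓ.nbrs_subset hG z)) ((mem_nbrs _).2 hw)
      (Finset.notMem_erase w N) (Real.arctan_pos.2 (hpos w hw)) fun u hu _ =>
        (Real.arctan_pos.2 (hpos u ((mem_nbrs _).1 hu))).le
  obtain ⟨s, hs, hs1, hsum⟩ := exists_contraction_factor (N.erase w)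
    (fun u hu => ⟨(hpos u (hG (hadj u hu))).le, (Real.tanh_lt_one _).le⟩) hlt
  have key := sum_norm_block_le hs (N := N.erase w) (fun u hu => (hadj u hu).ne.symm)
    ((hΓ.arg_sub_injOn_of_le hG z).mono fun u hu => hadj u hu)
    (x := fun u => weight ρ 1 s(z, u)) (fun u hu => hpos u (hG (hadj u hu))) hsum v
  -- If w is present, both the input and the output vanish there, so removing its row and column
  -- loses nothing.
  have hrow : ∀ u, ∑ w' ∈ N.erase w, B u w' * v w' = ∑ w' ∈ N, B u w' * v w' := fun u =>
    Finset.sum_subset (Finset.erase_subset _ _) fun w' hw' hne => by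
      have : w' = w := by by_contra h; exact hne (Finset.mem_erase.2 ⟨h, hw'⟩)
      subst this
      rw [(hvw hw').1, mul_zero]
  have hcol : ∑ u ∈ N.erase w, ‖∑ w' ∈ N, B u w' * v w'‖ ^ 2 =
      ∑ u ∈ N, ‖∑ w' ∈ N, B u w' * v w'‖ ^ 2 :=
    Finset.sum_subset (Finset.erase_subset _ _) fun u hu hne => by
      have : u = w := by by_contra h; exact hne (Finset.mem_erase.2 ⟨h, hu⟩)
      subst this
      rw [(hvw hu).2, norm_zero, sq, zero_mul]
  simp only [← hB, hrow] at key
  rw [hcol] at key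
  have h1 : ∑ u ∈ N.erase w, ‖v u‖ ^ 2 ≤ ∑ u ∈ N, ‖v u‖ ^ 2 :=
    Finset.sum_le_sum_of_subset_of_nonneg (Finset.erase_subset _ _) fun _ _ _ => by positivity
  have h2 : 0 ≤ ∑ u ∈ N, ‖v u‖ ^ 2 := Finset.sum_nonneg fun _ _ => by positivity
  have h3 : s ^ 2 < 1 := by nlinarith
  have h4 : ∑ u ∈ N, ‖v u‖ ^ 2 ≤ s ^ 2 * ∑ u ∈ N, ‖v u‖ ^ 2 :=
    hv.trans (key.trans (mul_le_mul_of_nonneg_left h1 (sq_nonneg s)))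
  have h5 : ∑ u ∈ N, ‖v u‖ ^ 2 = 0 := by nlinarith
  intro u hu
  have := (Finset.sum_eq_zero_iff_of_nonneg fun _ _ => by positivity).1 h5 u hu
  simpa using this

/-- An extremal argument: at a rightmost tail of the support of φ the block effectively loses an
edge and contracts strictly, whereas ‖c‖ ≥ 1 forces every block to preserve the norm of φ. -/
theorem no_eigenvector (hΓ : IsIsoradial Γ ρ) (hG : G ≤ Γ) (hfin : G.edgeSet.Finite)
    {φ : G.Dart → ℂ} {c : ℂ} (hc : 1 ≤ ‖c‖)
    (hφ : ∀ e, rowSum (symTransition (weight ρ 1)) φ e = c * φ e) : φ = 0 := by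
  classical
  have := finite_dart hfin
  have := Fintype.ofFinite G.Dart
  have hf := hΓ.finite_neighborSet_of_le hG
  have hx : ∀ e ∈ G.edgeSet, 0 < weight ρ 1 e := fun e he =>
    tanh_pos (mul_pos one_pos (coupling_pos (hΓ.edgeAngle_mem_edge
      (SimpleGraph.edgeSet_mono hG he))))
  have hc0 : c ≠ 0 := norm_pos_iff.1 (one_pos.trans_le hc)
  by_contra hne
  obtain ⟨g₀, hg₀⟩ := Function.ne_iff.1 hne
  -- An edge g in the support whose tail has the largest real part; this is where finiteness of G
  -- enters.
  obtain ⟨g, hg, hmax⟩ := (Finset.univ.filter fun g => φ g ≠ 0).exists_max_image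
    (fun g => g.fst.re) ⟨g₀, by simpa using hg₀⟩
  have hg : φ g ≠ 0 := by simpa using hg
  have hmax : ∀ f : G.Dart, g.fst.re < f.fst.re → φ f = 0 := fun f hlt => by
    by_contra h
    exact absurd (hmax f (by simpa using h)) (not_le.2 hlt)
  set z := g.fst with hz
  obtain ⟨w, hw, hwre⟩ := hΓ.exists_adj_re_lt (hG g.adj)
  -- all blocks are isometric on `φ`
  have hblock : ∀ y, ∑ e ∈ inDarts hf y, ‖rowSum (symTransition (weight ρ 1)) φ e‖ ^ 2 ≤
      ∑ e ∈ outDarts hf y, ‖φ e‖ ^ 2 := fun y => by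
    simpa using sum_norm_symTransition_le hf hx one_pos (hΓ.arg_sub_injOn_of_le hG y)
      (hΓ.sum_arctan_critical_le hG y) φ
  -- Summed over all vertices, both sides of the block bounds run once over all directed edges. A
  -- strict loss at z would contradict ‖Aφ‖ = ‖c‖‖φ‖ ≥ ‖φ‖.
  have hiso : ∑ e ∈ outDarts hf z, ‖φ e‖ ^ 2 ≤
      ∑ e ∈ inDarts hf z, ‖rowSum (symTransition (weight ρ 1)) φ e‖ ^ 2 := by
    by_contra! hlt
    let Z : Finset ℂ := Finset.univ.image fun e : G.Dart => e.fst
    have hZs : ∀ e : G.Dart, e.snd ∈ Z := fun e =>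
      Finset.mem_image.2 ⟨e.symm, Finset.mem_univ _, rfl⟩
    have hZf : ∀ e : G.Dart, e.fst ∈ Z := fun e =>
      Finset.mem_image.2 ⟨e, Finset.mem_univ _, rfl⟩
    have h1 : ∑ y ∈ Z, ∑ e ∈ inDarts hf y, ‖rowSum (symTransition (weight ρ 1)) φ e‖ ^ 2 <
        ∑ y ∈ Z, ∑ e ∈ outDarts hf y, ‖φ e‖ ^ 2 :=
      Finset.sum_lt_sum (fun y _ => hblock y) ⟨z, hZf g, hlt⟩
    have e1 : ∀ F : G.Dart → ℝ, ∑ y ∈ Z, ∑ e ∈ inDarts hf y, F e = ∑ e, F e := fun F => by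
      rw [← Finset.sum_fiberwise_of_maps_to (s := Finset.univ) (t := Z) (g := fun e => e.snd)
        (fun e _ => hZs e)]
      refine Finset.sum_congr rfl fun y _ => Finset.sum_congr ?_ fun _ _ => rfl
      ext e
      simp [mem_inDarts]
    have e2 : ∀ F : G.Dart → ℝ, ∑ y ∈ Z, ∑ e ∈ outDarts hf y, F e = ∑ e, F e := fun F => by
      rw [← Finset.sum_fiberwise_of_maps_to (s := Finset.univ) (t := Z) (g := fun e => e.fst)
        (fun e _ => hZf e)]
      refine Finset.sum_congr rfl fun y _ => Finset.sum_congr ?_ fun _ _ => rfl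
      ext e
      simp [mem_outDarts]
    rw [e1, e2] at h1
    refine absurd h1 (not_lt.2 (Finset.sum_le_sum fun e _ => ?_))
    rw [hφ, norm_mul, mul_pow]
    have : 1 ≤ ‖c‖ ^ 2 := one_le_pow₀ hc
    nlinarith [sq_nonneg ‖φ e‖]
  have hrow : ∀ u (hu : G.Adj z u), ∑ w' ∈ nbrs hf z,
      block (fun w => weight ρ 1 s(z, w)) z u w' * atVertex φ z w' = c * φ ⟨(u, z), hu.symm⟩ :=
    fun u hu => by rw [← rowSum_symTransition hf hx φ hu, hφ]
  have key := hΓ.eq_zero_of_block_isometry hG hw (v := atVertex φ z) (fun hwN => ?_) ?_ g.snd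
    ((mem_nbrs _).2 g.adj)
  · rw [atVertex_of_adj φ g.adj] at key
    exact hg key
  · have hzw : G.Adj z w := (mem_nbrs _).1 hwN
    constructor
    -- All edges leaving w start to the right of z, so φ vanishes on them; the eigenvalue equation
    -- at (z, w) then gives c φ(z, w) = 0.
    · rw [atVertex_of_adj φ hzw]
      have h1 := hφ ⟨(z, w), hzw⟩
      rw [rowSum_symTransition hf hx φ hzw.symm, Finset.sum_eq_zero] at h1
      · exact (mul_eq_zero.1 h1.symm).resolve_left hc0
      · intro w' hw'
        rw [atVertex_of_adj φ ((mem_nbrs _).1 hw'), hmax _ hwre, mul_zero]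
    · rw [hrow w hzw, hmax _ hwre, mul_zero]
  · rw [sum_outDarts, sum_inDarts] at hiso
    refine le_trans (le_of_eq ?_) (hiso.trans (le_of_eq ?_))
    · refine Finset.sum_congr rfl fun u hu => ?_
      have hu := (mem_nbrs _).1 hu
      rw [atVertex_of_adj _ hu, atVertex_of_adj _ hu]
    · refine Finset.sum_congr rfl fun u hu => ?_
      have hu := (mem_nbrs _).1 hu
      rw [atVertex_of_adj _ hu, ← rowSum_symTransition hf hx φ hu]
      rfl

/-- Critical weights on finite subgraphs. -/
theorem critical_finite (hΓ : IsIsoradial Γ ρ) (hk : 0 < k)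
    (hθ : ∀ e ∈ Γ.edgeSet, k ≤ edgeAngle ρ e) (hG : G ≤ Γ) (hfin : G.edgeSet.Finite) :
    InverseIsWalkSeries G (weight ρ 1) := by
  have hf := hΓ.finite_neighborSet_of_le hG
  obtain ⟨a, ha, hx⟩ := hΓ.weight_bounds hk hθ one_pos
  obtain ⟨Λ, A, D, hΛ, hA, rfl, -, -, -⟩ := exists_transition_operator hf ha
    (fun e he => hx e (SimpleGraph.edgeSet_mono hG he)) one_pos (hΓ.arg_sub_injOn_of_le hG)
    (hΓ.sum_arctan_critical_le hG)
  have hAs : Summable fun r : ℕ => A ^ r := by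
    have := finite_dart hfin
    -- Without edges the operator algebra is zero, and the spectral argument needs a nontrivial one.
    rcases subsingleton_or_nontrivial (EdgeSpace G →L[ℂ] EdgeSpace G) with hsub | hnt
    · exact (summable_zero (α := EdgeSpace G →L[ℂ] EdgeSpace G)).congr
        fun r => Subsingleton.elim _ _
    have hfd : FiniteDimensional ℂ (EdgeSpace G) := by
      let L : EdgeSpace G →ₗ[ℂ] (G.Dart → ℂ) :=
        { toFun := fun φ => φ, map_add' := fun _ _ => rfl, map_smul' := fun _ _ => rfl }
      exact FiniteDimensional.of_injective L fun φ χ h => lp.ext h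
    refine summable_pow_of_spectralRadius_lt_one
      (spectrum.spectralRadius_lt_of_forall_lt A (r := 1) fun c hc => ?_)
    by_contra! hlt
    obtain ⟨φ, hφ0, hφ⟩ := exists_eigenvector hc
    refine hφ0 (lp.ext (hΓ.no_eigenvector hG hfin (φ := φ) (c := c) hlt fun e => ?_))
    rw [← hA, hφ]
    rfl
  refine inverseIsWalkSeries_of_summable hf _ hΛ ?_
  have h := (hAs.mul_left D.val).mul_right D.inv
  exact h.congr fun r => (Units.conj_pow D A r).symm

end IsIsoradial

/-! ### Critical weights on the full graph -/

theorem summable_int_inv_sq : Summable fun n : ℤ => (1 + |(n : ℝ)|)⁻¹ ^ 2 := by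
  have h : Summable fun n : ℕ => (1 + (n : ℝ))⁻¹ ^ 2 := by
    have := (summable_nat_add_iff 1).2 (Real.summable_nat_pow_inv.2 (one_lt_two))
    refine this.congr fun n => ?_
    push_cast
    rw [inv_pow, add_comm]
  refine Summable.of_nat_of_neg ?_ ?_ <;>
  · refine h.congr fun n => ?_
    simp

/-- The majorant for the sum of squared cutoffs: their decay of order ‖z‖⁻⁴ is split evenly between
the two coordinates, and the Boolean allows two vertices per lattice cell. -/
theorem summable_lattice :
    Summable fun p : (ℤ × ℤ) × Bool => (1 + |(p.1.1 : ℝ)|)⁻¹ ^ 2 * (1 + |(p.1.2 : ℝ)|)⁻¹ ^ 2 := by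
  have h1 := summable_int_inv_sq.mul_of_nonneg summable_int_inv_sq
    (fun n => by positivity) (fun n => by positivity)
  have h2 : Summable fun _ : Bool => (1 : ℝ) := (hasSum_fintype _).summable
  have h3 := h1.mul_of_nonneg h2 (fun p => by positivity) (fun p => by positivity)
  simpa using h3

/-- A polynomially decaying cutoff. -/
def cutoff (ε : ℝ) (z : ℂ) : ℝ := (1 + ε * ‖z‖)⁻¹ ^ 2

theorem cutoff_pos {ε : ℝ} (hε : 0 < ε) (z : ℂ) : 0 < cutoff ε z := by
  unfold cutoff; positivity

/-- A move by at most r changes 1 + ε‖z‖ by a factor of at most 1 + rε. The relative variation of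
the cutoff thus tends to 0 with ε, uniformly in the plane. -/
theorem abs_cutoff_sub_le {ε r : ℝ} (hε : 0 < ε) (hr : 0 ≤ r) {a b : ℂ} (hab : ‖a - b‖ ≤ r) :
    |cutoff ε a - cutoff ε b| ≤ ((1 + r * ε) ^ 2 - 1) * cutoff ε a := by
  have h1 : 1 + ε * ‖a‖ ≤ (1 + r * ε) * (1 + ε * ‖b‖) := by
    have : ‖a‖ ≤ ‖b‖ + r := by
      have := norm_sub_norm_le a b
      linarith
    nlinarith [norm_nonneg b, mul_nonneg (mul_nonneg hr hε.le) (mul_nonneg hε.le (norm_nonneg b))]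
  have h2 : 1 + ε * ‖b‖ ≤ (1 + r * ε) * (1 + ε * ‖a‖) := by
    have : ‖b‖ ≤ ‖a‖ + r := by
      have := norm_sub_norm_le b a
      rw [norm_sub_rev] at this
      linarith
    nlinarith [norm_nonneg a, mul_nonneg (mul_nonneg hr hε.le) (mul_nonneg hε.le (norm_nonneg a))]
  set A := 1 + ε * ‖a‖ with hA
  set B := 1 + ε * ‖b‖ with hB
  set t := 1 + r * ε with ht
  have hA0 : 0 < A := by positivity
  have hB0 : 0 < B := by positivity
  have ht1 : 1 ≤ t := by rw [ht]; nlinarith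
  have ca : cutoff ε a = A⁻¹ ^ 2 := rfl
  have cb : cutoff ε b = B⁻¹ ^ 2 := rfl
  have k1 : B⁻¹ ≤ t * A⁻¹ := by
    rw [← div_eq_mul_inv, inv_le_comm₀ hB0 (by positivity), inv_div, div_le_iff₀ (by positivity)]
    linarith
  have k2 : A⁻¹ ≤ t * B⁻¹ := by
    rw [← div_eq_mul_inv, inv_le_comm₀ hA0 (by positivity), inv_div, div_le_iff₀ (by positivity)]
    linarith
  have k3 : B⁻¹ ^ 2 ≤ t ^ 2 * A⁻¹ ^ 2 := by
    rw [← mul_pow]; exact pow_le_pow_left₀ (by positivity) k1 2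
  have k4 : A⁻¹ ^ 2 ≤ t ^ 2 * B⁻¹ ^ 2 := by
    rw [← mul_pow]; exact pow_le_pow_left₀ (by positivity) k2 2
  have p1 : 0 < A⁻¹ ^ 2 := by positivity
  have p2 : 0 < B⁻¹ ^ 2 := by positivity
  have ht2 : 1 ≤ t ^ 2 := one_le_pow₀ ht1
  rw [ca, cb, abs_le]
  constructor
  · nlinarith
  · by_cases h : A⁻¹ ^ 2 ≤ B⁻¹ ^ 2
    · nlinarith
    · push Not at h
      nlinarith

/-- Whether a nonzero complex number points to the right half plane. -/
def pointsRight (d : ℂ) : Prop := 0 < d.re ∨ (d.re = 0 ∧ 0 < d.im)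

/-- Exactly one orientation of an edge points right, so this bit tells its two endpoints apart. -/
theorem pointsRight_neg {d : ℂ} (hd : d ≠ 0) : pointsRight (-d) ↔ ¬pointsRight d := by
  have h : d.re ≠ 0 ∨ d.im ≠ 0 := by
    by_contra! h
    exact hd (Complex.ext h.1 h.2)
  simp only [pointsRight, Complex.neg_re, Complex.neg_im, neg_eq_zero, Left.neg_pos_iff]
  constructor
  · rintro (h1 | h1) (h2 | h2)
    · linarith
    · linarith [h2.1]
    · linarith [h1.1]
    · linarith [h1.2, h2.2]
  · intro hn
    push Not at hn
    obtain ⟨h1, h2⟩ := hn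
    rcases h1.lt_or_eq with h3 | h3
    · exact Or.inl h3
    · exact Or.inr ⟨h3, lt_of_le_of_ne (h2 h3) (h.resolve_left (not_not.2 h3))⟩

namespace IsIsoradial

variable {Γ : SimpleGraph ℂ} {ρ k : ℝ}

theorem norm_sub_eq (hΓ : IsIsoradial Γ ρ) {z w : ℂ} (h : Γ.Adj z w) :
    ‖w - z‖ = 2 * ρ * Real.cos (edgeAngle ρ s(z, w)) := by
  have := hΓ.radius_pos
  rw [cos_edgeAngle this (hΓ.dist_lt _ _ h), mul_div_cancel₀ _ (by positivity)]

/-- The midpoints of edges with angle in `[k, π / 3]` are uniformly separated. -/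
theorem edge_eq_of_midpoint_close (hΓ : IsIsoradial Γ ρ) (hk : 0 < k)
    {z w z' w' : ℂ} (h : Γ.Adj z w) (h' : Γ.Adj z' w')
    (hθk : k ≤ edgeAngle ρ s(z, w)) (hθ : edgeAngle ρ s(z, w) ≤ π / 3)
    (hm : ‖(z' + w') / 2 - (z + w) / 2‖ ≤ ρ * Real.sin k / 4) : s(z', w') = s(z, w) := by
  by_contra hne
  refine hΓ.midpoint_notMem_rhombus h' h hne ?_
  have hρ := hΓ.radius_pos
  have hlt := hΓ.dist_lt _ _ h
  have hτ := slope_pos h.ne hlt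
  have hsq := slope_sq h.ne hlt
  have hπ := Real.pi_pos
  have hmem := hΓ.edgeAngle_mem h
  set θ := edgeAngle ρ s(z, w) with hθdef
  have hD : ‖w - z‖ = 2 * ρ * Real.cos θ := hΓ.norm_sub_eq h
  have hcos : 1 / 2 ≤ Real.cos θ := by
    rw [← Real.cos_pi_div_three]
    exact Real.cos_le_cos_of_nonneg_of_le_pi hmem.1.le (by linarith) hθ
  have hsink : 0 < Real.sin k := Real.sin_pos_of_pos_of_lt_pi hk (by linarith)
  have hsin : Real.sin k ≤ Real.sin θ :=
    Real.sin_le_sin_of_le_of_le_pi_div_two (by linarith) hmem.2.le hθk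
  set τ := slope ρ z w with hτdef
  set D := ‖w - z‖ with hDdef
  have hD1 : ρ ≤ D := by rw [hD]; nlinarith
  have hD0 : 0 < D := hρ.trans_le hD1
  -- τD is the length 2ρ sin θ of the dual diagonal. With D ≥ ρ the rhombus is fat in both
  -- directions, so it contains the midpoint of z'w', which no other rhombus may contain.
  have hτD : 2 * ρ * Real.sin k ≤ τ * D := by
    refine abs_le_of_sq_le_sq' ?_ (by positivity) |>.2
    have h1 := Real.sin_sq_add_cos_sq θ
    have h2 : (2 * ρ * Real.sin k) ^ 2 ≤ (2 * ρ * Real.sin θ) ^ 2 :=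
      pow_le_pow_left₀ (by positivity) (by gcongr) 2
    nlinarith
  set q := ((z' + w') / 2 - (z + w) / 2) / ((w - z) / 2) with hq
  have hne' : w - z ≠ 0 := sub_ne_zero.2 h.ne.symm
  have key := mem_rhombus h.ne hlt hρ (q := q) ?_
  · have e : (z' + w') / 2 = (z + w) / 2 + (w - z) / 2 * q := by rw [hq]; field_simp; ring
    rw [e]; exact key
  have hqn : ‖q‖ * D ≤ ρ * Real.sin k / 2 := by
    have : ‖q‖ * D = 2 * ‖(z' + w') / 2 - (z + w) / 2‖ := by
      rw [hq, norm_div, norm_div, ← hDdef, Complex.norm_two]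
      field_simp
    linarith
  have hr : |q.re| ≤ 1 / 2 := by
    refine (Complex.abs_re_le_norm q).trans ?_
    have : ‖q‖ * ρ ≤ ‖q‖ * D := mul_le_mul_of_nonneg_left hD1 (norm_nonneg q)
    have hs1 := Real.sin_le_one k
    nlinarith [norm_nonneg q]
  have hi : |q.im| / τ ≤ 1 / 2 := by
    rw [div_le_iff₀ hτ]
    refine (Complex.abs_im_le_norm q).trans ?_
    have : ‖q‖ * D ≤ 1 / 2 * τ * D := by nlinarith
    exact le_of_mul_le_mul_right this hD0
  linarith

/-- The bound k ≤ θ gives no lower bound for the edge lengths 2ρ cos θ, so vertices need not be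
separated. Instead each vertex z is represented by an edge zW(z) with θ ≤ π/3. The midpoints of such
edges are separated, and each edge represents at most its two endpoints. -/
theorem summable_cutoff_aux (hΓ : IsIsoradial Γ ρ) (hk : 0 < k)
    (hθ : ∀ e ∈ Γ.edgeSet, k ≤ edgeAngle ρ e) {ε : ℝ} (hε : 0 < ε) :
    ∃ C : ℝ, ∀ Z : Finset ℂ, (∀ z ∈ Z, ∃ w, Γ.Adj z w) → ∑ z ∈ Z, cutoff ε z ^ 2 ≤ C := by
  classical
  have hρ := hΓ.radius_pos
  obtain ⟨e₀, he₀, -⟩ := hΓ.cover 0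
  have hk2 : k < π / 2 := (hθ e₀ he₀).trans_lt (hΓ.edgeAngle_mem_edge he₀).2
  have hsink : 0 < Real.sin k := Real.sin_pos_of_pos_of_lt_pi hk (by linarith [Real.pi_pos])
  -- With this mesh two points in one cell differ by at most 2δ = ρ sin k / 4, the separation in
  -- `edge_eq_of_midpoint_close`.
  set δ := ρ * Real.sin k / 8 with hδ
  have hδ0 : 0 < δ := by positivity
  have hex : ∀ z, ∃ w, (∃ w, Γ.Adj z w) → Γ.Adj z w ∧ edgeAngle ρ s(z, w) ≤ π / 3 := by
    intro z
    by_cases h : ∃ w, Γ.Adj z w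
    · obtain ⟨w, hw⟩ := h
      obtain ⟨w', hw'⟩ := hΓ.exists_edgeAngle_le hw
      exact ⟨w', fun _ => hw'⟩
    · exact ⟨0, fun h' => absurd h' h⟩
  choose W hW using hex
  let F : ℂ → (ℤ × ℤ) × Bool := fun z =>
    ((⌊((z + W z) / 2).re / δ⌋, ⌊((z + W z) / 2).im / δ⌋), decide (pointsRight (W z - z)))
  have hclose : ∀ {x y : ℝ}, ⌊x / δ⌋ = ⌊y / δ⌋ → |x - y| ≤ δ := by
    intro x y h
    have h1 := Int.abs_sub_lt_one_of_floor_eq_floor h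
    rw [← sub_div, abs_div, abs_of_pos hδ0, div_lt_one hδ0] at h1
    exact h1.le
  have hinj : ∀ z z', (∃ w, Γ.Adj z w) → (∃ w, Γ.Adj z' w) → F z = F z' → z = z' := by
    intro z z' hz hz' hF
    obtain ⟨hz1, hz2⟩ := hW z hz
    obtain ⟨hz1', hz2'⟩ := hW z' hz'
    simp only [F, Prod.mk.injEq] at hF
    obtain ⟨⟨h1, h2⟩, h3⟩ := hF
    have hm : ‖(z' + W z') / 2 - (z + W z) / 2‖ ≤ ρ * Real.sin k / 4 := by
      refine (Complex.norm_le_abs_re_add_abs_im _).trans ?_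
      have := hclose h1.symm
      have := hclose h2.symm
      rw [Complex.sub_re, Complex.sub_im]
      linarith
    have he := hΓ.edge_eq_of_midpoint_close hk hz1 hz1' (hθ _ hz1) hz2 hm
    rcases Sym2.eq_iff.1 he with ⟨h4, -⟩ | ⟨h4, h5⟩
    · exact h4.symm
    · exfalso
      have h6 : W z' - z' = -(W z - z) := by rw [h5, h4]; ring
      rw [h6, decide_eq_decide, pointsRight_neg (sub_ne_zero.2 hz1.ne.symm)] at h3
      tauto
  set C := 2 + ρ / δ + 1 / (δ * ε) with hC
  have hC0 : 0 < C := by positivity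
  have hfloor : ∀ (x : ℝ) (z : ℂ), |x| ≤ ‖z‖ + ρ → 1 + |((⌊x / δ⌋ : ℤ) : ℝ)| ≤ C * (1 + ε * ‖z‖) := by
    intro x z hx
    have h1 : |((⌊x / δ⌋ : ℤ) : ℝ)| ≤ |x| / δ + 1 := by
      have h2 := Int.floor_le (x / δ)
      have h3 := Int.lt_floor_add_one (x / δ)
      have h4 : |x / δ| = |x| / δ := by rw [abs_div, abs_of_pos hδ0]
      have h5 := abs_le.1 h4.le
      rw [abs_le]
      constructor <;> linarith
    have h2 : |x| / δ ≤ (‖z‖ + ρ) / δ := by gcongr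
    have h3 : (‖z‖ + ρ) / δ = 1 / (δ * ε) * (ε * ‖z‖) + ρ / δ := by field_simp
    have h4 : 0 ≤ (2 + ρ / δ) * (ε * ‖z‖) := by positivity
    have h5 : 0 < 1 / (δ * ε) := by positivity
    rw [hC]
    linarith
  have hcomp : ∀ z, (∃ w, Γ.Adj z w) → cutoff ε z ^ 2 ≤ C ^ 4 *
      ((1 + |((F z).1.1 : ℝ)|)⁻¹ ^ 2 * (1 + |((F z).1.2 : ℝ)|)⁻¹ ^ 2) := by
    intro z hz
    obtain ⟨hz1, -⟩ := hW z hz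
    have hm : ‖(z + W z) / 2‖ ≤ ‖z‖ + ρ := by
      have e : (z + W z) / 2 = z + (W z - z) / 2 := by ring
      have := hΓ.dist_lt _ _ hz1
      rw [dist_comm, dist_eq_norm] at this
      rw [e]
      refine (norm_add_le _ _).trans ?_
      rw [norm_div, Complex.norm_two]
      linarith
    have h1 := hfloor _ z ((Complex.abs_re_le_norm _).trans hm)
    have h2 := hfloor _ z ((Complex.abs_im_le_norm _).trans hm)
    have hq : 0 < 1 + ε * ‖z‖ := by positivity
    have key : ∀ y : ℝ, 0 < y → y ≤ C * (1 + ε * ‖z‖) → (1 + ε * ‖z‖)⁻¹ ≤ C * y⁻¹ := by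
      intro y hy hle
      rw [← div_eq_mul_inv, inv_le_comm₀ hq (by positivity), inv_div, div_le_iff₀ hC0]
      linarith
    have k1 := pow_le_pow_left₀ (by positivity) (key _ (by positivity) h1) 2
    have k2 := pow_le_pow_left₀ (by positivity) (key _ (by positivity) h2) 2
    have k3 := mul_le_mul k1 k2 (by positivity) (by positivity)
    calc cutoff ε z ^ 2 = (1 + ε * ‖z‖)⁻¹ ^ 2 * (1 + ε * ‖z‖)⁻¹ ^ 2 := by rw [cutoff]; ring
      _ ≤ _ := k3
      _ = _ := by simp only [F]; ring
  refine ⟨C ^ 4 * ∑' p : (ℤ × ℤ) × Bool, (1 + |(p.1.1 : ℝ)|)⁻¹ ^ 2 * (1 + |(p.1.2 : ℝ)|)⁻¹ ^ 2,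
    fun Z hZ => ?_⟩
  calc ∑ z ∈ Z, cutoff ε z ^ 2 ≤ ∑ z ∈ Z, C ^ 4 *
        ((1 + |((F z).1.1 : ℝ)|)⁻¹ ^ 2 * (1 + |((F z).1.2 : ℝ)|)⁻¹ ^ 2) :=
        Finset.sum_le_sum fun z hz => hcomp z (hZ z hz)
    _ = C ^ 4 * ∑ p ∈ Z.image F, (1 + |(p.1.1 : ℝ)|)⁻¹ ^ 2 * (1 + |(p.1.2 : ℝ)|)⁻¹ ^ 2 := by
        rw [Finset.sum_image fun z hz z' hz' h => hinj z z' (hZ z hz) (hZ z' hz') h,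
          Finset.mul_sum]
    _ ≤ _ := by
        gcongr
        exact summable_lattice.sum_le_tsum _ fun p _ => by positivity

/-- The critical eigenfunction `sin (θ_e / 2)` times the cutoff is square summable. -/
theorem memlp_cutoff (hΓ : IsIsoradial Γ ρ) (hk : 0 < k)
    (hθ : ∀ e ∈ Γ.edgeSet, k ≤ edgeAngle ρ e) {ε : ℝ} (hε : 0 < ε) :
    Memℓp (fun e : Γ.Dart => ((Real.sin (edgeAngle ρ e.edge / 2) * cutoff ε e.fst : ℝ) : ℂ)) 2 := by
  classical
  obtain ⟨C, hC⟩ := hΓ.summable_cutoff_aux hk hθ hε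
  refine memℓp_gen' (C := π / k * C) fun E => ?_
  have hf := hΓ.finite_neighborSet
  set Z := E.image fun e => e.fst with hZ
  have hsub : E ⊆ Z.biUnion (outDarts hf) := fun e he =>
    Finset.mem_biUnion.2 ⟨e.fst, Finset.mem_image_of_mem _ he, (mem_outDarts hf).2 rfl⟩
  calc ∑ e ∈ E, ‖((Real.sin (edgeAngle ρ e.edge / 2) * cutoff ε e.fst : ℝ) : ℂ)‖ ^
          (2 : ENNReal).toReal
      ≤ ∑ e ∈ E, cutoff ε e.fst ^ 2 := by
        refine Finset.sum_le_sum fun e _ => ?_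
        have h1 := Real.abs_sin_le_one (edgeAngle ρ e.edge / 2)
        have h2 := cutoff_pos hε e.fst
        rw [ENNReal.toReal_ofNat, Real.rpow_ofNat, Complex.norm_real, norm_mul, Real.norm_eq_abs,
          Real.norm_of_nonneg h2.le]
        exact pow_le_pow_left₀ (by positivity) (mul_le_of_le_one_left h2.le h1) 2
    _ ≤ ∑ e ∈ Z.biUnion (outDarts hf), cutoff ε e.fst ^ 2 :=
        Finset.sum_le_sum_of_subset_of_nonneg hsub fun _ _ _ => by positivity
    _ = ∑ z ∈ Z, ∑ e ∈ outDarts hf z, cutoff ε e.fst ^ 2 := by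
        refine Finset.sum_biUnion fun z _ z' _ hne => Finset.disjoint_left.2 fun g hg hg' => hne ?_
        rw [← (mem_outDarts hf).1 hg, ← (mem_outDarts hf).1 hg']
    _ ≤ ∑ z ∈ Z, π / k * cutoff ε z ^ 2 := by
        refine Finset.sum_le_sum fun z _ => ?_
        rw [sum_outDarts]
        have e1 : ∀ w ∈ nbrs hf z, atVertex (fun e : Γ.Dart => cutoff ε e.fst ^ 2) z w =
            cutoff ε z ^ 2 := fun w hw => atVertex_of_adj _ ((mem_nbrs hf).1 hw)
        rw [Finset.sum_congr rfl e1, Finset.sum_const, nsmul_eq_mul]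
        have := hΓ.card_nbrs_mul_le hθ z
        exact mul_le_mul_of_nonneg_right ((le_div_iff₀ hk).2 this) (by positivity)
    _ ≤ π / k * C := by
        rw [← Finset.mul_sum]
        refine mul_le_mul_of_nonneg_left (hC Z fun z hz => ?_) (by positivity)
        obtain ⟨e, -, rfl⟩ := Finset.mem_image.1 hz
        exact ⟨e.snd, e.adj⟩

/-- The transition operator moves the cutoff from the tails to the heads. -/
theorem rowSum_transition_cutoff (hΓ : IsIsoradial Γ ρ) (χ : ℂ → ℝ) (e : Γ.Dart) :
    rowSum (transition (weight ρ 1))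
      (fun e : Γ.Dart => ((Real.sin (edgeAngle ρ e.edge / 2) * χ e.fst : ℝ) : ℂ)) e =
      ((Real.sin (edgeAngle ρ e.edge / 2) * χ e.snd : ℝ) : ℂ) := by
  classical
  have hf := hΓ.finite_neighborSet
  obtain ⟨⟨z₀, z⟩, h⟩ := e
  have h₀ : Γ.Adj z z₀ := h.symm
  have hedge : (⟨(z₀, z), h⟩ : Γ.Dart).edge = s(z, z₀) := Sym2.eq_swap
  have hm := hΓ.edgeAngle_mem h₀
  rw [rowSum_eq_sum (F := outDarts hf z), sum_outDarts, hedge]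
  · have hterm : ∀ w ∈ nbrs hf z, atVertex (fun g : Γ.Dart =>
        transition (weight ρ 1) (⟨(z₀, z), h⟩ : Γ.Dart) g *
          ((Real.sin (edgeAngle ρ g.edge / 2) * χ g.fst : ℝ) : ℂ)) z w =
        if w = z₀ then 0 else (weight ρ 1 s(z, z₀) * χ z : ℝ) *
          (Complex.exp (Complex.I / 2 * (Complex.arg ((w - z) / (z - z₀)) : ℝ)) *
            (Real.sin (edgeAngle ρ s(z, w) / 2) : ℝ)) := by
      intro w hw
      have hw := (mem_nbrs hf).1 hw
      rw [atVertex_of_adj _ hw, transition]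
      by_cases hwz : w = z₀
      · subst hwz
        rw [if_pos rfl, if_neg, zero_mul]
        rintro ⟨-, h2⟩
        exact h2 rfl
      · rw [if_neg hwz, if_pos ⟨rfl, fun h2 => hwz (congrArg (fun g : Γ.Dart => g.snd) h2)⟩, hedge]
        simp only [turningAngle]
        have e2 : (⟨(z, w), hw⟩ : Γ.Dart).edge = s(z, w) := rfl
        rw [e2]
        push_cast
        ring
    rw [Finset.sum_congr rfl hterm,
      ← Finset.add_sum_erase _ _ ((mem_nbrs hf).2 h₀), if_pos rfl, zero_add]
    have e3 : ∀ w ∈ (nbrs hf z).erase z₀, (if w = z₀ then 0 else (weight ρ 1 s(z, z₀) * χ z : ℝ) *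
          (Complex.exp (Complex.I / 2 * (Complex.arg ((w - z) / (z - z₀)) : ℝ)) *
            ((Real.sin (edgeAngle ρ s(z, w) / 2) : ℝ) : ℂ))) =
        (weight ρ 1 s(z, z₀) * χ z : ℝ) *
          (Complex.exp (Complex.I / 2 * (Complex.arg ((w - z) / (z - z₀)) : ℝ)) *
            ((Real.sin (edgeAngle ρ s(z, w) / 2) : ℝ) : ℂ)) := fun w hw =>
      if_neg (Finset.ne_of_mem_erase hw)
    -- The sum over the outgoing edges is cos(θ/2), and the critical weight tan(θ/2) turns it back
    -- into sin(θ/2).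
    rw [Finset.sum_congr rfl e3, ← Finset.mul_sum,
      hΓ.sum_exp_mul_sin h₀ (fun _ => mem_nbrs hf), ← Complex.ofReal_mul, weight_one hm,
      Real.tan_eq_sin_div_cos]
    congr 1
    have : Real.cos (edgeAngle ρ s(z, z₀) / 2) ≠ 0 :=
      (Real.cos_pos_of_mem_Ioo ⟨by linarith [hm.1, Real.pi_pos], by linarith [hm.1, hm.2]⟩).ne'
    field_simp
  · intro g hg
    rw [mem_outDarts]
    by_contra hne
    exact hg (by rw [transition, if_neg fun h' => hne h'.1.symm])

/-- At criticality, the Kac-Ward operator of the full graph is bounded without a bounded left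
inverse. -/
theorem critical_full (hΓ : IsIsoradial Γ ρ) (hk : 0 < k)
    (hθ : ∀ e ∈ Γ.edgeSet, k ≤ edgeAngle ρ e) :
    ∃ T : EdgeSpace Γ →L[ℂ] EdgeSpace Γ, HasMatrix T (kacWardMatrix Γ (weight ρ 1)) ∧
      ¬∃ S : EdgeSpace Γ →L[ℂ] EdgeSpace Γ, S * T = 1 := by
  have hρ := hΓ.radius_pos
  have hf := hΓ.finite_neighborSet
  obtain ⟨a, ha, hx⟩ := hΓ.weight_bounds hk hθ one_pos
  obtain ⟨Λ, -, -, hΛ, -, -, -, -, -⟩ := exists_transition_operator hf ha hx one_pos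
    (hΓ.arg_sub_injOn_of_le le_rfl) (hΓ.sum_arctan_critical_le le_rfl)
  refine ⟨1 - Λ, hasMatrix_one_sub hf _ hΛ, ?_⟩
  rintro ⟨S, hS⟩
  -- Edges are shorter than 2ρ, so the cutoff with parameter ε yields ‖Tφ‖ ≤ η‖φ‖ with η = (1 +
  -- 2ρε)² - 1. A left inverse S would give ‖φ‖ ≤ ‖S‖η‖φ‖, impossible once ‖S‖η < 1.
  obtain ⟨ε, hε, hεS⟩ : ∃ ε : ℝ, 0 < ε ∧ ‖S‖ * ((1 + 2 * ρ * ε) ^ 2 - 1) < 1 := by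
    have hc : Continuous fun ε : ℝ => ‖S‖ * ((1 + 2 * ρ * ε) ^ 2 - 1) := by fun_prop
    have h0 : Filter.Tendsto (fun ε : ℝ => ‖S‖ * ((1 + 2 * ρ * ε) ^ 2 - 1)) (nhdsWithin 0 (Set.Ioi 0))
        (nhds 0) := by
      have := (hc.tendsto 0).mono_left (nhdsWithin_le_nhds (s := Set.Ioi 0))
      simpa using this
    obtain ⟨ε, h1, h2⟩ := ((h0.eventually_lt_const one_pos).and self_mem_nhdsWithin).exists
    exact ⟨ε, h2, h1⟩
  set η := (1 + 2 * ρ * ε) ^ 2 - 1 with hη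
  have hη0 : 0 ≤ η := by
    have : 0 < 2 * ρ * ε := by positivity
    nlinarith
  let φ : EdgeSpace Γ := ⟨_, hΓ.memlp_cutoff hk hθ hε⟩
  have hφe : ∀ e, φ e = ((Real.sin (edgeAngle ρ e.edge / 2) * cutoff ε e.fst : ℝ) : ℂ) := fun e => rfl
  have hT : ∀ e, ‖(1 - Λ) φ e‖ ≤ η * ‖φ e‖ := by
    intro e
    have h1 : (1 - Λ) φ e = φ e - Λ φ e := rfl
    have h2 : Λ φ e = ((Real.sin (edgeAngle ρ e.edge / 2) * cutoff ε e.snd : ℝ) : ℂ) := by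
      rw [hΛ]; exact hΓ.rowSum_transition_cutoff (cutoff ε) e
    have h3 := abs_cutoff_sub_le hε (r := 2 * ρ) (by positivity) (a := e.fst) (b := e.snd) (by
      rw [← dist_eq_norm]; exact (hΓ.dist_lt _ _ e.adj).le)
    rw [h1, h2, hφe, ← Complex.ofReal_sub, ← mul_sub, Complex.norm_real, Complex.norm_real,
      norm_mul, norm_mul, Real.norm_eq_abs (_ - _), Real.norm_of_nonneg (cutoff_pos hε e.fst).le]
    calc _ ≤ ‖Real.sin (edgeAngle ρ e.edge / 2)‖ * (η * cutoff ε e.fst) := by gcongr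
      _ = _ := by ring
  have hTn : ‖(1 - Λ) φ‖ ≤ η * ‖φ‖ := by
    refine norm_le_of_forall_sum_sq_le (by positivity) fun E => ?_
    calc ∑ e ∈ E, ‖(1 - Λ) φ e‖ ^ 2 ≤ ∑ e ∈ E, η ^ 2 * ‖φ e‖ ^ 2 := by
          refine Finset.sum_le_sum fun e _ => ?_
          rw [← mul_pow]
          exact pow_le_pow_left₀ (norm_nonneg _) (hT e) 2
      _ ≤ (η * ‖φ‖) ^ 2 := by
          rw [← Finset.mul_sum, mul_pow]
          exact mul_le_mul_of_nonneg_left (sum_norm_sq_le φ E) (sq_nonneg η)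
  have h4 : ‖φ‖ ≤ ‖S‖ * (η * ‖φ‖) := by
    have e : φ = S ((1 - Λ) φ) := by
      have := congrArg (fun B : EdgeSpace Γ →L[ℂ] EdgeSpace Γ => B φ) hS
      exact this.symm
    calc ‖φ‖ = ‖S ((1 - Λ) φ)‖ := congrArg norm e
      _ ≤ ‖S‖ * ‖(1 - Λ) φ‖ := S.le_opNorm _
      _ ≤ _ := by gcongr
  have hφ0 : 0 < ‖φ‖ := by
    refine norm_pos_iff.2 fun h0 => ?_
    obtain ⟨e₀, he₀, -⟩ := hΓ.cover 0
    induction e₀ using Sym2.ind with | _ z w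
    have h5 : φ ⟨(z, w), he₀⟩ = 0 := by rw [h0]; rfl
    have hm := hΓ.edgeAngle_mem he₀
    have h6 : 0 < Real.sin (edgeAngle ρ s(z, w) / 2) * cutoff ε z :=
      mul_pos (Real.sin_pos_of_pos_of_lt_pi (by linarith [hm.1]) (by linarith [hm.2, Real.pi_pos]))
        (cutoff_pos hε z)
    rw [hφe] at h5
    exact h6.ne' (Complex.ofReal_eq_zero.1 h5)
  have : ‖S‖ * (η * ‖φ‖) = ‖S‖ * η * ‖φ‖ := by ring
  nlinarith

end IsIsoradial

end KacWard

end
-- Assembly of the theorem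
theorem theorem2p2 (Γ : SimpleGraph ℂ) (ρ k K : ℝ) (hΓ : KacWard.IsIsoradial Γ ρ)
    (hk : 0 < k) (hK : K < π)
    (hθ : ∀ e ∈ Γ.edgeSet, k ≤ KacWard.edgeAngle ρ e ∧ KacWard.edgeAngle ρ e ≤ K) :
    -- the sums over walks of a given length are finite sums
    (∀ G : SimpleGraph ℂ, G ≤ Γ → ∀ (r : ℕ) (e g : G.Dart), (KacWard.walks G r e g).Finite) ∧
    -- supercritical weights, arbitrary subgraphs
    (∀ β : ℝ, 0 < β → β < 1 → ∀ G : SimpleGraph ℂ, G ≤ Γ →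
      KacWard.InverseIsWalkSeries G (KacWard.weight ρ β)) ∧
    -- critical weights, finite subgraphs
    (∀ G : SimpleGraph ℂ, G ≤ Γ → G.edgeSet.Finite →
      KacWard.InverseIsWalkSeries G (KacWard.weight ρ 1)) ∧
    -- exponential decay for supercritical weights, uniformly in the subgraph
    (∀ β : ℝ, 0 < β → β < 1 → ∃ C ε : ℝ, 0 < C ∧ 0 < ε ∧ ε < 1 ∧
      ∀ G : SimpleGraph ℂ, G ≤ Γ → ∀ (e g : G.Dart) (r : ℕ),
        ‖KacWard.walkSum G (KacWard.weight ρ β) r e g‖ ≤ C * ε ^ r) ∧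
    -- on the full graph the critical operator is bounded but has no bounded (left) inverse
    (∃ T : KacWard.EdgeSpace Γ →L[ℂ] KacWard.EdgeSpace Γ,
      KacWard.HasMatrix T (KacWard.kacWardMatrix Γ (KacWard.weight ρ 1)) ∧
      ¬ ∃ S : KacWard.EdgeSpace Γ →L[ℂ] KacWard.EdgeSpace Γ, S * T = 1) := by
  have hθk : ∀ e ∈ Γ.edgeSet, k ≤ KacWard.edgeAngle ρ e := fun e he => (hθ e he).1
  refine ⟨fun G hG => KacWard.finite_walks (hΓ.finite_neighborSet_of_le hG), ?_, ?_, ?_,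
    hΓ.critical_full hk hθk⟩
  · intro β hβ hβ1 G hG
    obtain ⟨C, ε, -, -, -, h⟩ := hΓ.supercritical hk hθk hβ hβ1
    exact (h G hG).1
  · intro G hG hfin
    exact hΓ.critical_finite hk hθk hG hfin
  · intro β hβ hβ1
    obtain ⟨C, ε, hC, hε, hε1, h⟩ := hΓ.supercritical hk hθk hβ hβ1
    exact ⟨C, ε, hC, hε, hε1, fun G hG => (h G hG).2⟩
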